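/- **Setting.** Let $\mathfrak X$ be a connected, second countable differentiable manifold (of class $C^1$) of dimension $n$ with a continuous Riemannian metric, $\mathrm{dist}$ its geodesic distance, and $\omega$ its Riemannian volume measure ($d\omega=\sqrt{\det g}\,dx_1\cdots dx_n$ in local coordinates). Let $\mathscr M(\mathfrak X)$ be the set of Borel probability measures on $\mathfrak X$ with the topology of weak convergence. Let $\mathrm g:\mathfrak X\times\mathfrak X\to(-\infty,+\infty]$, $V:\mathfrak X\to(-\infty,+\infty]$ and $\vartheta:\mathfrak X\to[0,+\infty)$ satisfy: 1. $\mathrm g$ is symmetric and lower semicontinuous, and for every $\epsilon>0$ there is $\delta>0$ such that $|\mathrm g(u,x)|\le\epsilon\,\mathrm{dist}(u,x)^{-n}$ for all $u\ne x$ with $\mathrm{dist}(u,x)\le\delta$. 2. There is a sequence of real numbers $\mathrm c_k\to0$ such that for every integer $k\ge1$ one can write $\mathrm g=\mathrm g_k+\mathrm g^k$ with $\mathrm g_k\le k$ real valued and continuous on $\mathfrak X\times\mathfrak X$, $\mathrm g^k:\mathfrak X\times\mathfrak X\to[0,+\infty]$, and, for some $p>1$, $\int\mathrm g^k(u,x)^p\,\omega(dx)\le\mathrm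 c_k$ for all $u\in\mathfrak X$. 3. $\vartheta$ is continuous and $-\mathrm g(u,x)\le\vartheta(u)+\vartheta(x)$ for all $u,x\in\mathfrak X$. 4. For every $\kappa\ge0$ the function $\widetilde V_\kappa=V-\kappa\vartheta$ is bounded from below, the set $\{\widetilde V_\kappa<+\infty\}$ is open and nonempty, $\widetilde V_\kappa$ is continuous on this set, and $\int e^{-\widetilde V_\kappa}d\omega<+\infty$ (with $e^{-\infty}=0$). (The kernel $\mathrm g$ is thus allowed to be unbounded from below.) For $\beta>0$ and $N\in\mathbb N$ consider on $\mathfrak X^N$ the Gibbs measure $$\mathbb P_N[d\mathbf x]=\frac{e^{-\mathscr H_N(\mathbf x)}}{\mathrm Z_N}\prod_{j=1}^N\omega(dx_j),\qquad \mathscr H_N(\mathbf x)=\beta\sum_{1\le i<j\le N}\mathrm g(x_i,x_j)+\sum_{j=1}^NV(x_j),\qquad \mathrm Z_N=\int e^{-\mathscr H_N(\mathbf x)}\prod_{j=1}^N\omega(dx_j),$$ and the empirical measure $\widehat\mu_N=N^{-1}\sum_{j=1}^N\delta_{x_j}$. For $\gamma>0$ let $\nu_\gamma$ be the probability measure proportional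 to $e^{-\widetilde V_\gamma}\omega$ and define the free energy $$\mathscr F_\gamma(\mu)=\frac\gamma2\iint\big(\mathrm g(x,z)+\vartheta(x)+\vartheta(z)\big)\mu(dz)\mu(dx)+\mathrm H(\mu|\nu_\gamma)\in[0,+\infty],\qquad\mu\in\mathscr M(\mathfrak X),$$ where $\mathrm H(\mu|\nu_\gamma)=\int\log\frac{d\mu}{d\nu_\gamma}d\mu$ if $\mu\ll\nu_\gamma$ and $+\infty$ otherwise. **Proposition.** Let $\gamma>0$ and let $\beta=\beta_N>0$ be a sequence with $N\beta_N\to\gamma$ as $N\to+\infty$. Then $0<\mathrm Z_N<+\infty$ for all $N$, $\mathscr F_\gamma$ is not identically $+\infty$, and under $\mathbb P_N$ the sequence of empirical measures $\widehat\mu_N$ satisfies a large deviation principle in $\mathscr M(\mathfrak X)$ with speed $\beta_NN^2\to+\infty$ and good rate function $$I=\gamma^{-1}\Big(\mathscr F_\gamma-\inf_{\mathscr M(\mathfrak X)}\mathscr F_\gamma\Big).$$ That is, $I$ is lower semicontinuous with compact sublevel sets $\{I\le r\}$, $r\ge0$, and for every closed $C\subset\mathscr M(\mathfrak X)$ and every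 open $O\subset\mathscr M(\mathfrak X)$, $$\limsup_{N\to\infty}\frac{1}{\beta_NN^2}\log\mathbb P_N[\widehat\mu_N\in C]\le-\inf_CI,\qquad\liminf_{N\to\infty}\frac{1}{\beta_NN^2}\log\mathbb P_N[\widehat\mu_N\in O]\ge-\inf_OI.$$ -/

import Mathlib

open scoped Manifold Topology ENNReal NNReal
open MeasureTheory Bundle Filter

noncomputable section RiemannianVolume

/-- Charts map measurable sets to measurable sets. -/
theorem measurableSet_chart_image {n : ℕ} {X : Type*} [TopologicalSpace X] [MeasurableSpace X]
    [BorelSpace X] (e : OpenPartialHomeomorph X (EuclideanSpace ℝ (Fin n)))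
    {s : Set X} (hs : MeasurableSet s) (hse : s ⊆ e.source) : MeasurableSet (e '' s) := by
  have h1 : Measurable (e.target.domRestrict e.symm) := e.continuousOn_symm.domRestrict.measurable
  have h2 := e.open_target.measurableSet.subtype_image (h1 hs)
  convert! h2 using 1
  rw [e.image_eq_target_inter_inv_preimage hse]
  ext y
  simp [Set.domRestrict, and_comm]

variable {n : ℕ} {X : Type*} [TopologicalSpace X] [ChartedSpace (EuclideanSpace ℝ (Fin n)) X]

/-- The coordinate vector field `∂ᵢ` of the chart `e`, at the point with coordinates `y`. -/
def coordVector (e : OpenPartialHomeomorph X (EuclideanSpace ℝ (Fin n)))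
    (y : EuclideanSpace ℝ (Fin n)) (i : Fin n) : TangentSpace (𝓡 n) (e.symm y) :=
  mfderiv (𝓡 n) (𝓡 n) e.symm y (EuclideanSpace.basisFun (Fin n) ℝ i)

/-- Countably many charts cover the manifold. -/
theorem exists_countable_charts (n : ℕ) (X : Type*) [TopologicalSpace X]
    [ChartedSpace (EuclideanSpace ℝ (Fin n)) X] [SecondCountableTopology X] [Nonempty X] :
    ∃ c : ℕ → X, ⋃ i, (chartAt (EuclideanSpace ℝ (Fin n)) (c i)).source = Set.univ := by
  obtain ⟨s, hs, hcov⟩ := TopologicalSpace.countable_cover_nhds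
    (f := fun x : X => (chartAt (EuclideanSpace ℝ (Fin n)) x).source)
    (fun x => (chartAt (EuclideanSpace ℝ (Fin n)) x).open_source.mem_nhds (mem_chart_source _ x))
  have hne : s.Nonempty := by
    by_contra h
    rw [Set.not_nonempty_iff_eq_empty] at h
    subst h
    simp at hcov
    exact (Set.univ_nonempty (α := X)).ne_empty hcov.symm
  obtain ⟨c, rfl⟩ := hs.exists_eq_range hne
  exact ⟨c, by simpa [Set.biUnion_range] using hcov⟩

variable [RiemannianBundle (fun x : X => TangentSpace (𝓡 n) x)]

/-- The matrix `(gᵢⱼ)` of the Riemannian metric in the chart `e`, as a function of the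
coordinates. -/
def metricMatrix (e : OpenPartialHomeomorph X (EuclideanSpace ℝ (Fin n)))
    (y : EuclideanSpace ℝ (Fin n)) : Matrix (Fin n) (Fin n) ℝ :=
  Matrix.of fun i j => inner ℝ (coordVector e y i) (coordVector e y j)

/-- The density `√det g` of the Riemannian volume in the chart `e`. -/
def volumeDensity (e : OpenPartialHomeomorph X (EuclideanSpace ℝ (Fin n)))
    (y : EuclideanSpace ℝ (Fin n)) : ℝ≥0∞ :=
  ENNReal.ofReal (Real.sqrt (metricMatrix e y).det)

/-- Transport of inner products of tangent vectors along an equality of base points. -/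
theorem inner_tangent_congr {x x' : X} (h : x = x') (v w : EuclideanSpace ℝ (Fin n)) :
    inner ℝ (show TangentSpace (𝓡 n) x from v) (show TangentSpace (𝓡 n) x from w) =
    inner ℝ (show TangentSpace (𝓡 n) x' from v) (show TangentSpace (𝓡 n) x' from w) := by
  subst h; rfl

/-- Change of charts: `det g` is multiplied by the square of the Jacobian determinant. -/
theorem det_metricMatrix_change [IsManifold (𝓡 n) 1 X]
    {e e' : OpenPartialHomeomorph X (EuclideanSpace ℝ (Fin n))}
    (he : e ∈ atlas (EuclideanSpace ℝ (Fin n)) X) (he' : e' ∈ atlas (EuclideanSpace ℝ (Fin n)) X)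
    {y : EuclideanSpace ℝ (Fin n)} (hy : y ∈ e.target) (hy' : e.symm y ∈ e'.source) :
    (metricMatrix e y).det =
      (fderiv ℝ (e' ∘ e.symm) y).det ^ 2 * (metricMatrix e' ((e' ∘ e.symm) y)).det := by
  set φ := e' ∘ e.symm with hφ
  have hpt : e'.symm (φ y) = e.symm y := e'.left_inv hy'
  have hed := mdifferentiable_of_mem_atlas (I := 𝓡 n) he
  have hed' := mdifferentiable_of_mem_atlas (I := 𝓡 n) he'
  have h1 : MDifferentiableAt (𝓡 n) (𝓡 n) e.symm y := hed.mdifferentiableAt_symm hy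
  have h2 : MDifferentiableAt (𝓡 n) (𝓡 n) e' (e.symm y) := hed'.mdifferentiableAt hy'
  have h3 : MDifferentiableAt (𝓡 n) (𝓡 n) φ y := h2.comp y h1
  have h4 : MDifferentiableAt (𝓡 n) (𝓡 n) e'.symm (φ y) :=
    hed'.mdifferentiableAt_symm (e'.map_source hy')
  have hev : (e.symm : EuclideanSpace ℝ (Fin n) → X) =ᶠ[𝓝 y] e'.symm ∘ φ := by
    have : ∀ᶠ z in 𝓝 y, e.symm z ∈ e'.source :=
      (e.continuousAt_symm hy).eventually (e'.open_source.mem_nhds hy')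
    filter_upwards [this] with z hz
    exact (e'.left_inv hz).symm
  have hd := hev.mfderiv_eq (I := 𝓡 n) (I' := 𝓡 n)
  have hd2 := mfderiv_comp (I := 𝓡 n) (I' := 𝓡 n) (I'' := 𝓡 n) y h4 h3
  have hvec : ∀ v : EuclideanSpace ℝ (Fin n),
      (show EuclideanSpace ℝ (Fin n) from mfderiv (𝓡 n) (𝓡 n) e.symm y v) =
      (show EuclideanSpace ℝ (Fin n) from mfderiv (𝓡 n) (𝓡 n) e'.symm (φ y) (fderiv ℝ φ y v)) := by
    intro v
    rw [← mfderiv_eq_fderiv]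
    have := congrArg (fun L => L v) hd
    have h' := congrArg (fun L => L v) hd2
    exact this.trans h'
  set L := fderiv ℝ φ y with hL
  let b := EuclideanSpace.basisFun (Fin n) ℝ
  let J : Matrix (Fin n) (Fin n) ℝ := LinearMap.toMatrix b.toBasis b.toBasis L.toLinearMap
  have hdet : J.det = L.det := by
    simp [J, ContinuousLinearMap.det, LinearMap.det_toMatrix]
  have hexp : ∀ j, L (b j) = ∑ i, J i j • b i := by
    intro j
    have := (b.toBasis.sum_repr (L (b j))).symm
    simpa [J, LinearMap.toMatrix_apply] using this
  let D : EuclideanSpace ℝ (Fin n) →L[ℝ] TangentSpace (𝓡 n) (e'.symm (φ y)) :=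
    mfderiv (𝓡 n) (𝓡 n) e'.symm (φ y)
  have hmat : metricMatrix e y = J.transpose * metricMatrix e' (φ y) * J := by
    ext i j
    have h1 : metricMatrix e y i j =
        inner ℝ (D (L (b i))) (D (L (b j))) := by
      have := inner_tangent_congr hpt.symm (coordVector e y i) (coordVector e y j)
      refine this.trans ?_
      have hi := hvec (b i)
      have hj := hvec (b j)
      change (coordVector e y i : EuclideanSpace ℝ (Fin n)) = D (L (b i)) at hi
      change (coordVector e y j : EuclideanSpace ℝ (Fin n)) = D (L (b j)) at hj
      rw [hi, hj]
    rw [h1, hexp, hexp, map_sum, map_sum]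
    simp only [map_smul, sum_inner, inner_sum, real_inner_smul_left, real_inner_smul_right]
    simp only [Matrix.mul_apply, Matrix.transpose_apply, Finset.sum_mul]
    refine Finset.sum_congr rfl fun k _ => Finset.sum_congr rfl fun l _ => ?_
    have : metricMatrix e' (φ y) l k = inner ℝ (D (b l)) (D (b k)) := rfl
    rw [this]; ring
  rw [hmat, Matrix.det_mul, Matrix.det_mul, Matrix.det_transpose, hdet]
  ring

/-- Change of charts for the density `√det g`. -/
theorem volumeDensity_change [IsManifold (𝓡 n) 1 X]
    {e e' : OpenPartialHomeomorph X (EuclideanSpace ℝ (Fin n))}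
    (he : e ∈ atlas (EuclideanSpace ℝ (Fin n)) X) (he' : e' ∈ atlas (EuclideanSpace ℝ (Fin n)) X)
    {y : EuclideanSpace ℝ (Fin n)} (hy : y ∈ e.target) (hy' : e.symm y ∈ e'.source) :
    volumeDensity e y = ENNReal.ofReal |(fderiv ℝ (e' ∘ e.symm) y).det| *
      volumeDensity e' ((e' ∘ e.symm) y) := by
  rw [volumeDensity, det_metricMatrix_change he he' hy hy', Real.sqrt_mul (sq_nonneg _),
    Real.sqrt_sq_eq_abs, ENNReal.ofReal_mul (abs_nonneg _), volumeDensity]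


/-- The Riemannian volume on the domain of the chart `e`: the image under `e⁻¹` of the measure
`√det g dx₁ ⋯ dxₙ`. -/
def chartVolume [MeasurableSpace X] [BorelSpace X]
    (e : OpenPartialHomeomorph X (EuclideanSpace ℝ (Fin n))) : Measure X :=
  (((volume : Measure (EuclideanSpace ℝ (Fin n))).restrict e.target).withDensity
    (volumeDensity e)).map e.symm

/-- The chart volume of a subset of the chart domain. -/
theorem chartVolume_apply [MeasurableSpace X] [BorelSpace X]
    (e : OpenPartialHomeomorph X (EuclideanSpace ℝ (Fin n)))
    {s : Set X} (hs : MeasurableSet s) (hse : s ⊆ e.source) :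
    chartVolume e s = ∫⁻ y in e '' s, volumeDensity e y := by
  have hme : MeasurableSet e.target := e.open_target.measurableSet
  have hmeas : AEMeasurable e.symm
      (((volume : Measure (EuclideanSpace ℝ (Fin n))).restrict e.target).withDensity
        (volumeDensity e)) :=
    (e.continuousOn_symm.aemeasurable hme).mono_ac (withDensity_absolutelyContinuous _ _)
  have himg : e '' s = e.target ∩ e.symm ⁻¹' s := e.image_eq_target_inter_inv_preimage hse
  have hmi : MeasurableSet (e '' s) := measurableSet_chart_image e hs hse
  have hnull : ((volume : Measure (EuclideanSpace ℝ (Fin n))).restrict e.target).withDensity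
        (volumeDensity e) e.targetᶜ = 0 :=
    withDensity_absolutelyContinuous _ _ (by simp [Measure.restrict_apply hme.compl])
  rw [chartVolume, Measure.map_apply_of_aemeasurable hmeas hs,
    ← measure_inter_conull (t := e.target) (by simpa using hnull), Set.inter_comm, ← himg,
    withDensity_apply _ hmi, Measure.restrict_restrict hmi,
    Set.inter_eq_left.mpr (himg.trans_subset Set.inter_subset_left)]

/-- The chart volumes of two charts agree on the intersection of their domains. -/
theorem lintegral_volumeDensity_change [MeasurableSpace X] [BorelSpace X] [IsManifold (𝓡 n) 1 X]
    {e e' : OpenPartialHomeomorph X (EuclideanSpace ℝ (Fin n))}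
    (he : e ∈ atlas (EuclideanSpace ℝ (Fin n)) X) (he' : e' ∈ atlas (EuclideanSpace ℝ (Fin n)) X)
    {s : Set X} (hs : MeasurableSet s) (hse : s ⊆ e.source) (hse' : s ⊆ e'.source) :
    ∫⁻ y in e' '' s, volumeDensity e' y = ∫⁻ y in e '' s, volumeDensity e y := by
  have himg : e' '' s = (e' ∘ e.symm) '' (e '' s) := by
    rw [Set.image_image]
    exact Set.image_congr fun x hx => by simp [e.left_inv (hse hx)]
  have hmem : ∀ y ∈ e '' s, y ∈ e.target ∧ e.symm y ∈ s := by
    rintro _ ⟨x, hx, rfl⟩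
    exact ⟨e.map_source (hse hx), by rwa [e.left_inv (hse hx)]⟩
  have hmi : MeasurableSet (e '' s) := measurableSet_chart_image e hs hse
  have hinj : Set.InjOn (e' ∘ e.symm) (e '' s) := by
    intro y hy z hz h
    have h1 := e'.injOn (hse' (hmem y hy).2) (hse' (hmem z hz).2) h
    exact e.symm.injOn (hmem y hy).1 (hmem z hz).1 h1
  have hdiff : ∀ y ∈ e '' s, HasFDerivWithinAt (e' ∘ e.symm) (fderiv ℝ (e' ∘ e.symm) y)
      (e '' s) y := by
    intro y hy
    have h1 := (mdifferentiable_of_mem_atlas (I := 𝓡 n) he).mdifferentiableAt_symm (hmem y hy).1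
    have h2 := (mdifferentiable_of_mem_atlas (I := 𝓡 n) he').mdifferentiableAt
      (hse' (hmem y hy).2)
    have h3 : MDifferentiableAt (𝓡 n) (𝓡 n) (e' ∘ e.symm) y := h2.comp y h1
    exact h3.differentiableAt.hasFDerivAt.hasFDerivWithinAt
  rw [himg, lintegral_image_eq_lintegral_abs_det_fderiv_mul _ hmi hdiff hinj]
  exact setLIntegral_congr_fun hmi fun y hy =>
    (volumeDensity_change he he' (hmem y hy).1 (hse' (hmem y hy).2)).symm

/-- The Riemannian volume measure `ω`, glued from the chart volumes along a countable cover by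
charts; it does not depend on the cover, see `riemannianVolume_apply`. -/
def riemannianVolume (n : ℕ) (X : Type*) [TopologicalSpace X]
    [ChartedSpace (EuclideanSpace ℝ (Fin n)) X]
    [RiemannianBundle (fun x : X => TangentSpace (𝓡 n) x)]
    [SecondCountableTopology X] [Nonempty X] [MeasurableSpace X] [BorelSpace X] : Measure X :=
  let e : ℕ → OpenPartialHomeomorph X (EuclideanSpace ℝ (Fin n)) :=
    fun i => chartAt (EuclideanSpace ℝ (Fin n)) ((exists_countable_charts n X).choose i)
  Measure.sum fun i => (chartVolume (e i)).restrict (disjointed (fun j => (e j).source) i)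

/-- In every chart of the atlas, the Riemannian volume is `√det g dx₁ ⋯ dxₙ`. -/
theorem riemannianVolume_apply [SecondCountableTopology X] [Nonempty X] [MeasurableSpace X]
    [BorelSpace X] [IsManifold (𝓡 n) 1 X]
    {e : OpenPartialHomeomorph X (EuclideanSpace ℝ (Fin n))}
    (he : e ∈ atlas (EuclideanSpace ℝ (Fin n)) X)
    {s : Set X} (hs : MeasurableSet s) (hse : s ⊆ e.source) :
    riemannianVolume n X s = ∫⁻ y in e '' s, volumeDensity e y := by
  set f : ℕ → OpenPartialHomeomorph X (EuclideanSpace ℝ (Fin n)) :=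
    fun i => chartAt (EuclideanSpace ℝ (Fin n)) ((exists_countable_charts n X).choose i) with hf
  set A : ℕ → Set X := disjointed (fun j => (f j).source) with hA
  have hAm : ∀ i, MeasurableSet (A i) :=
    fun i => MeasurableSet.disjointed (fun j => (f j).open_source.measurableSet) i
  have hAs : ∀ i, A i ⊆ (f i).source := fun i => disjointed_subset _ i
  have hAd : Pairwise (Function.onFun Disjoint A) := disjoint_disjointed _
  have hAu : ⋃ i, A i = Set.univ := by
    rw [hA, iUnion_disjointed]; exact (exists_countable_charts n X).choose_spec
  have hpart : s = ⋃ i, s ∩ A i := by rw [← Set.inter_iUnion, hAu, Set.inter_univ]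
  have hterm : ∀ i, (chartVolume (f i)).restrict (A i) s =
      ∫⁻ y in e '' (s ∩ A i), volumeDensity e y := by
    intro i
    have hsi : MeasurableSet (s ∩ A i) := hs.inter (hAm i)
    rw [Measure.restrict_apply hs, chartVolume_apply (f i) hsi (Set.inter_subset_right.trans (hAs i))]
    exact lintegral_volumeDensity_change he (chart_mem_atlas _ _) hsi
      (Set.inter_subset_left.trans hse) (Set.inter_subset_right.trans (hAs i))
  have hsum : riemannianVolume n X s = ∑' i, (chartVolume (f i)).restrict (A i) s :=
    Measure.sum_apply _ hs
  rw [hsum]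
  simp_rw [hterm]
  have himg : e '' s = ⋃ i, e '' (s ∩ A i) := by rw [← Set.image_iUnion, ← hpart]
  rw [himg, lintegral_iUnion
    (fun i => measurableSet_chart_image e (hs.inter (hAm i)) (Set.inter_subset_left.trans hse))]
  intro i j hij
  refine Set.disjoint_left.mpr ?_
  rintro _ ⟨x, hx, rfl⟩ ⟨z, hz, hzx⟩
  have h := e.injOn (hse hz.1) (hse hx.1) hzx
  subst h
  exact Set.disjoint_left.mp (hAd hij) hx.2 hz.2

end RiemannianVolume

noncomputable section GibbsMeasure

variable {X : Type*} [MeasurableSpace X]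

/-- The energy `H_N(x) = β ∑_{i < j} g(x_i, x_j) + ∑_j V(x_j)` of a configuration. The values of
`g` and `V` are meant to lie in `(-∞, +∞]`. -/
def gibbsEnergy (β : ℝ) (g : X → X → EReal) (V : X → EReal) {N : ℕ} (x : Fin N → X) : EReal :=
  (β : EReal) * (∑ i, ∑ j ∈ Finset.Ioi i, g (x i) (x j)) + ∑ j, V (x j)

/-- The partition function `∫ e^{-H_N} dω^{⊗N}`. -/
def partitionFunction (ω : Measure X) (β : ℝ) (g : X → X → EReal) (V : X → EReal) (N : ℕ) :
    ℝ≥0∞ :=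
  ∫⁻ x : Fin N → X, EReal.exp (-gibbsEnergy β g V x) ∂(Measure.pi fun _ => ω)

/-- The Gibbs measure on `X^N`. -/
def gibbsMeasure (ω : Measure X) (β : ℝ) (g : X → X → EReal) (V : X → EReal) (N : ℕ) :
    Measure (Fin N → X) :=
  (partitionFunction ω β g V N)⁻¹ •
    (Measure.pi fun _ => ω).withDensity fun x => EReal.exp (-gibbsEnergy β g V x)

/-- The empirical measure `N⁻¹ ∑_j δ_{x_j}`; a probability measure when `N ≥ 1`. -/
def empiricalMeasure {N : ℕ} (x : Fin N → X) : Measure X :=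
  (N : ℝ≥0∞)⁻¹ • ∑ j, Measure.dirac (x j)

/-- The probability, under the Gibbs measure on `X^N`, that the empirical measure belongs to the
set `A` of probability measures. -/
def empiricalLaw (ω : Measure X) (β : ℝ) (g : X → X → EReal) (V : X → EReal) (N : ℕ)
    (A : Set (ProbabilityMeasure X)) : ℝ≥0∞ :=
  gibbsMeasure ω β g V N {x | ∃ μ ∈ A, (μ : Measure X) = empiricalMeasure x}

/-- The potential `V - κ ϑ`. -/
def shiftedPotential (V : X → EReal) (ϑ : X → ℝ) (κ : ℝ) (x : X) : EReal :=
  V x - ((κ * ϑ x : ℝ) : EReal)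

/-- The reference probability measure `ν_κ ∝ e^{-(V - κ ϑ)} ω`. -/
def referenceMeasure (ω : Measure X) (V : X → EReal) (ϑ : X → ℝ) (κ : ℝ) : Measure X :=
  (∫⁻ x, EReal.exp (-shiftedPotential V ϑ κ x) ∂ω)⁻¹ •
    ω.withDensity fun x => EReal.exp (-shiftedPotential V ϑ κ x)

/-- The weighted energy `∬ (g(x, z) + ϑ(x) + ϑ(z)) μ(dz) μ(dx)`, whose integrand is nonnegative
when `-g(x, z) ≤ ϑ(x) + ϑ(z)`. -/
def weightedEnergy (g : X → X → EReal) (ϑ : X → ℝ) (μ : Measure X) : ℝ≥0∞ :=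
  ∫⁻ x, ∫⁻ z, (g x z + ((ϑ x + ϑ z : ℝ) : EReal)).toENNReal ∂μ ∂μ

/-- The free energy `(γ / 2) ∬ (g(x, z) + ϑ(x) + ϑ(z)) μ(dz) μ(dx) + H(μ | ν_γ)`. -/
def freeEnergy (ω : Measure X) (g : X → X → EReal) (V : X → EReal) (ϑ : X → ℝ) (γ : ℝ)
    (μ : Measure X) : ℝ≥0∞ :=
  ENNReal.ofReal (γ / 2) * weightedEnergy g ϑ μ +
    InformationTheory.klDiv μ (referenceMeasure ω V ϑ γ)

end GibbsMeasure

section Assumptions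

/-- Regularity and integrability of a potential `U : X → (-∞, +∞]`: the set `{U < +∞}` is open and
nonempty, `U` is continuous on it, and `∫ e^{-U} dω < +∞`. -/
structure IsAdmissiblePotential {X : Type*} [TopologicalSpace X] [MeasurableSpace X]
    (ω : Measure X) (U : X → EReal) : Prop where
  isOpen : IsOpen {x | U x < ⊤}
  nonempty : {x | U x < ⊤}.Nonempty
  continuousOn : ContinuousOn U {x | U x < ⊤}
  lintegral_lt_top : ∫⁻ x, EReal.exp (-U x) ∂ω < ⊤

/-- Conditions on the two-body kernel `g : X × X → (-∞, +∞]` on a space of dimension `n`. -/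
structure IsAdmissibleKernel (n : ℕ) {X : Type*} [MetricSpace X] [MeasurableSpace X]
    (ω : Measure X) (g : X → X → EReal) : Prop where
  symm : ∀ u x, g u x = g x u
  lowerSemicontinuous : LowerSemicontinuous fun q : X × X => g q.1 q.2
  /-- `|g(u, x)| ≤ ε dist(u, x)⁻ⁿ` at small distances (off the diagonal, where the right-hand side
  is finite). -/
  singularity : ∀ ε : ℝ, 0 < ε → ∃ δ : ℝ, 0 < δ ∧ ∀ u x, u ≠ x → dist u x ≤ δ →
    (g u x).abs ≤ ENNReal.ofReal (ε * (dist u x ^ n)⁻¹)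
  /-- `g = g_k + g^k` with `g_k ≤ k` continuous, `g^k ≥ 0` and `∫ g^k(u, x)^p ω(dx) ≤ c_k → 0`. -/
  decomposition : ∃ c : ℕ → ℝ, Tendsto c atTop (𝓝 0) ∧ ∀ k : ℕ, 1 ≤ k →
    ∃ (gc : X → X → ℝ) (gs : X → X → ℝ≥0∞) (p : ℝ), 1 < p ∧
      Continuous (fun q : X × X => gc q.1 q.2) ∧ (∀ u x, gc u x ≤ k) ∧
      (∀ u x, g u x = (gc u x : EReal) + (gs u x : EReal)) ∧
      ∀ u, ∫⁻ x, gs u x ^ p ∂ω ≤ ENNReal.ofReal (c k)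

/-- The assumptions on a kernel `g`, possibly not bounded below, a potential `V` and a compensating
function `ϑ`. -/
structure GasAssumptions (n : ℕ) {X : Type*} [MetricSpace X] [MeasurableSpace X]
    (ω : Measure X) (g : X → X → EReal) (V : X → EReal) (ϑ : X → ℝ) : Prop where
  kernel : IsAdmissibleKernel n ω g
  continuous_theta : Continuous ϑ
  theta_nonneg : ∀ x, 0 ≤ ϑ x
  neg_kernel_le : ∀ u x, -g u x ≤ ((ϑ u + ϑ x : ℝ) : EReal)
  bddBelow : ∀ κ : ℝ, 0 ≤ κ → ∃ m : ℝ, ∀ x, (m : EReal) ≤ shiftedPotential V ϑ κ x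
  potential : ∀ κ : ℝ, 0 ≤ κ → IsAdmissiblePotential ω (shiftedPotential V ϑ κ)

/-- Large deviation principle on `Y` with speed `a` and (good) rate function `I`, where `p N A` is
the probability that the `N`-th random element of `Y` belongs to `A`. -/
structure SatisfiesLDP {Y : Type*} [TopologicalSpace Y] (p : ℕ → Set Y → ℝ≥0∞) (a : ℕ → ℝ)
    (I : Y → ℝ≥0∞) : Prop where
  tendsto_speed : Tendsto a atTop atTop
  lowerSemicontinuous : LowerSemicontinuous I
  isCompact_sublevel : ∀ r : ℝ≥0, IsCompact {y | I y ≤ r}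
  upper_bound : ∀ C : Set Y, IsClosed C →
    limsup (fun N => (((a N)⁻¹ : ℝ) : EReal) * ENNReal.log (p N C)) atTop ≤
      -(⨅ y ∈ C, (I y : EReal))
  lower_bound : ∀ O : Set Y, IsOpen O →
    -(⨅ y ∈ O, (I y : EReal)) ≤
      liminf (fun N => (((a N)⁻¹ : ℝ) : EReal) * ENNReal.log (p N O)) atTop

end Assumptions

/-!
Since `-g(x, z) ≤ ϑ(x) + ϑ(z)`, the kernel `G(x, z) = g(x, z) + ϑ(x) + ϑ(z)` is nonnegative, and
moving `β ∑_{i < j} (ϑ(x_i) + ϑ(x_j)) = β (N - 1) ∑_j ϑ(x_j)` from the potential to the kernel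
turns `ℙ_N` into the law with density proportional to `exp (-β ∑_{i < j} G(x_i, x_j))` with respect
to independent points of law `ν_κ`, where `κ = β (N - 1) → γ`. The laws `ν_κ` are exponential tilts
of `ν_γ` by `(κ - γ) ϑ`, and `ϑ` has all exponential moments, so `ν_κ` can be replaced by `ν_γ` in
the limit.

Upper bound: `ℱ_γ` is the supremum of the weakly continuous functionals
`(γ / 2) ∬ φ dμ dμ + ∫ f dμ - ∫ (e^f - 1) dν_γ` over bounded continuous `φ ≤ G` and `f`. Near a
point where such a functional exceeds `c`, the weight `exp (-β ∑_{i < j} G(x_i, x_j))` is at most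
about `exp (-N (c + ∫ (e^f - 1) dν_γ))` times the product of the `e^{f(x_j)}`, so Chernoff's bound
applies there; exponential tightness and compactness turn this into a bound on closed sets. Lower
bound: let the points be independent of law `μ`. By Jensen's inequality this costs `N` times the
interaction energy of `μ` plus `N H(μ | ν_κ)`, while the law of large numbers puts the empirical
measure in any neighbourhood of `μ`. A ratio of such bounds is the large deviation principle.
-/

section RiemannianVolumeProperties

variable {n : ℕ} {X : Type*} [TopologicalSpace X] [ChartedSpace (EuclideanSpace ℝ (Fin n)) X]
  [IsManifold (𝓡 n) 1 X]

theorem continuousOn_coordVector {e : OpenPartialHomeomorph X (EuclideanSpace ℝ (Fin n))}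
    (he : e ∈ atlas (EuclideanSpace ℝ (Fin n)) X) (i : Fin n) :
    ContinuousOn (fun y => (⟨e.symm y, coordVector e y i⟩ : TangentBundle (𝓡 n) X)) e.target := by
  have hsymm : ContMDiffOn (𝓡 n) (𝓡 n) 1 e.symm e.target :=
    contMDiffOn_symm_of_mem_maximalAtlas (IsManifold.subset_maximalAtlas he)
  have htangent := hsymm.continuousOn_tangentMapWithin le_rfl e.open_target.uniqueMDiffOn
  let basisVector (y : EuclideanSpace ℝ (Fin n)) :
      TangentBundle (𝓡 n) (EuclideanSpace ℝ (Fin n)) := ⟨y, EuclideanSpace.basisFun (Fin n) ℝ i⟩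
  have hbasis : Continuous basisVector :=
    (tangentBundleModelSpaceHomeomorph (𝓡 n)).symm.continuous.comp
      (Continuous.prodMk_left (EuclideanSpace.basisFun (Fin n) ℝ i))
  refine (htangent.comp hbasis.continuousOn fun y hy => hy).congr fun y hy => ?_
  exact (tangentMapWithin_eq_tangentMap (I := 𝓡 n) (I' := 𝓡 n) (p := basisVector y)
    (e.open_target.uniqueMDiffOn y hy)
    ((mdifferentiable_of_mem_atlas (I := 𝓡 n) he).mdifferentiableAt_symm hy)).symm

variable [RiemannianBundle (fun x : X => TangentSpace (𝓡 n) x)]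

theorem det_metricMatrix_pos {e : OpenPartialHomeomorph X (EuclideanSpace ℝ (Fin n))}
    (he : e ∈ atlas (EuclideanSpace ℝ (Fin n)) X) {y : EuclideanSpace ℝ (Fin n)}
    (hy : y ∈ e.target) : 0 < (metricMatrix e y).det := by
  have hinj : Function.Injective (mfderiv (𝓡 n) (𝓡 n) e.symm y) :=
    (mdifferentiable_of_mem_atlas (I := 𝓡 n) he).symm.mfderiv_injective hy
  have hindep : LinearIndependent ℝ (coordVector e y) := by
    have hbasis := (EuclideanSpace.basisFun (Fin n) ℝ).toBasis.linearIndependent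
    rw [OrthonormalBasis.coe_toBasis] at hbasis
    exact hbasis.map' (mfderiv (𝓡 n) (𝓡 n) e.symm y).toLinearMap (LinearMap.ker_eq_bot.mpr hinj)
  have hgram : Matrix.gram ℝ (coordVector e y) = metricMatrix e y := rfl
  exact hgram ▸ (Matrix.posDef_gram_of_linearIndependent (𝕜 := ℝ) hindep).det_pos

theorem volumeDensity_pos {e : OpenPartialHomeomorph X (EuclideanSpace ℝ (Fin n))}
    (he : e ∈ atlas (EuclideanSpace ℝ (Fin n)) X) {y : EuclideanSpace ℝ (Fin n)}
    (hy : y ∈ e.target) : 0 < volumeDensity e y :=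
  ENNReal.ofReal_pos.2 (Real.sqrt_pos.2 (det_metricMatrix_pos he hy))

variable [IsContinuousRiemannianBundle (EuclideanSpace ℝ (Fin n))
  (fun x : X => TangentSpace (𝓡 n) x)]

theorem continuousOn_volumeDensity {e : OpenPartialHomeomorph X (EuclideanSpace ℝ (Fin n))}
    (he : e ∈ atlas (EuclideanSpace ℝ (Fin n)) X) : ContinuousOn (volumeDensity e) e.target := by
  have hmatrix : ContinuousOn (metricMatrix e) e.target :=
    continuousOn_pi.2 fun i => continuousOn_pi.2 fun j =>
      ContinuousOn.inner_bundle (continuousOn_coordVector he i) (continuousOn_coordVector he j)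
  exact ENNReal.continuous_ofReal.comp_continuousOn (Real.continuous_sqrt.comp_continuousOn
    ((Continuous.matrix_det continuous_id).comp_continuousOn hmatrix))

variable [SecondCountableTopology X] [Nonempty X] [MeasurableSpace X] [BorelSpace X]

instance isOpenPosMeasure_riemannianVolume : (riemannianVolume n X).IsOpenPosMeasure := by
  refine ⟨fun U hU ⟨x, hxU⟩ hU_null => ?_⟩
  set e := chartAt (EuclideanSpace ℝ (Fin n)) x
  have he : e ∈ atlas (EuclideanSpace ℝ (Fin n)) X := chart_mem_atlas _ x
  set s := U ∩ e.source
  have hs : IsOpen s := hU.inter e.open_source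
  have hs_image : IsOpen (e '' s) := e.isOpen_image_of_subset_source hs Set.inter_subset_right
  have hs_target : e '' s ⊆ e.target := by
    rintro _ ⟨z, hz, rfl⟩
    exact e.map_source hz.2
  have hs_null : ∫⁻ y in e '' s, volumeDensity e y = 0 := by
    rw [← riemannianVolume_apply he hs.measurableSet Set.inter_subset_right]
    exact measure_mono_null Set.inter_subset_left hU_null
  rw [lintegral_eq_zero_iff' (((continuousOn_volumeDensity he).mono hs_target).aemeasurable
    hs_image.measurableSet)] at hs_null
  have hfalse : ∀ᵐ _ ∂volume.restrict (e '' s), False := by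
    filter_upwards [hs_null, ae_restrict_mem hs_image.measurableSet] with y hy hys
    exact (volumeDensity_pos he (hs_target hys)).ne' hy
  rw [Filter.eventually_false_iff_eq_bot, ae_eq_bot, Measure.restrict_eq_zero] at hfalse
  exact (hs_image.measure_pos volume ⟨e x, x, ⟨hxU, mem_chart_source _ x⟩, rfl⟩).ne' hfalse

instance isLocallyFiniteMeasure_riemannianVolume :
    IsLocallyFiniteMeasure (riemannianVolume n X) := by
  refine ⟨fun x => ?_⟩
  set e := chartAt (EuclideanSpace ℝ (Fin n)) x
  have he : e ∈ atlas (EuclideanSpace ℝ (Fin n)) X := chart_mem_atlas _ x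
  have hx : x ∈ e.source := mem_chart_source _ x
  have hcont : ContinuousAt (volumeDensity e) (e x) :=
    (continuousOn_volumeDensity he).continuousAt (e.open_target.mem_nhds (e.map_source hx))
  have hbound : ∀ᶠ y in 𝓝 (e x), volumeDensity e y < volumeDensity e (e x) + 1 :=
    hcont.eventually (gt_mem_nhds (ENNReal.lt_add_right ENNReal.ofReal_ne_top one_ne_zero))
  obtain ⟨r, hr, hball⟩ := Metric.eventually_nhds_iff_ball.1 hbound
  set s := e.source ∩ e ⁻¹' Metric.ball (e x) r
  have hs : IsOpen s := e.isOpen_inter_preimage Metric.isOpen_ball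
  have hs_image : e '' s ⊆ Metric.ball (e x) r := by
    rintro _ ⟨z, hz, rfl⟩
    exact hz.2
  refine ⟨s, hs.mem_nhds ⟨hx, Metric.mem_ball_self hr⟩, ?_⟩
  rw [riemannianVolume_apply he hs.measurableSet Set.inter_subset_left]
  calc ∫⁻ y in e '' s, volumeDensity e y
      ≤ ∫⁻ _ in e '' s, (volumeDensity e (e x) + 1) :=
        setLIntegral_mono measurable_const fun y hy => (hball y (hs_image hy)).le
    _ = (volumeDensity e (e x) + 1) * volume (e '' s) := setLIntegral_const _ _
    _ < ⊤ := ENNReal.mul_lt_top (by simp [volumeDensity])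
        ((measure_mono hs_image).trans_lt measure_ball_lt_top)

end RiemannianVolumeProperties

section LipschitzMinorant

open scoped BoundedContinuousFunction

variable {Y : Type*} [PseudoEMetricSpace Y]

/-- The Moreau–Yosida regularisation of `min f m`: its largest minorant that is Lipschitz with
constant `m`. -/
noncomputable def lipschitzMinorant (f : Y → ℝ≥0∞) (m : ℝ≥0) (y : Y) : ℝ≥0∞ :=
  ⨅ z, (min (f z) m + m * edist y z)

variable (f : Y → ℝ≥0∞) (m : ℝ≥0) (y : Y)

theorem lipschitzMinorant_le_min : lipschitzMinorant f m y ≤ min (f y) m :=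
  (iInf_le _ y).trans_eq (by rw [edist_self, mul_zero, add_zero])

theorem lipschitzMinorant_ne_top : lipschitzMinorant f m y ≠ ⊤ :=
  ne_top_of_le_ne_top ENNReal.coe_ne_top ((lipschitzMinorant_le_min f m y).trans (min_le_right _ _))

theorem monotone_lipschitzMinorant : Monotone (lipschitzMinorant f) := fun m k hmk y => by
  have hmk' : (m : ℝ≥0∞) ≤ k := by exact_mod_cast hmk
  exact iInf_mono fun z => by gcongr

theorem continuous_lipschitzMinorant : Continuous (lipschitzMinorant f m) := by
  refine continuous_of_le_add_edist m ENNReal.coe_ne_top fun x y => ?_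
  simp only [lipschitzMinorant, ENNReal.iInf_add]
  refine le_iInf fun z => (iInf_le _ z).trans ?_
  rw [add_assoc, ← mul_add, add_comm (edist y z)]
  gcongr
  exact edist_triangle _ _ _

theorem exists_boundedContinuous_eq_lipschitzMinorant :
    ∃ φ : Y →ᵇ ℝ≥0, ∀ y, (φ y : ℝ≥0∞) = lipschitzMinorant f m y := by
  have hcont : Continuous fun y => (lipschitzMinorant f m y).toNNReal :=
    ENNReal.continuousOn_toNNReal.comp_continuous (continuous_lipschitzMinorant f m)
      (lipschitzMinorant_ne_top f m)
  have hle (y : Y) : (lipschitzMinorant f m y).toNNReal ≤ m :=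
    ENNReal.toNNReal_mono ENNReal.coe_ne_top
      ((lipschitzMinorant_le_min f m y).trans (min_le_right _ _))
  refine ⟨.mkOfBound ⟨_, hcont⟩ m fun x y => ?_, fun y =>
    ENNReal.coe_toNNReal (lipschitzMinorant_ne_top f m y)⟩
  have hx : ((lipschitzMinorant f m x).toNNReal : ℝ) ≤ m := by exact_mod_cast hle x
  have hy : ((lipschitzMinorant f m y).toNNReal : ℝ) ≤ m := by exact_mod_cast hle y
  rw [NNReal.dist_eq]
  exact abs_sub_le_of_nonneg_of_le NNReal.zero_le_coe hx NNReal.zero_le_coe hy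

variable {f}

theorem iSup_lipschitzMinorant_natCast (hf : LowerSemicontinuous f) :
    ⨆ m : ℕ, lipschitzMinorant f m y = f y := by
  refine le_antisymm
    (iSup_le fun m => (lipschitzMinorant_le_min f m y).trans (min_le_left _ _)) ?_
  refine le_of_forall_lt_imp_le_of_dense fun c hc => ?_
  obtain ⟨ε, hε, hball⟩ := Metric.nhds_basis_eball.mem_iff.1 (hf y c hc)
  obtain ⟨m, hcm, hcmε⟩ : ∃ m : ℕ, c ≤ m ∧ c ≤ m * ε := by
    have hlarge : Tendsto (fun m : ℕ => (m : ℝ≥0∞)) atTop (𝓝 ⊤) := ENNReal.tendsto_nat_nhds_top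
    have hlarge_mul : Tendsto (fun m : ℕ => (m : ℝ≥0∞) * ε) atTop (𝓝 ⊤) := by
      have hmul := ENNReal.Tendsto.mul_const (b := ε) hlarge (.inl ENNReal.top_ne_zero)
      rwa [ENNReal.top_mul hε.ne'] at hmul
    exact ((hlarge.eventually_const_le hc.lt_top).and
      (hlarge_mul.eventually_const_le hc.lt_top)).exists
  refine le_iSup_of_le m (le_iInf fun z => ?_)
  rcases lt_or_ge (edist z y) ε with hz | hz
  · exact (le_min (hball hz).le (by exact_mod_cast hcm)).trans le_self_add
  · rw [edist_comm] at hz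
    calc c ≤ m * ε := hcmε
      _ ≤ m * edist y z := by gcongr
      _ ≤ _ := le_add_self

theorem lintegral_eq_iSup_boundedContinuous_le {Y : Type*} [TopologicalSpace Y]
    [TopologicalSpace.PseudoMetrizableSpace Y] [MeasurableSpace Y] [OpensMeasurableSpace Y]
    (μ : Measure Y) {f : Y → ℝ≥0∞} (hf : LowerSemicontinuous f) :
    ∫⁻ y, f y ∂μ =
      ⨆ (φ : Y →ᵇ ℝ≥0) (_ : ∀ y, (φ y : ℝ≥0∞) ≤ f y), ∫⁻ y, (φ y : ℝ≥0∞) ∂μ := by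
  let := TopologicalSpace.pseudoMetrizableSpacePseudoMetric Y
  refine le_antisymm ?_ (iSup₂_le fun φ hφ => lintegral_mono hφ)
  calc ∫⁻ y, f y ∂μ = ∫⁻ y, ⨆ m : ℕ, lipschitzMinorant f m y ∂μ :=
        lintegral_congr fun y => (iSup_lipschitzMinorant_natCast y hf).symm
    _ = ⨆ m : ℕ, ∫⁻ y, lipschitzMinorant f m y ∂μ :=
        lintegral_iSup (fun m => (continuous_lipschitzMinorant f m).measurable)
          ((monotone_lipschitzMinorant f).comp Nat.mono_cast)
    _ ≤ _ := iSup_le fun m => by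
        obtain ⟨φ, hφ⟩ := exists_boundedContinuous_eq_lipschitzMinorant f m
        refine le_iSup₂_of_le φ (fun y => ?_) (lintegral_congr hφ).ge
        exact (hφ y).trans_le ((lipschitzMinorant_le_min f m y).trans (min_le_left _ _))

end LipschitzMinorant

section EntropyDuality

open InformationTheory Real
open scoped BoundedContinuousFunction

theorem mul_le_klFun_add_exp_sub_one (a : ℝ) {r : ℝ} (hr : 0 ≤ r) :
    a * r ≤ klFun r + exp a - 1 := by
  rw [klFun_apply]
  rcases hr.eq_or_lt with rfl | hr
  · simp [exp_nonneg]
  · have htangent := add_one_le_exp (a - log r)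
    rw [exp_sub, exp_log hr, le_div_iff₀ hr] at htangent
    linarith

/-- The truncation of `r` to the interval `[1 / (m + 1), m + 1]`. -/
noncomputable def truncate (m : ℕ) (r : ℝ) : ℝ := max (1 / ((m : ℝ) + 1)) (min r (m + 1))

theorem truncate_pos (m : ℕ) (r : ℝ) : 0 < truncate m r :=
  (by positivity : (0 : ℝ) < 1 / ((m : ℝ) + 1)).trans_le (le_max_left _ _)

theorem measurable_truncate (m : ℕ) : Measurable (truncate m) := by
  unfold truncate
  fun_prop

theorem truncate_le (m : ℕ) (r : ℝ) : truncate m r ≤ m + 1 := by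
  have hm : (1 : ℝ) ≤ m + 1 := by linarith [m.cast_nonneg (α := ℝ)]
  exact max_le ((div_le_one (by positivity)).2 hm |>.trans hm) (min_le_right _ _)

theorem abs_log_truncate_le (m : ℕ) (r : ℝ) : |log (truncate m r)| ≤ log (m + 1) := by
  refine abs_le.2 ⟨?_, log_le_log (truncate_pos m r) (truncate_le m r)⟩
  rw [← log_inv, ← one_div]
  exact log_le_log (by positivity) (le_max_left _ _)

theorem sub_truncate_mul_log_truncate_nonneg (m : ℕ) (r : ℝ) :
    0 ≤ (r - truncate m r) * log (truncate m r) := by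
  have hm : (1 : ℝ) ≤ m + 1 := by linarith [m.cast_nonneg (α := ℝ)]
  have hm' : 1 / ((m : ℝ) + 1) ≤ 1 := (div_le_one (by positivity)).2 hm
  unfold truncate
  rcases le_total r (m + 1) with hr | hr
  · rcases le_total (1 / ((m : ℝ) + 1)) r with hr' | hr'
    · rw [min_eq_left hr, max_eq_right hr', sub_self, zero_mul]
    · rw [min_eq_left hr, max_eq_left hr']
      exact mul_nonneg_of_nonpos_of_nonpos (by linarith) (log_nonpos (by positivity) hm')
  · rw [min_eq_right hr, max_eq_right (hm'.trans hm)]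
    exact mul_nonneg (by linarith) (log_nonneg hm)

theorem mul_log_truncate_sub_nonneg (m : ℕ) (r : ℝ) :
    0 ≤ r * log (truncate m r) - (truncate m r - 1) := by
  have hkl := klFun_nonneg (truncate_pos m r).le
  rw [klFun_apply] at hkl
  linarith [sub_truncate_mul_log_truncate_nonneg m r]

theorem tendsto_truncate {r : ℝ} (hr : 0 ≤ r) :
    Tendsto (fun m => truncate m r) atTop (𝓝 r) := by
  have hmax : Tendsto (fun m : ℕ => max (1 / ((m : ℝ) + 1)) r) atTop (𝓝 r) := by
    simpa only [max_eq_right hr] using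
      (tendsto_one_div_add_atTop_nhds_zero_nat (𝕜 := ℝ)).max (tendsto_const_nhds (x := r))
  refine hmax.congr' ?_
  filter_upwards [tendsto_natCast_atTop_atTop.eventually_ge_atTop r] with m hm
  rw [truncate, min_eq_left (by linarith)]

theorem tendsto_mul_log_truncate_sub {r : ℝ} (hr : 0 ≤ r) :
    Tendsto (fun m => r * log (truncate m r) - (truncate m r - 1)) atTop (𝓝 (klFun r)) := by
  have hlog : Tendsto (fun m => r * log (truncate m r)) atTop (𝓝 (r * log r)) := by
    rcases hr.eq_or_lt with rfl | hr'
    · simp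
    · exact ((tendsto_truncate hr).log hr'.ne').const_mul _
  convert hlog.sub ((tendsto_truncate hr).sub_const 1) using 2
  rw [klFun_apply]
  ring

variable {X : Type*} [MeasurableSpace X] (μ ν : Measure X)

/-- The functional of `f` whose supremum is the relative entropy of `μ` with respect to `ν`
(Donsker–Varadhan). It is concave in `f`, and affine in `μ`. -/
noncomputable def entropyDual (f : X → ℝ) : ℝ := ∫ x, f x ∂μ - ∫ x, (exp (f x) - 1) ∂ν

variable [IsFiniteMeasure μ]

variable {μ ν} in
theorem exists_measurable_lt_entropyDual_of_not_ac (hac : ¬ μ ≪ ν) {c : ℝ} (hc : 0 ≤ c) :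
    ∃ (f : X → ℝ) (B : ℝ), Measurable f ∧ (∀ x, |f x| ≤ B) ∧ c < entropyDual μ ν f := by
  obtain ⟨A, hA, hνA, hμA⟩ : ∃ A, MeasurableSet A ∧ ν A = 0 ∧ μ A ≠ 0 := by
    by_contra! h
    exact hac (Measure.AbsolutelyContinuous.mk h)
  have hpos : 0 < μ.real A := ENNReal.toReal_pos hμA (measure_ne_top _ _)
  set t : ℝ := (c + 1) / μ.real A with ht
  have ht0 : 0 ≤ t := by positivity
  refine ⟨A.indicator fun _ => t, t, measurable_const.indicator hA, fun x => ?_, ?_⟩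
  · by_cases hx : x ∈ A <;> simp [hx, ht0, abs_of_nonneg]
  · have hexp : (fun x => exp (A.indicator (fun _ => t) x) - 1) =ᵐ[ν] 0 := by
      filter_upwards [measure_eq_zero_iff_ae_notMem.1 hνA] with x hx
      simp [hx]
    rw [entropyDual, integral_indicator_const _ hA, integral_eq_zero_of_ae hexp, smul_eq_mul, ht,
      mul_div_cancel₀ _ hpos.ne']
    linarith

variable [IsFiniteMeasure ν]

theorem lintegral_le_klDiv_add_lintegral_exp {f : X → ℝ} (hf : Measurable f) :
    ∫⁻ x, ENNReal.ofReal (f x) ∂μ ≤ klDiv μ ν + ∫⁻ x, ENNReal.ofReal (exp (f x)) ∂ν := by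
  by_cases hac : μ ≪ ν
  swap
  · simp [klDiv_of_not_ac hac]
  rw [klDiv_eq_lintegral_klFun_of_ac hac, ← lintegral_rnDeriv_mul hac (by fun_prop),
    ← lintegral_add_right _ (by fun_prop)]
  refine lintegral_mono_ae ?_
  filter_upwards [μ.rnDeriv_lt_top ν] with x hx
  rw [← ENNReal.ofReal_add (klFun_nonneg ENNReal.toReal_nonneg) (exp_nonneg _)]
  nth_rw 1 [← ENNReal.ofReal_toReal hx.ne]
  rw [← ENNReal.ofReal_mul ENNReal.toReal_nonneg, mul_comm]
  refine ENNReal.ofReal_le_ofReal ?_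
  linarith [mul_le_klFun_add_exp_sub_one (f x) (ENNReal.toReal_nonneg (a := μ.rnDeriv ν x))]

variable {μ ν}

theorem entropyDual_eq_integral_rnDeriv (hac : μ ≪ ν) {f : X → ℝ} (hf : Integrable f μ)
    (hexp : Integrable (fun x => exp (f x)) ν) :
    Integrable (fun x => (μ.rnDeriv ν x).toReal * f x - (exp (f x) - 1)) ν ∧
      entropyDual μ ν f = ∫ x, ((μ.rnDeriv ν x).toReal * f x - (exp (f x) - 1)) ∂ν := by
  have hmul : Integrable (fun x => (μ.rnDeriv ν x).toReal * f x) ν :=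
    (integrable_rnDeriv_smul_iff hac).2 hf
  have hsub : Integrable (fun x => exp (f x) - 1) ν := hexp.sub (integrable_const 1)
  refine ⟨hmul.sub hsub, ?_⟩
  rw [integral_sub hmul hsub, entropyDual, ← integral_rnDeriv_smul hac]
  rfl

theorem ofReal_entropyDual_le_klDiv {f : X → ℝ} (hf : Integrable f μ)
    (hexp : Integrable (fun x => exp (f x)) ν) :
    ENNReal.ofReal (entropyDual μ ν f) ≤ klDiv μ ν := by
  by_cases hkl : klDiv μ ν = ⊤
  · exact hkl ▸ le_top
  obtain ⟨hac, hllr⟩ := klDiv_ne_top_iff.1 hkl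
  obtain ⟨hint, heq⟩ := entropyDual_eq_integral_rnDeriv hac hf hexp
  refine ENNReal.ofReal_le_of_le_toReal ?_
  rw [toReal_klDiv_eq_integral_klFun hac, heq]
  refine integral_mono hint ((integrable_klFun_rnDeriv_iff hac).2 hllr) fun x => ?_
  dsimp only
  linarith [mul_le_klFun_add_exp_sub_one (f x) (ENNReal.toReal_nonneg (a := μ.rnDeriv ν x))]

theorem integrable_exp_of_abs_le {f : X → ℝ} (hf : Measurable f) {B : ℝ} (hB : ∀ x, |f x| ≤ B) :
    Integrable (fun x => exp (f x)) ν := by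
  refine .of_bound (by fun_prop) (exp B) (ae_of_all _ fun x => ?_)
  rw [norm_eq_abs, abs_exp]
  exact exp_le_exp.2 ((le_abs_self _).trans (hB x))

theorem integrable_of_abs_le {f : X → ℝ} (hf : Measurable f) {B : ℝ} (hB : ∀ x, |f x| ≤ B) :
    Integrable f μ :=
  .of_bound hf.aestronglyMeasurable B (ae_of_all _ hB)

/-- The supremum is formally attained at `f = log dμ/dν`; truncating the density makes this
function bounded, at a price that vanishes by Fatou's lemma. -/
theorem exists_measurable_lt_entropyDual_of_ac (hac : μ ≪ ν) {c : ℝ} (hc : 0 ≤ c)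
    (hlt : ENNReal.ofReal c < klDiv μ ν) :
    ∃ (f : X → ℝ) (B : ℝ), Measurable f ∧ (∀ x, |f x| ≤ B) ∧ c < entropyDual μ ν f := by
  set r : X → ℝ := fun x => (μ.rnDeriv ν x).toReal
  have hr : Measurable r := by fun_prop
  have htrunc (m : ℕ) : Measurable fun x => truncate m (r x) := (measurable_truncate m).comp hr
  have hfatou : klDiv μ ν ≤ liminf (fun m => ∫⁻ x, ENNReal.ofReal
      (r x * log (truncate m (r x)) - (truncate m (r x) - 1)) ∂ν) atTop := by
    rw [klDiv_eq_lintegral_klFun_of_ac hac]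
    refine le_trans (le_of_eq (lintegral_congr fun x => ?_))
      (lintegral_liminf_le fun m => by fun_prop)
    exact (ENNReal.tendsto_ofReal
      (tendsto_mul_log_truncate_sub ENNReal.toReal_nonneg)).liminf_eq.symm
  obtain ⟨m, hm⟩ := (eventually_lt_of_lt_liminf (hlt.trans_le hfatou)).exists
  have hmeas : Measurable fun x => log (truncate m (r x)) := by fun_prop
  have hbound (x : X) : |log (truncate m (r x))| ≤ log (m + 1) := abs_log_truncate_le m (r x)
  refine ⟨_, _, hmeas, hbound, ?_⟩
  obtain ⟨hint, heq⟩ := entropyDual_eq_integral_rnDeriv hac (integrable_of_abs_le hmeas hbound)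
    (integrable_exp_of_abs_le (ν := ν) hmeas hbound)
  simp only [exp_log (truncate_pos m _)] at hint heq
  rwa [heq, ← ENNReal.ofReal_lt_ofReal_iff_of_nonneg hc, ofReal_integral_eq_lintegral_ofReal hint
    (ae_of_all _ fun x => mul_log_truncate_sub_nonneg m (r x))]

theorem entropyDual_sub_le {f g : X → ℝ} {B : ℝ} (hf : Measurable f) (hg : Measurable g)
    (hfB : ∀ x, |f x| ≤ B) (hgB : ∀ x, |g x| ≤ B) :
    entropyDual μ ν f - entropyDual μ ν g ≤ (1 + exp B) * ∫ x, |f x - g x| ∂(μ + ν) := by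
  have habs (x : X) : |(|f x - g x|)| ≤ B + B := by
    rw [abs_abs]
    exact (abs_sub _ _).trans (add_le_add (hfB x) (hgB x))
  have habsμ : Integrable (fun x => |f x - g x|) μ := integrable_of_abs_le (by fun_prop) habs
  have habsν : Integrable (fun x => |f x - g x|) ν := integrable_of_abs_le (by fun_prop) habs
  have hfμ : Integrable f μ := integrable_of_abs_le hf hfB
  have hgμ : Integrable g μ := integrable_of_abs_le hg hgB
  have hfν : Integrable (fun x => exp (f x) - 1) ν :=
    (integrable_exp_of_abs_le hf hfB).sub (integrable_const 1)
  have hgν : Integrable (fun x => exp (g x) - 1) ν :=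
    (integrable_exp_of_abs_le hg hgB).sub (integrable_const 1)
  have hlinear : ∫ x, f x ∂μ - ∫ x, g x ∂μ ≤ ∫ x, |f x - g x| ∂μ := by
    rw [← integral_sub hfμ hgμ]
    exact integral_mono (hfμ.sub hgμ) habsμ fun x => le_abs_self _
  have hexp : ∫ x, (exp (g x) - 1) ∂ν - ∫ x, (exp (f x) - 1) ∂ν
      ≤ exp B * ∫ x, |f x - g x| ∂ν := by
    rw [← integral_sub hgν hfν, ← integral_const_mul]
    refine integral_mono (hgν.sub hfν) (habsν.const_mul _) fun x => ?_
    have htangent := add_one_le_exp (f x - g x)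
    have hsplit : exp (f x) = exp (g x) * exp (f x - g x) := by rw [← exp_add]; ring_nf
    calc exp (g x) - 1 - (exp (f x) - 1) ≤ exp (g x) * (g x - f x) := by
          rw [hsplit]; nlinarith [exp_pos (g x)]
      _ ≤ exp (g x) * |f x - g x| := by gcongr; exact (le_abs_self _).trans_eq (abs_sub_comm _ _)
      _ ≤ exp B * |f x - g x| := by gcongr; exact (le_abs_self _).trans (hgB x)
  have hμ : 0 ≤ ∫ x, |f x - g x| ∂μ := integral_nonneg fun x => abs_nonneg _
  have hν : 0 ≤ ∫ x, |f x - g x| ∂ν := integral_nonneg fun x => abs_nonneg _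
  rw [integral_add_measure habsμ habsν, entropyDual, entropyDual]
  nlinarith [exp_pos B, hμ, hν]

variable [TopologicalSpace X] [TopologicalSpace.PseudoMetrizableSpace X] [BorelSpace X]

theorem exists_boundedContinuous_abs_le_integral_abs_sub_le {f : X → ℝ} (hf : Measurable f)
    {B : ℝ} (hB : ∀ x, |f x| ≤ B) {ε : ℝ} (hε : 0 < ε) :
    ∃ g : X →ᵇ ℝ, (∀ x, |g x| ≤ B) ∧ ∫ x, |f x - g x| ∂μ ≤ ε := by
  rcases isEmpty_or_nonempty X with hX | ⟨⟨x₀⟩⟩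
  · exact ⟨0, fun x => (hX.false x).elim, (integral_of_isEmpty.trans_le hε.le)⟩
  have hB0 : 0 ≤ B := (abs_nonneg _).trans (hB x₀)
  have hfint : Integrable f μ := integrable_of_abs_le hf hB
  obtain ⟨g, hg, -⟩ := hfint.exists_boundedContinuous_integral_sub_le hε
  have hgB (x : X) : |max (-B) (min (g x) B)| ≤ B :=
    abs_le.2 ⟨le_max_left _ _, max_le (by linarith) (min_le_right _ _)⟩
  refine ⟨.ofNormedAddCommGroup (fun x => max (-B) (min (g x) B)) (by fun_prop) B hgB, hgB,
    (integral_mono_of_nonneg (ae_of_all _ fun x => abs_nonneg _) (hfint.sub (g.integrable μ)).abs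
      (ae_of_all _ fun x => ?_)).trans hg⟩
  have hclamp : f x = max (-B) (min (f x) B) := by
    rw [min_eq_left (abs_le.1 (hB x)).2, max_eq_right (abs_le.1 (hB x)).1]
  calc |f x - max (-B) (min (g x) B)|
      = |max (-B) (min (f x) B) - max (-B) (min (g x) B)| := by rw [← hclamp]
    _ ≤ |min (f x) B - min (g x) B| := by
        simpa using abs_max_sub_max_le_max (-B) (min (f x) B) (-B) (min (g x) B)
    _ ≤ |f x - g x| := by simpa using abs_min_sub_min_le_max (f x) B (g x) B

variable (μ ν)

theorem klDiv_eq_iSup_entropyDual :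
    klDiv μ ν = ⨆ f : X →ᵇ ℝ, ENNReal.ofReal (entropyDual μ ν f) := by
  have hbounded (f : X →ᵇ ℝ) (x : X) : |f x| ≤ ‖f‖ := f.norm_coe_le_norm x
  refine le_antisymm (le_of_forall_lt fun a ha => ?_) (iSup_le fun f =>
    ofReal_entropyDual_le_klDiv (f.integrable μ)
      (integrable_exp_of_abs_le f.continuous.measurable (hbounded f)))
  obtain ⟨c, rfl⟩ : ∃ c : ℝ≥0, (c : ℝ≥0∞) = a := ⟨a.toNNReal, ENNReal.coe_toNNReal ha.ne_top⟩
  rw [← ENNReal.ofReal_coe_nnreal] at ha ⊢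
  obtain ⟨f, B, hf, hB, hlt⟩ : ∃ (f : X → ℝ) (B : ℝ), Measurable f ∧ (∀ x, |f x| ≤ B) ∧
      (c : ℝ) < entropyDual μ ν f := by
    by_cases hac : μ ≪ ν
    · exact exists_measurable_lt_entropyDual_of_ac hac c.coe_nonneg ha
    · exact exists_measurable_lt_entropyDual_of_not_ac hac c.coe_nonneg
  set ε := (entropyDual μ ν f - c) / (2 * (1 + exp B)) with hε
  have hε0 : 0 < ε := div_pos (by linarith) (by positivity)
  obtain ⟨g, hgB, hg⟩ :=
    exists_boundedContinuous_abs_le_integral_abs_sub_le (μ := μ + ν) hf hB hε0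
  refine lt_iSup_iff.2 ⟨g, (ENNReal.ofReal_lt_ofReal_iff_of_nonneg c.coe_nonneg).2 ?_⟩
  have herr : (1 + exp B) * ∫ x, |f x - g x| ∂(μ + ν) ≤ (entropyDual μ ν f - c) / 2 :=
    (mul_le_mul_of_nonneg_left hg (by positivity)).trans_eq (by rw [hε]; field_simp)
  linarith [entropyDual_sub_le (μ := μ) (ν := ν) hf g.continuous.measurable hB hgB]

end EntropyDuality

section ProductMeasures

variable {X : Type*} [MeasurableSpace X]

theorem lintegral_pi_fin_prod {N : ℕ} (μ : Fin N → Measure X) [∀ i, SigmaFinite (μ i)]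
    {f : Fin N → X → ℝ≥0∞} (hf : ∀ i, Measurable (f i)) :
    ∫⁻ x, ∏ i, f i (x i) ∂(Measure.pi μ) = ∏ i, ∫⁻ y, f i y ∂(μ i) := by
  induction N with
  | zero => simp
  | succ N ih =>
    have hpres := (measurePreserving_piFinSuccAbove μ 0).symm
    have hsplit := lintegral_prod_mul (μ := μ 0) (ν := Measure.pi fun j => μ (Fin.succAbove 0 j))
      (f := f 0) (g := fun y => ∏ i, f i.succ (y i)) (hf 0).aemeasurable
      (Finset.measurable_prod _ fun i _ =>
        (hf i.succ).comp (measurable_pi_apply i)).aemeasurable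
    rw [ih (fun j => μ (Fin.succAbove 0 j)) (fun i => hf i.succ)] at hsplit
    rw [← hpres.lintegral_comp (by fun_prop)]
    simpa [Fin.prod_univ_succ] using hsplit

theorem pi_withDensity {N : ℕ} (ω : Measure X) [SigmaFinite ω] {f : X → ℝ≥0∞} (hf : Measurable f)
    [SigmaFinite (ω.withDensity f)] :
    (Measure.pi fun _ : Fin N => ω.withDensity f) =
      (Measure.pi fun _ : Fin N => ω).withDensity fun x => ∏ i, f (x i) := by
  refine Measure.pi_eq fun s hs => ?_
  rw [withDensity_apply _ (MeasurableSet.univ_pi hs), Measure.restrict_pi_pi,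
    lintegral_pi_fin_prod _ (fun _ => hf)]
  exact Finset.prod_congr rfl fun i _ => (withDensity_apply _ (hs i)).symm

theorem map_infinitePi_comp_val (μ : Measure X) [IsProbabilityMeasure μ] (N : ℕ) :
    (Measure.infinitePi fun _ : ℕ => μ).map (fun x (i : Fin N) => x i) =
      Measure.pi fun _ : Fin N => μ := by
  rw [← Measure.infinitePi_eq_pi]
  exact Measure.map_infinitePi_infinitePi_of_inj (P := fun _ : ℕ => μ) Fin.val_injective

theorem ae_infinitePi_tendsto_average (μ : Measure X) [IsProbabilityMeasure μ] {f : X → ℝ}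
    (hf : Measurable f) (hint : Integrable f μ) :
    ∀ᵐ x ∂(Measure.infinitePi fun _ : ℕ => μ),
      Tendsto (fun N : ℕ => (∑ i ∈ Finset.range N, f (x i)) / N) atTop (𝓝 (∫ y, f y ∂μ)) := by
  set P := Measure.infinitePi fun _ : ℕ => μ
  have hpres (i : ℕ) : MeasurePreserving (fun x : ℕ → X => x i) P μ :=
    measurePreserving_eval_infinitePi _ i
  have hlaw (i : ℕ) : P.map (fun x => f (x i)) = μ.map f := by
    rw [← (hpres i).map_eq, Measure.map_map hf (by fun_prop)]
    rfl
  have hmean : ∫ x, f (x 0) ∂P = ∫ y, f y ∂μ := by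
    rw [← (hpres 0).map_eq, integral_map (hpres 0).measurable.aemeasurable
      hf.aestronglyMeasurable]
  have hindep : ProbabilityTheory.iIndepFun (fun (i : ℕ) (x : ℕ → X) => f (x i)) P :=
    ProbabilityTheory.iIndepFun_infinitePi (X := fun _ => f) fun _ => hf
  rw [← hmean]
  exact ProbabilityTheory.strong_law_ae_real (fun (i : ℕ) (x : ℕ → X) => f (x i))
    ((hpres 0).integrable_comp_of_integrable hint) (fun i j hij => hindep.indepFun hij)
    fun i => ⟨(by fun_prop : Measurable _).aemeasurable, (by fun_prop : Measurable _).aemeasurable,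
      (hlaw i).trans (hlaw 0).symm⟩

theorem tendsto_pi_le_abs_average_sub (μ : Measure X) [IsProbabilityMeasure μ] {f : X → ℝ}
    (hf : Measurable f) (hint : Integrable f μ) {δ : ℝ} (hδ : 0 < δ) :
    Tendsto (fun N : ℕ => (Measure.pi fun _ : Fin N => μ)
      {x | δ ≤ |(∑ j, f (x j)) / N - ∫ y, f y ∂μ|}) atTop (𝓝 0) := by
  have hmeasure := tendstoInMeasure_iff_norm.1 (tendstoInMeasure_of_tendsto_ae
    (fun N => (by fun_prop : Measurable fun x : ℕ → X =>
      (∑ i ∈ Finset.range N, f (x i)) / N).aestronglyMeasurable)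
    (ae_infinitePi_tendsto_average μ hf hint)) δ hδ
  refine hmeasure.congr fun N => ?_
  rw [← map_infinitePi_comp_val μ N, Measure.map_apply (by fun_prop)
    (measurableSet_le measurable_const (by fun_prop))]
  simp only [Finset.sum_range, Real.norm_eq_abs, Set.preimage_ofPred_eq]

end ProductMeasures

section MeanFieldEnergy

open InformationTheory
open scoped BoundedContinuousFunction

/-- The mean-field free energy `(γ / 2) ∬ G dμ dμ + H(μ | ν)` of a nonnegative pair interaction. -/
noncomputable def meanFieldEnergy {X : Type*} [MeasurableSpace X] (G : X → X → ℝ≥0∞)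
    (ν : Measure X) (γ : ℝ) (μ : Measure X) : ℝ≥0∞ :=
  ENNReal.ofReal (γ / 2) * ∫⁻ x, ∫⁻ z, G x z ∂μ ∂μ + klDiv μ ν

/-- The weakly continuous functionals of `μ` whose supremum over `φ ≤ G` and `f` is the mean-field
free energy. -/
noncomputable def dualEnergy {X : Type*} [MeasurableSpace X] [TopologicalSpace X]
    (φ : X × X →ᵇ ℝ≥0) (f : X →ᵇ ℝ) (ν : Measure X) (γ : ℝ) (μ : Measure X) : ℝ :=
  γ / 2 * (∫⁻ q, φ q ∂(μ.prod μ)).toReal + entropyDual μ ν f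

/-- A function with relatively compact sublevel sets. -/
structure IsExhaustion {Y : Type*} [MeasurableSpace Y] [TopologicalSpace Y] (h : Y → ℕ) :
    Prop where
  measurable : Measurable h
  exists_isCompact : ∀ k, ∃ K, IsCompact K ∧ {x | h x ≤ k} ⊆ K

theorem IsExhaustion.isCompact_closure_lintegral_le {Y : Type*} [MeasurableSpace Y]
    [TopologicalSpace Y] [T2Space Y] [BorelSpace Y] {h : Y → ℕ} (hh : IsExhaustion h)
    {L : ℝ≥0∞} (hL : L ≠ ⊤) :
    IsCompact (closure {μ : ProbabilityMeasure Y | ∫⁻ x, h x ∂(μ : Measure Y) ≤ L}) := by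
  refine isCompact_closure_of_isTightMeasureSet ?_
  rw [isTightMeasureSet_iff_exists_isCompact_measure_compl_le]
  intro ε hε
  obtain ⟨k, hk⟩ : ∃ k : ℕ, L ≤ ((k + 1 : ℕ) : ℝ≥0∞) * ε := by
    have hlarge := ENNReal.Tendsto.mul_const (b := ε)
      (ENNReal.tendsto_nat_nhds_top.comp (tendsto_add_atTop_nat 1)) (.inl ENNReal.top_ne_zero)
    rw [ENNReal.top_mul hε.ne'] at hlarge
    exact (hlarge.eventually_const_le hL.lt_top).exists
  obtain ⟨K, hKcompact, hK⟩ := hh.exists_isCompact k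
  refine ⟨K, hKcompact, ?_⟩
  rintro _ ⟨μ, hμ, rfl⟩
  have hsubset : Kᶜ ⊆ {x | ((k + 1 : ℕ) : ℝ≥0∞) ≤ h x} := fun x hx =>
    (Nat.cast_le (α := ℝ≥0∞)).2 (Nat.succ_le_of_lt (not_le.1 fun hle => hx (hK hle)))
  have hmarkov := mul_meas_ge_le_lintegral (μ := (μ : Measure Y)) (f := fun x => (h x : ℝ≥0∞))
    (measurable_from_top.comp hh.measurable) ((k + 1 : ℕ) : ℝ≥0∞)
  refine (ENNReal.mul_le_mul_iff_right (a := ((k + 1 : ℕ) : ℝ≥0∞)) (by simp) (by simp)).1 ?_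
  calc ((k + 1 : ℕ) : ℝ≥0∞) * (μ : Measure Y) Kᶜ
      ≤ (k + 1 : ℕ) * (μ : Measure Y) {x | ((k + 1 : ℕ) : ℝ≥0∞) ≤ h x} := by gcongr
    _ ≤ L := hmarkov.trans hμ
    _ ≤ (k + 1 : ℕ) * ε := hk

variable {X : Type*} [MeasurableSpace X] [TopologicalSpace X] [BorelSpace X]
  [SecondCountableTopology X] [TopologicalSpace.PseudoMetrizableSpace X]

theorem continuous_dualEnergy (φ : X × X →ᵇ ℝ≥0) (f : X →ᵇ ℝ) (ν : Measure X) (γ : ℝ) :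
    Continuous fun μ : ProbabilityMeasure X => dualEnergy φ f ν γ μ := by
  have hquadratic : Continuous fun μ : ProbabilityMeasure X =>
      (∫⁻ q, φ q ∂((μ : Measure X).prod (μ : Measure X))).toReal :=
    NNReal.continuous_coe.comp ((ProbabilityMeasure.continuous_testAgainstNN_eval φ).comp
      (ProbabilityMeasure.continuous_prod.comp (continuous_id.prodMk continuous_id)))
  have hlinear := ProbabilityMeasure.continuous_integral_boundedContinuousFunction f
  unfold dualEnergy entropyDual
  fun_prop

variable {G : X → X → ℝ≥0∞} (hG : LowerSemicontinuous fun q : X × X => G q.1 q.2)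
  (ν : Measure X) [IsFiniteMeasure ν] {γ : ℝ} (hγ : 0 ≤ γ) (μ : ProbabilityMeasure X)

include hG hγ

theorem meanFieldEnergy_eq_iSup_dualEnergy :
    meanFieldEnergy G ν γ μ =
      ⨆ (φ : {φ : X × X →ᵇ ℝ≥0 // ∀ q, (φ q : ℝ≥0∞) ≤ G q.1 q.2}) (f : X →ᵇ ℝ),
        ENNReal.ofReal (dualEnergy (φ : X × X →ᵇ ℝ≥0) f ν γ μ) := by
  have hne_top (φ : X × X →ᵇ ℝ≥0) : ∫⁻ q, φ q ∂((μ : Measure X).prod (μ : Measure X)) ≠ ⊤ :=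
    (BoundedContinuousFunction.lintegral_lt_top_of_nnreal _ φ).ne
  have hscale (φ : X × X →ᵇ ℝ≥0) :
      ENNReal.ofReal (γ / 2) * ∫⁻ q, φ q ∂((μ : Measure X).prod (μ : Measure X)) =
        ENNReal.ofReal (γ / 2 * (∫⁻ q, φ q ∂((μ : Measure X).prod (μ : Measure X))).toReal) := by
    rw [ENNReal.ofReal_mul (by positivity), ENNReal.ofReal_toReal (hne_top φ)]
  have : Nonempty {φ : X × X →ᵇ ℝ≥0 // ∀ q, (φ q : ℝ≥0∞) ≤ G q.1 q.2} := ⟨0, by simp⟩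
  rw [meanFieldEnergy, lintegral_lintegral hG.measurable.aemeasurable,
    lintegral_eq_iSup_boundedContinuous_le _ hG, iSup_subtype', ENNReal.mul_iSup,
    klDiv_eq_iSup_entropyDual]
  simp only [hscale]
  refine le_antisymm (ENNReal.iSup_add_iSup_le fun φ f => ?_) (iSup₂_le fun φ f => ?_)
  · rcases le_total 0 (entropyDual (μ : Measure X) ν f) with hf | hf
    · rw [← ENNReal.ofReal_add (by positivity) hf]
      exact le_iSup₂_of_le φ f le_rfl
    · refine le_iSup₂_of_le φ 0 ?_
      rw [ENNReal.ofReal_of_nonpos hf, add_zero]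
      refine ENNReal.ofReal_le_ofReal (le_of_eq ?_)
      simp [dualEnergy, entropyDual]
  · exact ENNReal.ofReal_add_le.trans (add_le_add (le_iSup_of_le φ le_rfl) (le_iSup_of_le f le_rfl))

theorem exists_lt_dualEnergy {c : ℝ} (hc : (c : EReal) < (meanFieldEnergy G ν γ μ : EReal)) :
    ∃ (φ : X × X →ᵇ ℝ≥0) (f : X →ᵇ ℝ), (∀ q, (φ q : ℝ≥0∞) ≤ G q.1 q.2) ∧
      c < dualEnergy φ f ν γ μ := by
  rcases lt_or_ge c 0 with hc0 | hc0
  · exact ⟨0, 0, by simp, by simpa [dualEnergy, entropyDual] using hc0⟩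
  have hlt : ENNReal.ofReal c < meanFieldEnergy G ν γ μ := by
    rwa [← EReal.coe_ennreal_lt_coe_ennreal_iff, EReal.coe_ennreal_ofReal, max_eq_left hc0]
  rw [meanFieldEnergy_eq_iSup_dualEnergy hG ν hγ, lt_iSup_iff] at hlt
  obtain ⟨φ, hlt⟩ := hlt
  obtain ⟨f, hlt⟩ := lt_iSup_iff.1 hlt
  exact ⟨φ, f, φ.2, (ENNReal.ofReal_lt_ofReal_iff_of_nonneg hc0).1 hlt⟩

omit μ in
theorem lowerSemicontinuous_meanFieldEnergy :
    LowerSemicontinuous fun μ : ProbabilityMeasure X => meanFieldEnergy G ν γ μ := by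
  simp only [meanFieldEnergy_eq_iSup_dualEnergy hG ν hγ]
  exact lowerSemicontinuous_iSup fun φ => lowerSemicontinuous_iSup fun f =>
    (ENNReal.continuous_ofReal.comp (continuous_dualEnergy φ.1 f ν γ)).lowerSemicontinuous

omit μ in
theorem isCompact_meanFieldEnergy_le [T2Space X] {h : X → ℕ} (hh : IsExhaustion h)
    (hexp : ∫⁻ x, ENNReal.ofReal (Real.exp (h x)) ∂ν ≠ ⊤) {r : ℝ≥0∞} (hr : r ≠ ⊤) :
    IsCompact {μ : ProbabilityMeasure X | meanFieldEnergy G ν γ μ ≤ r} := by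
  have hclosed : IsClosed {μ : ProbabilityMeasure X | meanFieldEnergy G ν γ μ ≤ r} :=
    (lowerSemicontinuous_meanFieldEnergy hG ν hγ).isClosed_preimage r
  refine (hh.isCompact_closure_lintegral_le (ENNReal.add_ne_top.2 ⟨hr, hexp⟩)).of_isClosed_subset
    hclosed fun μ hμ => subset_closure ?_
  have hentropy := lintegral_le_klDiv_add_lintegral_exp (μ : Measure X) ν
    (f := fun x => (h x : ℝ)) (measurable_from_top.comp hh.measurable)
  simp only [ENNReal.ofReal_natCast] at hentropy
  exact hentropy.trans (add_le_add_left (le_add_self.trans hμ) _)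

end MeanFieldEnergy

section GibbsWeight

/-- The weight `e^{-s}` of an energy `s ∈ [0, ∞]`. -/
noncomputable def boltzmannFactor (s : ℝ≥0∞) : ℝ≥0∞ := EReal.exp (-(s : EReal))

theorem antitone_boltzmannFactor : Antitone boltzmannFactor := fun _ _ h =>
  EReal.exp_monotone (EReal.neg_le_neg_iff.2 (EReal.coe_ennreal_le_coe_ennreal_iff.2 h))

@[fun_prop]
theorem measurable_boltzmannFactor : Measurable boltzmannFactor :=
  antitone_boltzmannFactor.measurable

theorem boltzmannFactor_ofReal {t : ℝ} (ht : 0 ≤ t) :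
    boltzmannFactor (ENNReal.ofReal t) = ENNReal.ofReal (Real.exp (-t)) := by
  rw [boltzmannFactor, EReal.coe_ennreal_ofReal, max_eq_left ht, ← EReal.coe_neg, EReal.exp_coe]

theorem boltzmannFactor_le_one (s : ℝ≥0∞) : boltzmannFactor s ≤ 1 := by
  simpa [boltzmannFactor] using antitone_boltzmannFactor (zero_le : 0 ≤ s)

theorem boltzmannFactor_le_ofReal_exp_neg {t : ℝ} {s : ℝ≥0∞} (h : ENNReal.ofReal t ≤ s) :
    boltzmannFactor s ≤ ENNReal.ofReal (Real.exp (-t)) := by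
  rcases le_total 0 t with ht | ht
  · exact (antitone_boltzmannFactor h).trans_eq (boltzmannFactor_ofReal ht)
  · exact (boltzmannFactor_le_one s).trans
      (ENNReal.one_le_ofReal.2 (Real.one_le_exp (by linarith)))

/-- The pair energy `∑_{i < j} G(x_i, x_j)`. -/
noncomputable def pairSum {X : Type*} (G : X → X → ℝ≥0∞) {N : ℕ} (x : Fin N → X) : ℝ≥0∞ :=
  ∑ i, ∑ j ∈ Finset.Ioi i, G (x i) (x j)

/-- The nonnegative kernel `g(x, z) + ϑ(x) + ϑ(z)`; truncation at `0` has no effect under the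
assumption `-g(x, z) ≤ ϑ(x) + ϑ(z)`. -/
noncomputable def compensatedKernel {X : Type*} (g : X → X → EReal) (ϑ : X → ℝ) (x z : X) :
    ℝ≥0∞ :=
  (g x z + ((ϑ x + ϑ z : ℝ) : EReal)).toENNReal

theorem coe_ennreal_finset_sum {ι : Type*} (s : Finset ι) (a : ι → ℝ≥0∞) :
    ((∑ i ∈ s, a i : ℝ≥0∞) : EReal) = ∑ i ∈ s, (a i : EReal) :=
  map_sum (⟨⟨(↑), EReal.coe_ennreal_zero⟩, EReal.coe_ennreal_add⟩ : ℝ≥0∞ →+ EReal) a s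

theorem coe_real_finset_sum {ι : Type*} (s : Finset ι) (a : ι → ℝ) :
    ((∑ i ∈ s, a i : ℝ) : EReal) = ∑ i ∈ s, (a i : EReal) :=
  map_sum (⟨⟨(↑), EReal.coe_zero⟩, EReal.coe_add⟩ : ℝ →+ EReal) a s

theorem exp_neg_finset_sum {ι : Type*} (s : Finset ι) {u : ι → EReal} (hu : ∀ i, u i ≠ ⊥) :
    ∑ i ∈ s, u i ≠ ⊥ ∧ EReal.exp (-∑ i ∈ s, u i) = ∏ i ∈ s, EReal.exp (-u i) := by
  classical
  induction s using Finset.induction_on with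
  | empty => simp
  | insert a s ha ih =>
    rw [Finset.sum_insert ha, Finset.prod_insert ha, ← ih.2, ← EReal.exp_add,
      EReal.neg_add (.inl (hu a)) (.inr ih.1), sub_eq_add_neg]
    exact ⟨EReal.add_ne_bot_iff.2 ⟨hu a, ih.1⟩, rfl⟩

theorem sum_sum_Ioi_add {N : ℕ} (t : Fin N → ℝ) :
    ∑ i, ∑ j ∈ Finset.Ioi i, (t i + t j) = ((N - 1 : ℕ) : ℝ) * ∑ j, t j := by
  rw [Finset.sum_sum_Ioi_add_eq_sum_sum_off_diag (fun _ j : Fin N => t j), Finset.mul_sum]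
  refine Finset.sum_congr rfl fun i _ => ?_
  simp [Finset.card_compl]

variable {X : Type*} {g : X → X → EReal} {V : X → EReal} {ϑ : X → ℝ} {N : ℕ}

theorem coe_compensatedKernel (hg : ∀ u x, -g u x ≤ ((ϑ u + ϑ x : ℝ) : EReal)) (u x : X) :
    (compensatedKernel g ϑ u x : EReal) = g u x + ((ϑ u + ϑ x : ℝ) : EReal) := by
  refine EReal.coe_toENNReal ?_
  have h := hg u x
  generalize g u x = a at h ⊢
  induction a with
  | bot => exact absurd (top_le_iff.1 h) (EReal.coe_ne_top _)
  | top => simp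
  | coe a =>
    norm_cast at h ⊢
    linarith

theorem sum_sum_Ioi_eq_pairSum (hg : ∀ u x, -g u x ≤ ((ϑ u + ϑ x : ℝ) : EReal)) (x : Fin N → X) :
    ∑ i, ∑ j ∈ Finset.Ioi i, g (x i) (x j) = (pairSum (compensatedKernel g ϑ) x : EReal) +
      ((-(((N - 1 : ℕ) : ℝ) * ∑ j, ϑ (x j)) : ℝ) : EReal) := by
  have hsplit (u z : X) :
      g u z = (compensatedKernel g ϑ u z : EReal) + ((-(ϑ u + ϑ z) : ℝ) : EReal) := by
    rw [coe_compensatedKernel hg, EReal.coe_neg, ← sub_eq_add_neg, EReal.add_sub_cancel_right]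
  simp only [pairSum, ← sum_sum_Ioi_add (fun j => ϑ (x j)), ← Finset.sum_neg_distrib,
    coe_ennreal_finset_sum, coe_real_finset_sum, ← Finset.sum_add_distrib, ← hsplit]

theorem sum_potential_eq_sum_shiftedPotential (V : X → EReal) (ϑ : X → ℝ) (κ : ℝ)
    (x : Fin N → X) :
    ∑ j, V (x j) = ∑ j, shiftedPotential V ϑ κ (x j) + ((κ * ∑ j, ϑ (x j) : ℝ) : EReal) := by
  rw [Finset.mul_sum, coe_real_finset_sum, ← Finset.sum_add_distrib]
  exact Finset.sum_congr rfl fun j _ => (EReal.sub_add_cancel).symm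

theorem shiftedPotential_ne_bot {y : X} (hV : V y ≠ ⊥) (κ : ℝ) : shiftedPotential V ϑ κ y ≠ ⊥ := by
  rw [shiftedPotential, sub_eq_add_neg, ← EReal.coe_neg]
  exact EReal.add_ne_bot_iff.2 ⟨hV, EReal.coe_ne_bot _⟩

theorem gibbsEnergy_eq (hg : ∀ u x, -g u x ≤ ((ϑ u + ϑ x : ℝ) : EReal)) {β : ℝ} (hβ : 0 ≤ β)
    (x : Fin N → X) :
    gibbsEnergy β g V x =
      ((ENNReal.ofReal β * pairSum (compensatedKernel g ϑ) x : ℝ≥0∞) : EReal) +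
        ∑ j, shiftedPotential V ϑ (β * ((N - 1 : ℕ) : ℝ)) (x j) := by
  have hcancel : β * -(((N - 1 : ℕ) : ℝ) * ∑ j, ϑ (x j)) +
      β * ((N - 1 : ℕ) : ℝ) * ∑ j, ϑ (x j) = 0 := by ring
  rw [gibbsEnergy, sum_sum_Ioi_eq_pairSum hg,
    sum_potential_eq_sum_shiftedPotential V ϑ (β * ((N - 1 : ℕ) : ℝ)),
    EReal.left_distrib_of_nonneg_of_ne_top (by exact_mod_cast hβ) (EReal.coe_ne_top _),
    EReal.coe_ennreal_mul, EReal.coe_ennreal_ofReal, max_eq_left hβ, ← EReal.coe_mul,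
    add_add_add_comm, ← EReal.coe_add, hcancel, EReal.coe_zero, add_zero]

/-- Moving the compensating function from the kernel to the potential turns the Gibbs weight into
a Boltzmann factor bounded by `1` times a product. -/
theorem exp_neg_gibbsEnergy (hg : ∀ u x, -g u x ≤ ((ϑ u + ϑ x : ℝ) : EReal)) (hV : ∀ x, V x ≠ ⊥)
    {β : ℝ} (hβ : 0 ≤ β) (x : Fin N → X) :
    EReal.exp (-gibbsEnergy β g V x) =
      boltzmannFactor (ENNReal.ofReal β * pairSum (compensatedKernel g ϑ) x) *
        ∏ j, EReal.exp (-shiftedPotential V ϑ (β * ((N - 1 : ℕ) : ℝ)) (x j)) := by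
  obtain ⟨hsum, hprod⟩ := exp_neg_finset_sum Finset.univ fun j =>
    shiftedPotential_ne_bot (ϑ := ϑ) (hV (x j)) (β * ((N - 1 : ℕ) : ℝ))
  rw [gibbsEnergy_eq hg hβ, EReal.neg_add (.inl (EReal.coe_ennreal_ne_bot _)) (.inr hsum),
    sub_eq_add_neg, EReal.exp_add, hprod, boltzmannFactor]

end GibbsWeight

section PairGibbs

variable {X : Type*}

theorem sum_sum_le_two_mul_pairSum_add {G : X → X → ℝ≥0∞} (hsymm : ∀ x z, G x z = G z x)
    {φ : X → X → ℝ≥0∞} (hφ : ∀ x z, φ x z ≤ G x z) {M : ℝ≥0∞} (hM : ∀ x, φ x x ≤ M) {N : ℕ}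
    (x : Fin N → X) :
    ∑ i, ∑ j, φ (x i) (x j) ≤ 2 * pairSum G x + N * M := by
  have hoff : ∑ i, ∑ j ∈ {i}ᶜ, G (x j) (x i) = 2 * pairSum G x := by
    rw [← Finset.sum_sum_Ioi_add_eq_sum_sum_off_diag (fun i j => G (x i) (x j)), pairSum]
    simp only [Finset.mul_sum, two_mul, hsymm]
  calc ∑ i, ∑ j, φ (x i) (x j) = ∑ j, (∑ i ∈ {j}ᶜ, φ (x i) (x j) + φ (x j) (x j)) := by
        rw [Finset.sum_comm]
        exact Finset.sum_congr rfl fun j _ => by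
          rw [← Finset.sum_compl_add_sum {j}, Finset.sum_singleton]
    _ ≤ ∑ j, (∑ i ∈ {j}ᶜ, G (x i) (x j) + M) := by gcongr <;> simp only [hφ, hM]
    _ = 2 * pairSum G x + N * M := by simp [Finset.sum_add_distrib, hoff]

variable [MeasurableSpace X]

/-- The configurations whose empirical measure belongs to `A`. -/
def empiricalEvent (N : ℕ) (A : Set (ProbabilityMeasure X)) : Set (Fin N → X) :=
  {x | ∃ μ ∈ A, (μ : Measure X) = empiricalMeasure x}

/-- The unnormalized Gibbs measure of the nonnegative kernel `G` with one-particle reference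
measure `ρ`. -/
noncomputable def pairGibbs (G : X → X → ℝ≥0∞) (β : ℝ) (ρ : Measure X) (N : ℕ) :
    Measure (Fin N → X) :=
  (Measure.pi fun _ => ρ).withDensity fun x => boltzmannFactor (ENNReal.ofReal β * pairSum G x)

instance sFinite_empiricalMeasure {N : ℕ} (x : Fin N → X) : SFinite (empiricalMeasure x) := by
  unfold empiricalMeasure
  infer_instance

theorem isProbabilityMeasure_empiricalMeasure {N : ℕ} (hN : 0 < N) (x : Fin N → X) :
    IsProbabilityMeasure (empiricalMeasure x) where
  measure_univ := by
    simp [empiricalMeasure, ENNReal.inv_mul_cancel, hN.ne']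

theorem empiricalEvent_univ {N : ℕ} (hN : 0 < N) :
    empiricalEvent N (Set.univ : Set (ProbabilityMeasure X)) = Set.univ :=
  Set.eq_univ_of_forall fun x => ⟨⟨_, isProbabilityMeasure_empiricalMeasure hN x⟩, trivial, rfl⟩

theorem empiricalEvent_zero (A : Set (ProbabilityMeasure X)) : empiricalEvent 0 A = ∅ := by
  refine Set.eq_empty_of_forall_notMem fun x ⟨μ, _, hμ⟩ => ?_
  have hmass := measure_univ (μ := (μ : Measure X))
  simp [hμ, empiricalMeasure] at hmass

theorem measurable_pairSum {G : X → X → ℝ≥0∞} (hG : Measurable fun q : X × X => G q.1 q.2)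
    (N : ℕ) : Measurable fun x : Fin N → X => pairSum G x :=
  Finset.measurable_sum _ fun i _ => Finset.measurable_sum _ fun j _ =>
    hG.comp (f := fun x : Fin N → X => (x i, x j)) (by fun_prop)

theorem lintegral_empiricalMeasure {N : ℕ} (x : Fin N → X) {f : X → ℝ≥0∞} (hf : Measurable f) :
    ∫⁻ y, f y ∂(empiricalMeasure x) = (N : ℝ≥0∞)⁻¹ * ∑ j, f (x j) := by
  simp [empiricalMeasure, lintegral_finsetSum_measure, lintegral_dirac' _ hf]

theorem integral_empiricalMeasure {N : ℕ} (x : Fin N → X) {f : X → ℝ}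
    (hf : StronglyMeasurable f) :
    ∫ y, f y ∂(empiricalMeasure x) = (N : ℝ)⁻¹ * ∑ j, f (x j) := by
  rw [empiricalMeasure, integral_smul_measure,
    integral_finsetSum_measure fun _ _ => integrable_dirac' hf (by simp)]
  simp [integral_dirac' _ _ hf]

theorem lintegral_prod_empiricalMeasure {N : ℕ} (x : Fin N → X) {f : X × X → ℝ≥0∞}
    (hf : Measurable f) :
    ∫⁻ q, f q ∂((empiricalMeasure x).prod (empiricalMeasure x)) =
      (N : ℝ≥0∞)⁻¹ * ((N : ℝ≥0∞)⁻¹ * ∑ i, ∑ j, f (x i, x j)) := by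
  have hinner (y : X) : ∫⁻ z, f (y, z) ∂(empiricalMeasure x) =
      (N : ℝ≥0∞)⁻¹ * ∑ j, f (y, x j) :=
    lintegral_empiricalMeasure x (hf.comp measurable_prodMk_left)
  rw [lintegral_prod _ hf.aemeasurable]
  simp only [hinner]
  rw [lintegral_empiricalMeasure x (by fun_prop), ← Finset.mul_sum]

theorem empiricalEvent_mono {N : ℕ} {A B : Set (ProbabilityMeasure X)} (h : A ⊆ B) :
    empiricalEvent N A ⊆ empiricalEvent N B := fun _ ⟨μ, hμ, hμx⟩ => ⟨μ, h hμ, hμx⟩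

theorem empiricalEvent_union (N : ℕ) (A B : Set (ProbabilityMeasure X)) :
    empiricalEvent N (A ∪ B) = empiricalEvent N A ∪ empiricalEvent N B := by
  ext x
  simp only [empiricalEvent, Set.mem_union, Set.mem_ofPred_eq, or_and_right, exists_or]

theorem empiricalEvent_biUnion (N : ℕ) {ι : Type*} (t : Finset ι)
    (A : ι → Set (ProbabilityMeasure X)) :
    empiricalEvent N (⋃ i ∈ t, A i) = ⋃ i ∈ t, empiricalEvent N (A i) := by
  ext x
  simp only [empiricalEvent, Set.mem_iUnion, Set.mem_ofPred_eq]
  grind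

theorem pairGibbs_le_of_boltzmannFactor_le {G : X → X → ℝ≥0∞}
    (hG : Measurable fun q : X × X => G q.1 q.2) (β : ℝ) (ρ : Measure X) [SigmaFinite ρ] {N : ℕ}
    {E : Set (Fin N → X)} {K : ℝ≥0∞} {u : X → ℝ≥0∞} (hu : Measurable u)
    (hE : ∀ x ∈ E, boltzmannFactor (ENNReal.ofReal β * pairSum G x) ≤ K * ∏ j, u (x j)) :
    pairGibbs G β ρ N E ≤ K * (∫⁻ y, u y ∂ρ) ^ N := by
  set w : (Fin N → X) → ℝ≥0∞ := fun x => boltzmannFactor (ENNReal.ofReal β * pairSum G x)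
  have hw : Measurable w :=
    measurable_boltzmannFactor.comp ((measurable_pairSum hG N).const_mul _)
  have hprod : Measurable fun x : Fin N → X => ∏ j, u (x j) := by fun_prop
  have hbound := hprod.const_mul K
  calc pairGibbs G β ρ N E ≤ pairGibbs G β ρ N {x | w x ≤ K * ∏ j, u (x j)} := measure_mono hE
    _ = ∫⁻ x in {x | w x ≤ K * ∏ j, u (x j)}, w x ∂(Measure.pi fun _ => ρ) :=
        withDensity_apply _ (measurableSet_le hw hbound)
    _ ≤ ∫⁻ x in {x | w x ≤ K * ∏ j, u (x j)}, K * ∏ j, u (x j) ∂(Measure.pi fun _ => ρ) :=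
        setLIntegral_mono hbound fun x hx => hx
    _ ≤ ∫⁻ x, K * ∏ j, u (x j) ∂(Measure.pi fun _ => ρ) := setLIntegral_le_lintegral _ _
    _ = K * (∫⁻ y, u y ∂ρ) ^ N := by
        rw [lintegral_const_mul _ hprod, lintegral_pi_fin_prod _ fun _ => hu]
        simp

end PairGibbs

section ExponentialDecay

/-- Exponential decay at rate at least `c`: `p N ≤ e^{-N (c - o(1))}`. -/
def DecaysAtRate (p : ℕ → ℝ≥0∞) (c : ℝ) : Prop :=
  ∀ b < c, ∀ᶠ N : ℕ in atTop, p N ≤ ENNReal.ofReal (Real.exp (-(N * b)))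

/-- Exponential decay at rate at most `c`: `p N ≥ e^{-N (c + o(1))}`. -/
def DecaysAtMostAtRate (p : ℕ → ℝ≥0∞) (c : ℝ) : Prop :=
  ∀ b > c, ∀ᶠ N : ℕ in atTop, ENNReal.ofReal (Real.exp (-(N * b))) ≤ p N

variable {p q : ℕ → ℝ≥0∞} {c : ℝ}

theorem DecaysAtRate.mono (hq : DecaysAtRate q c) {c' : ℝ} (hc : c' ≤ c) (hpq : ∀ N, p N ≤ q N) :
    DecaysAtRate p c' := fun b hb =>
  (hq b (hb.trans_le hc)).mono fun N hN => (hpq N).trans hN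

theorem DecaysAtRate.add (hp : DecaysAtRate p c) (hq : DecaysAtRate q c) :
    DecaysAtRate (fun N => p N + q N) c := by
  intro b hb
  obtain ⟨b', hbb', hb'c⟩ := exists_between hb
  have htwo : ∀ᶠ N : ℕ in atTop, 2 ≤ Real.exp (N * (b' - b)) :=
    (Real.tendsto_exp_atTop.comp (tendsto_natCast_atTop_atTop.atTop_mul_const
      (sub_pos.2 hbb'))).eventually_ge_atTop 2
  filter_upwards [hp b' hb'c, hq b' hb'c, htwo] with N hpN hqN hN
  refine (add_le_add hpN hqN).trans ?_
  rw [← ENNReal.ofReal_add (Real.exp_nonneg _) (Real.exp_nonneg _)]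
  refine ENNReal.ofReal_le_ofReal ?_
  calc Real.exp (-(N * b')) + Real.exp (-(N * b')) = 2 * Real.exp (-(N * b')) := by ring
    _ ≤ Real.exp (N * (b' - b)) * Real.exp (-(N * b')) := by gcongr
    _ = Real.exp (-(N * b)) := by rw [← Real.exp_add]; ring_nf

theorem DecaysAtRate.finset_sum {ι : Type*} (t : Finset ι) {p : ι → ℕ → ℝ≥0∞}
    (hp : ∀ i, DecaysAtRate (p i) c) : DecaysAtRate (fun N => ∑ i ∈ t, p i N) c := by
  classical
  induction t using Finset.induction_on with
  | empty => exact fun b _ => .of_forall fun N => by simp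
  | insert i t hi ih =>
    simp only [Finset.sum_insert hi]
    exact (hp i).add ih

theorem tendsto_zero_of_tendsto_natCast_mul {β : ℕ → ℝ} {γ : ℝ}
    (hβγ : Tendsto (fun N : ℕ => N * β N) atTop (𝓝 γ)) : Tendsto β atTop (𝓝 0) := by
  have h := hβγ.mul (tendsto_inv_atTop_nhds_zero_nat (𝕜 := ℝ))
  rw [mul_zero] at h
  refine h.congr' ?_
  filter_upwards [eventually_gt_atTop 0] with N hN
  field_simp

theorem tendsto_mul_natCast_sub_one {β : ℕ → ℝ} {γ : ℝ}
    (hβγ : Tendsto (fun N : ℕ => N * β N) atTop (𝓝 γ)) :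
    Tendsto (fun N : ℕ => β N * ((N - 1 : ℕ) : ℝ)) atTop (𝓝 γ) := by
  have h := hβγ.sub (tendsto_zero_of_tendsto_natCast_mul hβγ)
  rw [sub_zero] at h
  refine h.congr' ?_
  filter_upwards [eventually_ge_atTop 1] with N hN
  rw [Nat.cast_sub hN, Nat.cast_one]
  ring

end ExponentialDecay

section UpperBound

open scoped BoundedContinuousFunction

variable {X : Type*} [MeasurableSpace X] {G : X → X → ℝ≥0∞}

theorem decaysAtRate_pairGibbs_lt_lintegral (hG : Measurable fun q : X × X => G q.1 q.2)
    (β : ℕ → ℝ) {ρ : ℕ → Measure X} [∀ N, SigmaFinite (ρ N)] {h : X → ℕ} (hh : Measurable h)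
    {b : ℝ} (hb : ∀ᶠ N in atTop, ∫⁻ y, ENNReal.ofReal (Real.exp (h y)) ∂(ρ N) ≤
      ENNReal.ofReal (Real.exp b)) (L : ℝ≥0) :
    DecaysAtRate (fun N => pairGibbs G (β N) (ρ N) N
      (empiricalEvent N {μ | (L : ℝ≥0∞) < ∫⁻ y, h y ∂(μ : Measure X)})) (L - b) := by
  intro c hc
  filter_upwards [hb, eventually_gt_atTop 0] with N hbN hN
  have hmarkov : ∀ x ∈ empiricalEvent N {μ | (L : ℝ≥0∞) < ∫⁻ y, h y ∂(μ : Measure X)},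
      boltzmannFactor (ENNReal.ofReal (β N) * pairSum G x) ≤
        ENNReal.ofReal (Real.exp (-(N * L))) * ∏ j, ENNReal.ofReal (Real.exp (h (x j))) := by
    rintro x ⟨μ, hμ, hμx⟩
    rw [Set.mem_ofPred_eq, hμx, lintegral_empiricalMeasure x (by fun_prop),
      ← ENNReal.div_eq_inv_mul,
      ENNReal.lt_div_iff_mul_lt (.inl (by positivity)) (.inl (by simp))] at hμ
    have hsum : (N : ℝ) * L < ∑ j, (h (x j) : ℝ) := by
      rw [mul_comm]
      exact_mod_cast hμ
    rw [← ENNReal.ofReal_prod_of_nonneg fun j _ => Real.exp_nonneg _, ← Real.exp_sum,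
      ← ENNReal.ofReal_mul (Real.exp_nonneg _), ← Real.exp_add]
    exact (boltzmannFactor_le_one _).trans
      (ENNReal.one_le_ofReal.2 (Real.one_le_exp (by linarith)))
  calc pairGibbs G (β N) (ρ N) N _
      ≤ ENNReal.ofReal (Real.exp (-(N * L))) *
          (∫⁻ y, ENNReal.ofReal (Real.exp (h y)) ∂(ρ N)) ^ N :=
        pairGibbs_le_of_boltzmannFactor_le hG (β N) (ρ N) (by fun_prop) hmarkov
    _ ≤ ENNReal.ofReal (Real.exp (-(N * L))) * ENNReal.ofReal (Real.exp b) ^ N := by gcongr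
    _ = ENNReal.ofReal (Real.exp (-(N * (L - b)))) := by
        rw [← ENNReal.ofReal_pow (Real.exp_nonneg _), ← Real.exp_nat_mul,
          ← ENNReal.ofReal_mul (Real.exp_nonneg _), ← Real.exp_add]
        ring_nf
    _ ≤ ENNReal.ofReal (Real.exp (-(N * c))) := by gcongr

variable [TopologicalSpace X] [BorelSpace X] [SecondCountableTopology X]

theorem ofReal_le_pairSum (hsymm : ∀ x z, G x z = G z x) {φ : X × X →ᵇ ℝ≥0}
    (hφ : ∀ q, (φ q : ℝ≥0∞) ≤ G q.1 q.2) {M : ℝ≥0} (hM : ∀ q, φ q ≤ M) {N : ℕ} (hN : 0 < N)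
    (x : Fin N → X) :
    ENNReal.ofReal (N * (N * (∫⁻ q, φ q ∂((empiricalMeasure x).prod (empiricalMeasure x))).toReal
      - M) / 2) ≤ pairSum G x := by
  set A := ∫⁻ q, φ q ∂((empiricalMeasure x).prod (empiricalMeasure x))
  have hsum : (N : ℝ≥0∞) * (N * A) = ∑ i, ∑ j, (φ (x i, x j) : ℝ≥0∞) := by
    have hne : (N : ℝ≥0∞) ≠ 0 := Nat.cast_ne_zero.2 hN.ne'
    rw [show A = _ from lintegral_prod_empiricalMeasure x (by fun_prop),
      ENNReal.mul_inv_cancel_left hne (by simp), ENNReal.mul_inv_cancel_left hne (by simp)]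
  have := isProbabilityMeasure_empiricalMeasure hN x
  have hA : A ≠ ⊤ := (BoundedContinuousFunction.lintegral_lt_top_of_nnreal _ φ).ne
  have hle := sum_sum_le_two_mul_pairSum_add hsymm (φ := fun y z => φ (y, z)) (fun y z => hφ (y, z))
    (M := M) (fun y => by exact_mod_cast hM _) x
  rw [← hsum, ← tsub_le_iff_right, mul_comm 2] at hle
  rw [ENNReal.ofReal_div_of_pos two_pos]
  refine ENNReal.div_le_of_le_mul ((le_of_eq ?_).trans (hle.trans_eq (by simp)))
  rw [mul_sub, ENNReal.ofReal_sub _ (by positivity)]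
  simp [ENNReal.ofReal_mul, ENNReal.ofReal_toReal hA]

theorem boltzmannFactor_le_of_lt_dualEnergy (hsymm : ∀ x z, G x z = G z x)
    {φ : X × X →ᵇ ℝ≥0} (hφ : ∀ q, (φ q : ℝ≥0∞) ≤ G q.1 q.2) {M : ℝ≥0} (hM : ∀ q, φ q ≤ M)
    (f : X →ᵇ ℝ) (ν : Measure X) {γ β c : ℝ} (hβ : 0 ≤ β) {N : ℕ} (hN : 0 < N) (x : Fin N → X)
    (hc : c < dualEnergy φ f ν γ (empiricalMeasure x)) :
    boltzmannFactor (ENNReal.ofReal β * pairSum G x) ≤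
      ENNReal.ofReal (Real.exp (N * (-c - ∫ y, (Real.exp (f y) - 1) ∂ν +
        (|N * β - γ| + β) * M / 2))) * ∏ j, ENNReal.ofReal (Real.exp (f (x j))) := by
  have hpair := ofReal_le_pairSum hsymm hφ hM hN x
  rw [dualEnergy, entropyDual,
    integral_empiricalMeasure x f.continuous.stronglyMeasurable] at hc
  set A := (∫⁻ q, φ q ∂((empiricalMeasure x).prod (empiricalMeasure x))).toReal
  set J := ∫ y, (Real.exp (f y) - 1) ∂ν
  set T := ∑ j, f (x j) with hT
  have hpos : (0 : ℝ) < N := Nat.cast_pos.2 hN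
  have hA_nonneg : 0 ≤ A := ENNReal.toReal_nonneg
  have hA_le : A ≤ M := by
    have := isProbabilityMeasure_empiricalMeasure hN x
    refine ENNReal.toReal_le_of_le_ofReal M.2 ?_
    calc _ ≤ ∫⁻ _, (M : ℝ≥0∞) ∂((empiricalMeasure x).prod (empiricalMeasure x)) :=
          lintegral_mono fun q => ENNReal.coe_le_coe.2 (hM q)
      _ = _ := by simp
  have hlin : (γ - N * β) * A ≤ |N * β - γ| * M := by
    rw [abs_sub_comm]
    exact mul_le_mul (le_abs_self _) hA_le hA_nonneg (abs_nonneg _)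
  have hcN : N * c ≤ N * (γ / 2 * A) + T - N * J := by
    have := mul_le_mul_of_nonneg_left hc.le hpos.le
    rwa [mul_add, mul_sub, mul_inv_cancel_left₀ hpos.ne', ← add_sub_assoc] at this
  have hbound := boltzmannFactor_le_ofReal_exp_neg
    (t := β * (N * (N * A - M) / 2)) (s := ENNReal.ofReal β * pairSum G x) (by
      rw [ENNReal.ofReal_mul hβ]; gcongr)
  rw [← ENNReal.ofReal_prod_of_nonneg fun j _ => Real.exp_nonneg _, ← Real.exp_sum, ← hT,
    ← ENNReal.ofReal_mul (Real.exp_nonneg _), ← Real.exp_add]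
  refine hbound.trans (ENNReal.ofReal_le_ofReal (Real.exp_le_exp.2 ?_))
  nlinarith [mul_le_mul_of_nonneg_left hlin hpos.le]

theorem decaysAtRate_pairGibbs_lt_dualEnergy (hG : Measurable fun q : X × X => G q.1 q.2)
    (hsymm : ∀ x z, G x z = G z x) {φ : X × X →ᵇ ℝ≥0} (hφ : ∀ q, (φ q : ℝ≥0∞) ≤ G q.1 q.2)
    (f : X →ᵇ ℝ) {ν : Measure X} [IsProbabilityMeasure ν] {γ : ℝ} {β : ℕ → ℝ} (hβ : ∀ N, 0 ≤ β N)
    (hβγ : Tendsto (fun N : ℕ => N * β N) atTop (𝓝 γ)) {ρ : ℕ → Measure X}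
    [∀ N, SigmaFinite (ρ N)]
    (hρ : Tendsto (fun N => ∫⁻ y, ENNReal.ofReal (Real.exp (f y)) ∂(ρ N)) atTop
      (𝓝 (∫⁻ y, ENNReal.ofReal (Real.exp (f y)) ∂ν))) (c : ℝ) :
    DecaysAtRate (fun N => pairGibbs G (β N) (ρ N) N
      (empiricalEvent N {μ | c < dualEnergy φ f ν γ μ})) c := by
  intro b hb
  obtain ⟨M, hM⟩ : ∃ M : ℝ≥0, ∀ q, φ q ≤ M := by
    obtain ⟨M, hM⟩ := φ.isBounded_range.bddAbove
    exact ⟨M, fun q => hM ⟨q, rfl⟩⟩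
  set J := ∫ y, (Real.exp (f y) - 1) ∂ν with hJ
  have hint : Integrable (fun y => Real.exp (f y)) ν :=
    integrable_exp_of_abs_le f.continuous.measurable f.norm_coe_le_norm
  have hlimit : ∫⁻ y, ENNReal.ofReal (Real.exp (f y)) ∂ν < ENNReal.ofReal
      (Real.exp (J + (c - b) / 2)) := by
    rw [← ofReal_integral_eq_lintegral_ofReal hint (.of_forall fun _ => Real.exp_nonneg _),
      ENNReal.ofReal_lt_ofReal_iff (Real.exp_pos _)]
    rw [integral_sub hint (integrable_const _)] at hJ
    simp only [integral_const, probReal_univ, smul_eq_mul, one_mul] at hJ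
    linarith [Real.add_one_le_exp (J + (c - b) / 2)]
  have herror : Tendsto (fun N : ℕ => (|N * β N - γ| + β N) * M / 2) atTop (𝓝 0) := by
    simpa using (((hβγ.sub_const γ).abs.add
      (tendsto_zero_of_tendsto_natCast_mul hβγ)).mul_const (M : ℝ)).div_const 2
  filter_upwards [herror.eventually_lt_const (half_pos (sub_pos.2 hb)),
    hρ.eventually_lt_const hlimit, eventually_gt_atTop 0] with N herrorN hρN hN
  calc pairGibbs G (β N) (ρ N) N _
      ≤ ENNReal.ofReal (Real.exp (N * (-c - J + (|N * β N - γ| + β N) * M / 2))) *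
          (∫⁻ y, ENNReal.ofReal (Real.exp (f y)) ∂(ρ N)) ^ N := by
        refine pairGibbs_le_of_boltzmannFactor_le hG (β N) (ρ N) (by fun_prop) ?_
        rintro x ⟨μ, hμ, hμx⟩
        rw [Set.mem_ofPred_eq, hμx] at hμ
        exact boltzmannFactor_le_of_lt_dualEnergy hsymm hφ hM f ν (hβ N) hN x hμ
    _ ≤ ENNReal.ofReal (Real.exp (N * (-c - J + (c - b) / 2))) *
          ENNReal.ofReal (Real.exp (J + (c - b) / 2)) ^ N := by gcongr
    _ = ENNReal.ofReal (Real.exp (-(N * b))) := by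
        rw [← ENNReal.ofReal_pow (Real.exp_nonneg _), ← Real.exp_nat_mul,
          ← ENNReal.ofReal_mul (Real.exp_nonneg _), ← Real.exp_add]
        ring_nf

/-- Up to an event of arbitrarily fast decay, the closed set can be replaced by a compact one, which
finitely many superlevel sets of dual energies cover. -/
theorem decaysAtRate_pairGibbs_of_isClosed [T2Space X] [TopologicalSpace.PseudoMetrizableSpace X]
    (hG : LowerSemicontinuous fun q : X × X => G q.1 q.2) (hsymm : ∀ x z, G x z = G z x)
    {ν : Measure X} [IsProbabilityMeasure ν] {γ : ℝ} (hγ : 0 ≤ γ) {β : ℕ → ℝ} (hβ : ∀ N, 0 ≤ β N)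
    (hβγ : Tendsto (fun N : ℕ => N * β N) atTop (𝓝 γ)) {ρ : ℕ → Measure X}
    [∀ N, SigmaFinite (ρ N)]
    (hρ : ∀ f : X →ᵇ ℝ, Tendsto (fun N => ∫⁻ y, ENNReal.ofReal (Real.exp (f y)) ∂(ρ N)) atTop
      (𝓝 (∫⁻ y, ENNReal.ofReal (Real.exp (f y)) ∂ν)))
    {h : X → ℕ} (hh : IsExhaustion h) {b : ℝ}
    (hb : ∀ᶠ N in atTop, ∫⁻ y, ENNReal.ofReal (Real.exp (h y)) ∂(ρ N) ≤
      ENNReal.ofReal (Real.exp b))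
    {C : Set (ProbabilityMeasure X)} (hC : IsClosed C) {c : ℝ}
    (hc : ∀ μ ∈ C, (c : EReal) ≤ (meanFieldEnergy G ν γ μ : EReal)) :
    DecaysAtRate (fun N => pairGibbs G (β N) (ρ N) N (empiricalEvent N C)) c := by
  suffices hlt : ∀ c' < c,
      DecaysAtRate (fun N => pairGibbs G (β N) (ρ N) N (empiricalEvent N C)) c' by
    intro a ha
    obtain ⟨c', hac', hc'⟩ := exists_between ha
    exact hlt c' hc' a hac'
  intro c' hc'
  obtain ⟨L, hL⟩ : ∃ L : ℝ≥0, c' ≤ L - b := ⟨(c' + b).toNNReal, by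
    linarith [Real.le_coe_toNNReal (c' + b)]⟩
  have hdual (μ : C) := exists_lt_dualEnergy hG ν hγ (μ : ProbabilityMeasure X)
    ((EReal.coe_lt_coe_iff.2 hc').trans_le (hc μ μ.2))
  choose φ f hφ hlt using hdual
  let U (μ : C) : Set (ProbabilityMeasure X) := {μ' | c' < dualEnergy (φ μ) (f μ) ν γ μ'}
  let T : Set (ProbabilityMeasure X) := {μ | (L : ℝ≥0∞) < ∫⁻ y, h y ∂(μ : Measure X)}
  obtain ⟨t, ht⟩ := ((hh.isCompact_closure_lintegral_le
      (ENNReal.coe_ne_top (r := L))).inter_left hC).elim_finite_subcover U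
    (fun μ => isOpen_lt continuous_const (continuous_dualEnergy _ _ _ _))
    fun μ hμ => Set.mem_iUnion.2 ⟨⟨μ, hμ.1⟩, hlt ⟨μ, hμ.1⟩⟩
  have hcover : C ⊆ T ∪ ⋃ μ ∈ t, U μ := fun μ hμ =>
    or_iff_not_imp_left.2 fun hμL =>
    ht ⟨hμ, subset_closure (by simpa [T] using hμL)⟩
  have htight := decaysAtRate_pairGibbs_lt_lintegral hG.measurable β hh.measurable hb L
  have hcompact := DecaysAtRate.finset_sum t fun μ => decaysAtRate_pairGibbs_lt_dualEnergy
    hG.measurable hsymm (hφ μ) (f μ) hβ hβγ (hρ _) c'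
  refine ((htight.mono hL fun _ => le_rfl).add hcompact).mono le_rfl fun N => ?_
  calc pairGibbs G (β N) (ρ N) N (empiricalEvent N C)
      ≤ pairGibbs G (β N) (ρ N) N (empiricalEvent N T ∪ ⋃ μ ∈ t, empiricalEvent N (U μ)) := by
        rw [← empiricalEvent_biUnion, ← empiricalEvent_union]
        exact measure_mono (empiricalEvent_mono hcover)
    _ ≤ _ := (measure_union_le _ _).trans (add_le_add_right (measure_biUnion_finset_le _ _) _)

end UpperBound

section LowerBound

open InformationTheory

section GibbsVariational

variable {Ω : Type*} [MeasurableSpace Ω] {P Q : Measure Ω} {ψ : Ω → ℝ}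

theorem add_one_mul_measureReal_sub_setIntegral_le [IsFiniteMeasure P] [IsFiniteMeasure Q]
    (hψ : Integrable ψ P)
    (hPQ : (P.withDensity fun x => ENNReal.ofReal (Real.exp (-ψ x))) ≤ Q) (s : ℝ) {T : Set Ω}
    (hT : MeasurableSet T) :
    (s + 1) * P.real T - ∫ x in T, ψ x ∂P ≤ Real.exp s * Q.real T := by
  have hexp : Integrable (fun x => Real.exp (-ψ x)) P := by
    refine ⟨(Real.measurable_exp.comp_aemeasurable hψ.1.aemeasurable.neg).aestronglyMeasurable, ?_⟩
    rw [hasFiniteIntegral_iff_ofReal (.of_forall fun x => (Real.exp_pos _).le),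
      ← setLIntegral_univ, ← withDensity_apply _ .univ]
    exact (hPQ _).trans_lt (measure_lt_top Q _)
  calc (s + 1) * P.real T - ∫ x in T, ψ x ∂P = ∫ x in T, (s + 1 - ψ x) ∂P := by
        rw [integral_sub (integrable_const _) hψ.restrict, setIntegral_const, smul_eq_mul, mul_comm]
    _ ≤ ∫ x in T, Real.exp s * Real.exp (-ψ x) ∂P := by
        refine integral_mono ((integrable_const _).sub hψ.restrict)
          (hexp.restrict.const_mul _) fun x => ?_
        rw [← Real.exp_add]
        linarith [Real.add_one_le_exp (s + -ψ x)]
    _ = Real.exp s * ∫ x in T, Real.exp (-ψ x) ∂P := integral_const_mul _ _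
    _ ≤ Real.exp s * Q.real T := by
        rw [integral_eq_lintegral_of_nonneg_ae (.of_forall fun x => (Real.exp_pos _).le)
          hexp.1.restrict, ← withDensity_apply _ hT]
        exact mul_le_mul_of_nonneg_left (ENNReal.toReal_mono (measure_ne_top Q T) (hPQ T))
          (Real.exp_pos s).le

/-- Weak duality in the Gibbs variational formula, tested against `s` on `T` and `0` off `T`. -/
theorem mul_measureReal_sub_integral_le [IsProbabilityMeasure P] (hQ : Q Set.univ ≤ 1)
    (hψ : Integrable ψ P)
    (hPQ : (P.withDensity fun x => ENNReal.ofReal (Real.exp (-ψ x))) ≤ Q) {s : ℝ} (hs : 0 ≤ s)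
    (T : Set Ω) : s * P.real T - ∫ x, ψ x ∂P ≤ Real.exp s * Q.real T := by
  have : IsFiniteMeasure Q := ⟨hQ.trans_lt ENNReal.one_lt_top⟩
  set T' := toMeasurable Q T
  have hT' : MeasurableSet T' := measurableSet_toMeasurable Q T
  have hon := add_one_mul_measureReal_sub_setIntegral_le hψ hPQ s hT'
  have hoff := add_one_mul_measureReal_sub_setIntegral_le hψ hPQ 0 hT'.compl
  have hQoff : Q.real T'ᶜ ≤ 1 := ENNReal.toReal_le_of_le_ofReal zero_le_one (by
    simpa using (measure_mono (Set.subset_univ _)).trans hQ)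
  have hQT : Q.real T' = Q.real T := congrArg ENNReal.toReal (measure_toMeasurable T)
  have hPT : s * P.real T ≤ s * P.real T' :=
    mul_le_mul_of_nonneg_left (measureReal_mono (subset_toMeasurable Q T)) hs
  rw [Real.exp_zero] at hoff
  rw [← hQT]
  linarith [integral_add_compl hT' hψ, probReal_add_probReal_compl (μ := P) hT']

end GibbsVariational

variable {X : Type*} [MeasurableSpace X]

theorem lintegral_pairSum_le {G : X → X → ℝ≥0∞} (hG : Measurable fun q : X × X => G q.1 q.2)
    (μ : Measure X) [IsProbabilityMeasure μ] (N : ℕ) :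
    ∫⁻ x : Fin N → X, pairSum G x ∂(Measure.pi fun _ => μ) ≤
      ENNReal.ofReal ((N : ℝ) ^ 2 / 2) * ∫⁻ x, ∫⁻ z, G x z ∂μ ∂μ := by
  have hm (i j : Fin N) : Measurable fun x : Fin N → X => G (x i) (x j) :=
    hG.comp (f := fun x : Fin N → X => (x i, x j)) (by fun_prop)
  have hpair {i j : Fin N} (hij : i ≠ j) :
      ∫⁻ x : Fin N → X, G (x i) (x j) ∂(Measure.pi fun _ => μ) = ∫⁻ x, ∫⁻ z, G x z ∂μ ∂μ := by
    have hmap := Measure.infinitePi_map_eval_prod (P := fun _ : Fin N => μ) hij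
    rw [Measure.infinitePi_eq_pi] at hmap
    rw [← lintegral_prod (fun q : X × X => G q.1 q.2) hG.aemeasurable, ← hmap,
      lintegral_map hG (by fun_prop)]
  have hcard : ∑ i : Fin N, ((Finset.Ioi i).card : ℝ) ≤ (N : ℝ) ^ 2 / 2 := by
    have hsum := sum_sum_Ioi_add (N := N) fun _ => (1 / 2 : ℝ)
    simp only [add_halves, Finset.sum_const, Finset.card_univ, Fintype.card_fin, nsmul_eq_mul,
      mul_one] at hsum
    have hN : ((N - 1 : ℕ) : ℝ) ≤ N := by exact_mod_cast Nat.sub_le N 1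
    rw [hsum]
    nlinarith [(Nat.cast_nonneg N : (0 : ℝ) ≤ N)]
  calc ∫⁻ x : Fin N → X, pairSum G x ∂(Measure.pi fun _ => μ)
      = ∑ i : Fin N, ∑ _j ∈ Finset.Ioi i, ∫⁻ x, ∫⁻ z, G x z ∂μ ∂μ := by
        unfold pairSum
        rw [lintegral_finsetSum _ fun i _ => Finset.measurable_sum _ fun j _ => hm i j]
        refine Finset.sum_congr rfl fun i _ => ?_
        rw [lintegral_finsetSum _ fun j _ => hm i j]
        exact Finset.sum_congr rfl fun j hj => hpair (Finset.mem_Ioi.1 hj).ne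
    _ = ENNReal.ofReal (∑ i : Fin N, ((Finset.Ioi i).card : ℝ)) *
          ∫⁻ x, ∫⁻ z, G x z ∂μ ∂μ := by
        rw [ENNReal.ofReal_sum_of_nonneg fun i _ => Nat.cast_nonneg _]
        simp [Finset.sum_mul]
    _ ≤ _ := by gcongr

/-- The function `ψ` such that the product measure of `μ` has density at most `exp ψ` with respect
to `pairGibbs G β ρ N`. -/
noncomputable def gibbsLogRatio (G : X → X → ℝ≥0∞) (β : ℝ) (μ ρ : Measure X) {N : ℕ}
    (x : Fin N → X) : ℝ :=
  β * (pairSum G x).toReal + ∑ j, llr μ ρ (x j)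

section GibbsLogRatio

variable {G : X → X → ℝ≥0∞} (hG : Measurable fun q : X × X => G q.1 q.2) {β : ℝ} (hβ : 0 ≤ β)
  {μ ρ : Measure X} [IsProbabilityMeasure μ]
  (hE : ∫⁻ x, ∫⁻ z, G x z ∂μ ∂μ ≠ ⊤) (N : ℕ)

include hG hE

theorem lintegral_pairSum_ne_top : ∫⁻ x : Fin N → X, pairSum G x ∂(Measure.pi fun _ => μ) ≠ ⊤ :=
  ((lintegral_pairSum_le hG μ N).trans_lt
    (ENNReal.mul_lt_top ENNReal.ofReal_lt_top hE.lt_top)).ne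

theorem integrable_gibbsLogRatio (hllr : Integrable (llr μ ρ) μ) :
    Integrable (fun x : Fin N → X => gibbsLogRatio G β μ ρ x) (Measure.pi fun _ => μ) :=
  ((integrable_toReal_of_lintegral_ne_top (measurable_pairSum hG N).aemeasurable
    (lintegral_pairSum_ne_top hG hE N)).const_mul β).add
    (integrable_finsetSum _ fun _ _ => integrable_comp_eval hllr)

include hβ

theorem integral_gibbsLogRatio_le [IsProbabilityMeasure ρ] (hkl : klDiv μ ρ ≠ ⊤) :
    ∫ x : Fin N → X, gibbsLogRatio G β μ ρ x ∂(Measure.pi fun _ => μ) ≤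
      N * (N * β * ((∫⁻ x, ∫⁻ z, G x z ∂μ ∂μ).toReal / 2) + (klDiv μ ρ).toReal) := by
  obtain ⟨hμρ, hllr⟩ := klDiv_ne_top_iff.1 hkl
  have hpair : ∫ x : Fin N → X, (pairSum G x).toReal ∂(Measure.pi fun _ => μ) ≤
      (N : ℝ) ^ 2 / 2 * (∫⁻ x, ∫⁻ z, G x z ∂μ ∂μ).toReal := by
    rw [integral_toReal (measurable_pairSum hG N).aemeasurable
      (ae_lt_top (measurable_pairSum hG N) (lintegral_pairSum_ne_top hG hE N))]
    have h := ENNReal.toReal_mono (ENNReal.mul_ne_top ENNReal.ofReal_ne_top hE)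
      (lintegral_pairSum_le hG μ N)
    rwa [ENNReal.toReal_mul, ENNReal.toReal_ofReal (by positivity)] at h
  have hentropy : ∫ x : Fin N → X, ∑ j, llr μ ρ (x j) ∂(Measure.pi fun _ => μ) =
      N * (klDiv μ ρ).toReal := by
    rw [integral_finsetSum _ fun j _ => integrable_comp_eval hllr,
      toReal_klDiv_of_measure_eq hμρ (by simp)]
    simp [integral_comp_eval (μ := fun _ : Fin N => μ) hllr.1]
  unfold gibbsLogRatio
  rw [integral_add ((integrable_toReal_of_lintegral_ne_top (measurable_pairSum hG N).aemeasurable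
    (lintegral_pairSum_ne_top hG hE N)).const_mul β)
    (integrable_finsetSum _ fun _ _ => integrable_comp_eval hllr), integral_const_mul, hentropy]
  nlinarith [mul_le_mul_of_nonneg_left hpair hβ]

theorem withDensity_exp_neg_gibbsLogRatio_le [SigmaFinite ρ] (hμρ : μ ≪ ρ) :
    ((Measure.pi fun _ : Fin N => μ).withDensity fun x =>
      ENNReal.ofReal (Real.exp (-gibbsLogRatio G β μ ρ x))) ≤ pairGibbs G β ρ N := by
  set q := μ.rnDeriv ρ
  have hq : Measurable q := Measure.measurable_rnDeriv μ ρ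
  have hqμ : ρ.withDensity q = μ := Measure.withDensity_rnDeriv_eq μ ρ hμρ
  have hb : Measurable fun x : Fin N → X => boltzmannFactor (ENNReal.ofReal β * pairSum G x) :=
    measurable_boltzmannFactor.comp ((measurable_pairSum hG N).const_mul _)
  have hllr : ∀ᵐ x ∂μ, ENNReal.ofReal (Real.exp (-llr μ ρ x)) = (q x)⁻¹ := by
    filter_upwards [exp_neg_llr hμρ, Measure.inv_rnDeriv hμρ, Measure.rnDeriv_lt_top ρ μ]
      with x hexp hinv hlt
    rw [hexp, ENNReal.ofReal_toReal hlt.ne, ← hinv, Pi.inv_apply]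
  have hdensity : (fun x : Fin N → X => ENNReal.ofReal (Real.exp (-gibbsLogRatio G β μ ρ x)))
      =ᵐ[Measure.pi fun _ => μ] fun x =>
        boltzmannFactor (ENNReal.ofReal β * pairSum G x) * ∏ j, (q (x j))⁻¹ := by
    filter_upwards [eventually_all.2 fun j : Fin N =>
        (Measure.tendsto_eval_ae_ae (μ := fun _ => μ) (i := j)).eventually hllr,
      ae_lt_top (measurable_pairSum hG N) (lintegral_pairSum_ne_top hG hE N)] with x hx hlt
    rw [gibbsLogRatio, neg_add, Real.exp_add, ENNReal.ofReal_mul (Real.exp_pos _).le,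
      ← boltzmannFactor_ofReal (mul_nonneg hβ ENNReal.toReal_nonneg), ENNReal.ofReal_mul hβ,
      ENNReal.ofReal_toReal hlt.ne, ← Finset.sum_neg_distrib, Real.exp_sum,
      ENNReal.ofReal_prod_of_nonneg fun j _ => (Real.exp_pos _).le]
    simp only [hx]
  have : SigmaFinite (ρ.withDensity q) := hqμ ▸ inferInstance
  have hpi : (Measure.pi fun _ : Fin N => μ) =
      (Measure.pi fun _ => ρ).withDensity fun x => ∏ j, q (x j) := by
    simpa only [hqμ] using pi_withDensity (N := N) ρ hq
  rw [withDensity_congr_ae hdensity, hpi, ← withDensity_mul _ (by fun_prop) (by fun_prop)]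
  refine withDensity_mono (.of_forall fun x => ?_)
  simp only [Pi.mul_apply]
  rw [mul_left_comm, ← Finset.prod_mul_distrib]
  exact mul_le_of_le_one_right' (Finset.prod_le_one' fun j _ => ENNReal.mul_inv_le_one _)

end GibbsLogRatio

theorem pairGibbs_univ_le_one (G : X → X → ℝ≥0∞) (β : ℝ) (ρ : Measure X) [IsProbabilityMeasure ρ]
    (N : ℕ) : pairGibbs G β ρ N Set.univ ≤ 1 := by
  rw [pairGibbs, withDensity_apply _ .univ, Measure.restrict_univ]
  exact (lintegral_mono fun x => boltzmannFactor_le_one _).trans (by simp)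

theorem pairGibbs_univ_pos {G : X → X → ℝ≥0∞} (hG : Measurable fun q : X × X => G q.1 q.2)
    {β : ℝ} (hβ : 0 ≤ β) {μ ρ : Measure X} [IsProbabilityMeasure μ] [IsProbabilityMeasure ρ]
    (hE : ∫⁻ x, ∫⁻ z, G x z ∂μ ∂μ ≠ ⊤) (hkl : klDiv μ ρ ≠ ⊤) (N : ℕ) :
    0 < pairGibbs G β ρ N Set.univ := by
  obtain ⟨hμρ, hllr⟩ := klDiv_ne_top_iff.1 hkl
  set a := ∫ x : Fin N → X, gibbsLogRatio G β μ ρ x ∂(Measure.pi fun _ => μ)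
  have h := mul_measureReal_sub_integral_le (pairGibbs_univ_le_one G β ρ N)
    (integrable_gibbsLogRatio hG hE N hllr) (withDensity_exp_neg_gibbsLogRatio_le hG hβ hE N hμρ)
    (abs_nonneg (a + 1)) Set.univ
  rw [probReal_univ] at h
  have hpos : 0 < Real.exp |a + 1| * (pairGibbs G β ρ N).real Set.univ := by
    linarith [le_abs_self (a + 1)]
  exact (ENNReal.toReal_pos_iff.1 (pos_of_mul_pos_right hpos (Real.exp_pos _).le)).1

variable [TopologicalSpace X] [OpensMeasurableSpace X]

theorem tendsto_pi_empiricalEvent_compl (μ : ProbabilityMeasure X) {O : Set (ProbabilityMeasure X)}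
    (hO : O ∈ 𝓝 μ) :
    Tendsto (fun N : ℕ => (Measure.pi fun _ : Fin N => (μ : Measure X)) (empiricalEvent N Oᶜ))
      atTop (𝓝 0) := by
  let P (N : ℕ) : Measure (Fin N → X) := Measure.pi fun _ => (μ : Measure X)
  have squeeze {p q : ℕ → ℝ≥0∞} (hq : Tendsto q atTop (𝓝 0)) (hpq : ∀ N, p N ≤ q N) :
      Tendsto p atTop (𝓝 0) :=
    tendsto_of_tendsto_of_tendsto_of_le_of_le tendsto_const_nhds hq (fun _ => zero_le) hpq
  let F : Filter (ProbabilityMeasure X) :=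
    { sets := {A | Tendsto (fun N => P N (empiricalEvent N Aᶜ)) atTop (𝓝 0)}
      univ_sets := by simp [empiricalEvent]
      sets_of_superset := fun hA hAB => squeeze hA fun N =>
        measure_mono (empiricalEvent_mono (Set.compl_subset_compl.2 hAB))
      inter_sets := fun {A B} hA hB => by
        refine squeeze (by simpa using Tendsto.add hA hB) fun N => ?_
        rw [Set.compl_inter, empiricalEvent_union]
        exact measure_union_le _ _ }
  have hF : Tendsto id F (𝓝 μ) := by
    refine ProbabilityMeasure.tendsto_iff_forall_integral_tendsto.2 fun f =>
      Metric.tendsto_nhds.2 fun δ hδ => ?_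
    refine squeeze (tendsto_pi_le_abs_average_sub (μ : Measure X) f.continuous.measurable
      (f.integrable _) hδ) fun N => measure_mono ?_
    rintro x ⟨μ', hμ', e⟩
    simp only [id, Set.mem_compl_iff, Set.mem_ofPred_eq, not_lt, Real.dist_eq, e] at hμ' ⊢
    rwa [integral_empiricalMeasure x f.continuous.measurable.stronglyMeasurable,
      ← div_eq_inv_mul] at hμ'
  exact hF hO

theorem tendsto_measureReal_pi_empiricalEvent (μ : ProbabilityMeasure X)
    {O : Set (ProbabilityMeasure X)} (hO : O ∈ 𝓝 μ) :
    Tendsto (fun N : ℕ => (Measure.pi fun _ : Fin N => (μ : Measure X)).real (empiricalEvent N O))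
      atTop (𝓝 1) := by
  have hcompl := (ENNReal.tendsto_toReal ENNReal.zero_ne_top).comp
    (tendsto_pi_empiricalEvent_compl μ hO)
  refine tendsto_of_tendsto_of_tendsto_of_le_of_le' (by simpa using hcompl.const_sub 1)
    tendsto_const_nhds ?_ (.of_forall fun N => measureReal_le_one)
  filter_upwards [eventually_gt_atTop 0] with N hN
  have hcover : empiricalEvent N O ∪ empiricalEvent N Oᶜ = Set.univ := by
    rw [← empiricalEvent_union, Set.union_compl_self]
    exact Set.eq_univ_of_forall fun x =>
      ⟨⟨empiricalMeasure x, isProbabilityMeasure_empiricalMeasure hN x⟩, trivial, rfl⟩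
  have hle := measureReal_union_le (μ := Measure.pi fun _ : Fin N => (μ : Measure X))
    (empiricalEvent N O) (empiricalEvent N Oᶜ)
  rw [hcover, probReal_univ] at hle
  exact sub_le_iff_le_add.2 hle

theorem decaysAtMostAtRate_pairGibbs_of_mem_nhds {G : X → X → ℝ≥0∞}
    (hG : Measurable fun q : X × X => G q.1 q.2) {ν : Measure X} {γ : ℝ} (hγ : 0 < γ)
    {β : ℕ → ℝ} (hβ : ∀ N, 0 ≤ β N) (hβγ : Tendsto (fun N : ℕ => N * β N) atTop (𝓝 γ))
    {ρ : ℕ → Measure X} [∀ N, IsProbabilityMeasure (ρ N)] {μ : ProbabilityMeasure X}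
    (hkl : Tendsto (fun N => klDiv μ (ρ N)) atTop (𝓝 (klDiv μ ν)))
    {O : Set (ProbabilityMeasure X)} (hO : O ∈ 𝓝 μ) (hfin : meanFieldEnergy G ν γ μ ≠ ⊤) :
    DecaysAtMostAtRate (fun N => pairGibbs G (β N) (ρ N) N (empiricalEvent N O))
      (meanFieldEnergy G ν γ μ).toReal := by
  intro c hc
  have hc0 : 0 < c := hc.trans_le' ENNReal.toReal_nonneg
  obtain ⟨hE', hK⟩ := ENNReal.add_ne_top.1 hfin
  have hE : ∫⁻ x, ∫⁻ z, G x z ∂(μ : Measure X) ∂μ ≠ ⊤ := fun h => hE' (by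
    rw [h, ENNReal.mul_top (ENNReal.ofReal_pos.2 (half_pos hγ)).ne'])
  set E := (∫⁻ x, ∫⁻ z, G x z ∂(μ : Measure X) ∂μ).toReal
  rw [meanFieldEnergy, ENNReal.toReal_add hE' hK, ENNReal.toReal_mul,
    ENNReal.toReal_ofReal (half_pos hγ).le] at hc
  have hlim : Tendsto (fun N : ℕ =>
      c * (Measure.pi fun _ : Fin N => (μ : Measure X)).real (empiricalEvent N O) -
        (N * β N * (E / 2) + (klDiv μ (ρ N)).toReal)) atTop
      (𝓝 (c * 1 - (γ * (E / 2) + (klDiv μ ν).toReal))) :=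
    ((tendsto_measureReal_pi_empiricalEvent μ hO).const_mul c).sub
      ((hβγ.mul_const _).add ((ENNReal.tendsto_toReal hK).comp hkl))
  have hdiv := tendsto_natCast_atTop_atTop.atTop_mul_pos (C := _) (by linarith) hlim
  filter_upwards [hdiv.eventually_ge_atTop 1, hkl.eventually_ne hK] with N hN hklN
  obtain ⟨hμρ, hllr⟩ := klDiv_ne_top_iff.1 hklN
  have hvar := mul_measureReal_sub_integral_le (pairGibbs_univ_le_one G (β N) (ρ N) N)
    (integrable_gibbsLogRatio hG hE N hllr)
    (withDensity_exp_neg_gibbsLogRatio_le hG (hβ N) hE N hμρ)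
    (mul_nonneg N.cast_nonneg hc0.le) (empiricalEvent N O)
  have hψ := integral_gibbsLogRatio_le hG (hβ N) hE N hklN
  have hge : 1 ≤ Real.exp (N * c) * (pairGibbs G (β N) (ρ N) N).real (empiricalEvent N O) := by
    linarith
  rw [Real.exp_neg]
  exact ENNReal.ofReal_le_of_le_toReal ((inv_le_iff_one_le_mul₀' (Real.exp_pos _)).2 hge)

end LowerBound

section LargeDeviations

variable {p q Z : ℕ → ℝ≥0∞} {c m : ℝ}

theorem DecaysAtRate.inv_mul (hq : DecaysAtRate q c) (hZ : DecaysAtMostAtRate Z m) :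
    DecaysAtRate (fun N => (Z N)⁻¹ * q N) (c - m) := by
  intro b hb
  obtain ⟨m', hm, hm'⟩ := exists_between (lt_sub_comm.1 hb)
  filter_upwards [hq (b + m') (by linarith), hZ m' hm] with N hqN hZN
  refine (mul_le_mul' (ENNReal.inv_le_inv.2 hZN) hqN).trans_eq ?_
  rw [← ENNReal.ofReal_inv_of_pos (Real.exp_pos _), ← Real.exp_neg,
    ← ENNReal.ofReal_mul (Real.exp_pos _).le, ← Real.exp_add]
  ring_nf

theorem DecaysAtMostAtRate.inv_mul (hq : DecaysAtMostAtRate q c) (hZ : DecaysAtRate Z m) :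
    DecaysAtMostAtRate (fun N => (Z N)⁻¹ * q N) (c - m) := by
  intro b hb
  obtain ⟨m', hm', hm⟩ := exists_between (sub_lt_comm.1 hb)
  filter_upwards [hq (b + m') (by linarith), hZ m' hm] with N hqN hZN
  refine Eq.trans_le ?_ (mul_le_mul' (ENNReal.inv_le_inv.2 hZN) hqN)
  rw [← ENNReal.ofReal_inv_of_pos (Real.exp_pos _), ← Real.exp_neg,
    ← ENNReal.ofReal_mul (Real.exp_pos _).le, ← Real.exp_add]
  ring_nf

section Speed

variable {a : ℕ → ℝ} {κ : ℝ} (ha : ∀ᶠ N in atTop, 0 ≤ a N)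
  (hκ : Tendsto (fun N : ℕ => (a N)⁻¹ * N) atTop (𝓝 κ))

theorem log_ofReal_exp (s : ℝ) : ENNReal.log (ENNReal.ofReal (Real.exp s)) = s := by
  rw [← EReal.exp_coe, EReal.log_exp]

include hκ in
theorem tendsto_inv_mul_log_ofReal_exp (b : ℝ) :
    Tendsto (fun N : ℕ => (((a N)⁻¹ : ℝ) : EReal) *
      ENNReal.log (ENNReal.ofReal (Real.exp (-(N * b))))) atTop (𝓝 ((-(κ * b) : ℝ) : EReal)) := by
  simp only [log_ofReal_exp, ← EReal.coe_mul]
  refine (continuous_coe_real_ereal.tendsto _).comp ((hκ.mul_const b).neg.congr fun N => ?_)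
  ring

include ha hκ

theorem DecaysAtRate.limsup_inv_mul_log_le (hp : DecaysAtRate p c) :
    limsup (fun N => (((a N)⁻¹ : ℝ) : EReal) * ENNReal.log (p N)) atTop ≤
      ((-(κ * c) : ℝ) : EReal) := by
  have hcont : Tendsto (fun b : ℝ => ((-(κ * b) : ℝ) : EReal)) (𝓝[<] c)
      (𝓝 ((-(κ * c) : ℝ) : EReal)) :=
    ((continuous_coe_real_ereal.comp (by fun_prop : Continuous fun b : ℝ => -(κ * b))).tendsto
      c).mono_left nhdsWithin_le_nhds
  refine ge_of_tendsto hcont (eventually_mem_nhdsWithin.mono fun b hb => ?_)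
  rw [← (tendsto_inv_mul_log_ofReal_exp hκ b).limsup_eq]
  refine limsup_le_limsup ?_
  filter_upwards [hp b hb, ha] with N hN haN
  exact mul_le_mul_of_nonneg_left (ENNReal.log_monotone hN)
    (EReal.coe_nonneg.2 (inv_nonneg.2 haN))

theorem DecaysAtMostAtRate.le_liminf_inv_mul_log (hp : DecaysAtMostAtRate p c) :
    ((-(κ * c) : ℝ) : EReal) ≤
      liminf (fun N => (((a N)⁻¹ : ℝ) : EReal) * ENNReal.log (p N)) atTop := by
  have hcont : Tendsto (fun b : ℝ => ((-(κ * b) : ℝ) : EReal)) (𝓝[>] c)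
      (𝓝 ((-(κ * c) : ℝ) : EReal)) :=
    ((continuous_coe_real_ereal.comp (by fun_prop : Continuous fun b : ℝ => -(κ * b))).tendsto
      c).mono_left nhdsWithin_le_nhds
  refine le_of_tendsto hcont (eventually_mem_nhdsWithin.mono fun b hb => ?_)
  rw [← (tendsto_inv_mul_log_ofReal_exp hκ b).liminf_eq]
  refine liminf_le_liminf ?_
  filter_upwards [hp b hb, ha] with N hN haN
  exact mul_le_mul_of_nonneg_left (ENNReal.log_monotone hN)
    (EReal.coe_nonneg.2 (inv_nonneg.2 haN))

end Speed

theorem ofReal_mul_tsub_le_iff {κ : ℝ} (hκ : 0 < κ) {x m t : ℝ≥0∞} :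
    ENNReal.ofReal κ * (x - m) ≤ t ↔ x ≤ ENNReal.ofReal κ⁻¹ * t + m := by
  rw [ENNReal.mul_le_iff_le_inv (ENNReal.ofReal_pos.2 hκ).ne' ENNReal.ofReal_ne_top,
    ← ENNReal.ofReal_inv_of_pos hκ, tsub_le_iff_right]

theorem coe_le_of_lt_ofReal_mul_tsub {κ t : ℝ} (hκ : 0 < κ) {x m : ℝ≥0∞} (hm : m ≠ ⊤)
    (hmx : m ≤ x) (ht : (t : EReal) < (ENNReal.ofReal κ * (x - m) : ℝ≥0∞)) :
    ((κ⁻¹ * t + m.toReal : ℝ) : EReal) ≤ x := by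
  rcases le_total t 0 with h0 | h0
  · calc ((κ⁻¹ * t + m.toReal : ℝ) : EReal) ≤ m.toReal := by
          rw [EReal.coe_le_coe_iff]
          linarith [mul_nonpos_of_nonneg_of_nonpos (inv_nonneg.2 hκ.le) h0]
      _ = m := EReal.coe_ennreal_toReal hm
      _ ≤ x := EReal.coe_ennreal_le_coe_ennreal_iff.2 hmx
  · rw [← max_eq_left h0, ← EReal.coe_ennreal_ofReal, EReal.coe_ennreal_lt_coe_ennreal_iff,
      ← not_le, ofReal_mul_tsub_le_iff hκ, not_le] at ht
    have hnonneg : 0 ≤ κ⁻¹ * t := mul_nonneg (inv_nonneg.2 hκ.le) h0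
    rw [← max_eq_left (add_nonneg hnonneg ENNReal.toReal_nonneg), ← EReal.coe_ennreal_ofReal,
      EReal.coe_ennreal_le_coe_ennreal_iff, ENNReal.ofReal_add hnonneg ENNReal.toReal_nonneg,
      ENNReal.ofReal_toReal hm, ENNReal.ofReal_mul (inv_nonneg.2 hκ.le)]
    exact ht.le

theorem satisfiesLDP_of_exponential_bounds {Y : Type*} [TopologicalSpace Y] {F : Y → ℝ≥0∞}
    (hlsc : LowerSemicontinuous F) (hcpt : ∀ r, r ≠ ⊤ → IsCompact {y | F y ≤ r})
    (hF : ⨅ y, F y ≠ ⊤) {a : ℕ → ℝ} (ha : Tendsto a atTop atTop) {κ : ℝ} (hκ : 0 < κ)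
    (haκ : Tendsto (fun N : ℕ => (a N)⁻¹ * N) atTop (𝓝 κ)) {p Q : ℕ → Set Y → ℝ≥0∞}
    (hp : ∀ N A, p N A = (Q N Set.univ)⁻¹ * Q N A)
    (hupper : ∀ C, IsClosed C → ∀ c : ℝ, (∀ y ∈ C, (c : EReal) ≤ F y) → DecaysAtRate (Q · C) c)
    (hlower : ∀ O, IsOpen O → ∀ y ∈ O, F y ≠ ⊤ → DecaysAtMostAtRate (Q · O) (F y).toReal) :
    SatisfiesLDP p a (fun y => ENNReal.ofReal κ * (F y - ⨅ y', F y')) := by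
  set m := ⨅ y, F y
  have hmF (y : Y) : m ≤ F y := iInf_le F y
  have ha0 : ∀ᶠ N in atTop, 0 ≤ a N := ha.eventually_ge_atTop 0
  have hZupper : DecaysAtRate (Q · Set.univ) m.toReal := hupper _ isClosed_univ _ fun y _ => by
    rw [EReal.coe_ennreal_toReal hF, EReal.coe_ennreal_le_coe_ennreal_iff]
    exact hmF y
  have hZlower : DecaysAtMostAtRate (Q · Set.univ) m.toReal := by
    intro b hb
    have hmb : ⨅ y, F y < ENNReal.ofReal b := (ENNReal.lt_ofReal_iff_toReal_lt hF).2 hb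
    obtain ⟨y, hy⟩ := iInf_lt_iff.1 hmb
    exact hlower _ isOpen_univ y trivial hy.ne_top b
      ((ENNReal.lt_ofReal_iff_toReal_lt hy.ne_top).1 hy)
  refine ⟨ha, ?_, fun r => ?_, fun C hC => ?_, fun O hO => ?_⟩
  · have hcont : Continuous fun t : ℝ≥0∞ => ENNReal.ofReal κ * (t - m) :=
      (ENNReal.continuous_const_mul ENNReal.ofReal_ne_top).comp (ENNReal.continuous_sub_right m)
    exact hcont.comp_lowerSemicontinuous hlsc fun s t h =>
      mul_le_mul_right (tsub_le_tsub_right h m) _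
  · simp only [ofReal_mul_tsub_le_iff hκ]
    exact hcpt _ (by finiteness)
  · rw [EReal.le_neg]
    refine EReal.ge_of_forall_gt_iff_ge.1 fun t ht => ?_
    have hdecay := (hupper C hC (κ⁻¹ * t + m.toReal) fun y hy =>
      coe_le_of_lt_ofReal_mul_tsub hκ hF (hmF y) (ht.trans_le (iInf₂_le y hy))).inv_mul hZlower
    have h := hdecay.limsup_inv_mul_log_le ha0 haκ
    rw [add_sub_cancel_right, mul_inv_cancel_left₀ hκ.ne', EReal.coe_neg] at h
    simp only [hp]
    exact EReal.le_neg_of_le_neg h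
  · rw [EReal.neg_le]
    refine le_iInf₂ fun y hy => ?_
    rw [EReal.neg_le]
    by_cases hFy : F y = ⊤
    · simp [hFy, ENNReal.top_sub hF, ENNReal.mul_top (ENNReal.ofReal_pos.2 hκ).ne']
    have h := ((hlower O hO y hy hFy).inv_mul hZupper).le_liminf_inv_mul_log ha0 haκ
    simp only [hp]
    refine Eq.trans_le ?_ h
    rw [EReal.coe_neg, ← ENNReal.toReal_sub_of_le (hmF y) hFy, ← ENNReal.toReal_ofReal hκ.le,
      ← ENNReal.toReal_mul, EReal.coe_ennreal_toReal (by finiteness), ENNReal.toReal_ofReal hκ.le]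

end LargeDeviations

section Tilting

open InformationTheory

variable {α : Type*} [MeasurableSpace α] {μ ν : Measure α} {f : α → ℝ}

theorem klDiv_tilted_right [IsProbabilityMeasure μ] [IsProbabilityMeasure ν]
    (hkl : klDiv μ ν ≠ ⊤) (hfμ : Integrable f μ) (hfν : Integrable (fun x => Real.exp (f x)) ν) :
    klDiv μ (ν.tilted f) = ENNReal.ofReal
      ((klDiv μ ν).toReal - ∫ x, f x ∂μ + Real.log (∫ x, Real.exp (f x) ∂ν)) := by
  have := isProbabilityMeasure_tilted hfν
  obtain ⟨hac, hllr⟩ := klDiv_ne_top_iff.1 hkl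
  rw [klDiv_of_ac_of_integrable (hac.trans (absolutelyContinuous_tilted hfν))
    (integrable_llr_tilted_right hac hfμ hllr hfν), toReal_klDiv_of_measure_eq hac (by simp),
    integral_llr_tilted_right hac hfμ hfν hllr]
  simp

variable {ι : Type*} {l : Filter ι} {a : ι → ℝ}

theorem exp_mul_le_exp_abs {s : ℝ} (hs : |s| ≤ 1) (t : ℝ) : Real.exp (s * t) ≤ Real.exp |t| :=
  Real.exp_le_exp.2 <| (le_abs_self _).trans <| by
    rw [abs_mul]
    exact mul_le_of_le_one_left (abs_nonneg t) hs

theorem eventually_abs_le_one (ha : Tendsto a l (𝓝 0)) : ∀ᶠ i in l, |a i| ≤ 1 := by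
  have h := ha.abs
  rw [abs_zero] at h
  exact h.eventually_le_const one_pos

theorem integrable_exp_mul (hf : Measurable f) (hexp : Integrable (fun x => Real.exp |f x|) ν)
    {s : ℝ} (hs : |s| ≤ 1) : Integrable (fun x => Real.exp (s * f x)) ν :=
  hexp.mono' (by fun_prop) (.of_forall fun x => by
    rw [Real.norm_of_nonneg (Real.exp_pos _).le]
    exact exp_mul_le_exp_abs hs (f x))

variable [l.IsCountablyGenerated]

theorem tendsto_lintegral_exp_mul (hf : Measurable f) {u : α → ℝ≥0∞} (hu : Measurable u)
    (hint : ∫⁻ x, ENNReal.ofReal (Real.exp |f x|) * u x ∂ν ≠ ⊤) (ha : Tendsto a l (𝓝 0)) :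
    Tendsto (fun i => ∫⁻ x, ENNReal.ofReal (Real.exp (a i * f x)) * u x ∂ν) l
      (𝓝 (∫⁻ x, u x ∂ν)) := by
  refine tendsto_lintegral_filter_of_dominated_convergence _ (.of_forall fun i => by fun_prop) ?_
    hint (.of_forall fun x => ?_)
  · filter_upwards [eventually_abs_le_one ha] with i hi
    exact .of_forall fun x =>
      mul_le_mul_left (ENNReal.ofReal_le_ofReal (exp_mul_le_exp_abs hi (f x))) _
  · have hweight : Tendsto (fun i => ENNReal.ofReal (Real.exp (a i * f x))) l (𝓝 1) := by
      simpa using ENNReal.tendsto_ofReal ((Real.continuous_exp.tendsto _).comp (ha.mul_const (f x)))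
    simpa using ENNReal.Tendsto.mul_const hweight (.inl one_ne_zero)

variable [IsProbabilityMeasure ν]

theorem tendsto_integral_exp_mul (hf : Measurable f)
    (hexp : Integrable (fun x => Real.exp |f x|) ν) (ha : Tendsto a l (𝓝 0)) :
    Tendsto (fun i => ∫ x, Real.exp (a i * f x) ∂ν) l (𝓝 1) := by
  have hone : ∫ x, Real.exp (0 * f x) ∂ν = 1 := by simp
  rw [← hone]
  refine tendsto_integral_filter_of_dominated_convergence _ (.of_forall fun i => by fun_prop) ?_
    hexp (.of_forall fun x => (Real.continuous_exp.tendsto _).comp (ha.mul_const (f x)))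
  filter_upwards [eventually_abs_le_one ha] with i hi
  refine .of_forall fun x => ?_
  rw [Real.norm_of_nonneg (Real.exp_pos _).le]
  exact exp_mul_le_exp_abs hi (f x)

theorem tendsto_lintegral_tilted (hf : Measurable f)
    (hexp : Integrable (fun x => Real.exp |f x|) ν) {u : α → ℝ≥0∞} (hu : Measurable u)
    (hint : ∫⁻ x, ENNReal.ofReal (Real.exp |f x|) * u x ∂ν ≠ ⊤) (ha : Tendsto a l (𝓝 0)) :
    Tendsto (fun i => ∫⁻ x, u x ∂(ν.tilted fun x => a i * f x)) l (𝓝 (∫⁻ x, u x ∂ν)) := by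
  have hnormalization :
      Tendsto (fun i => ENNReal.ofReal (∫ x, Real.exp (a i * f x) ∂ν)⁻¹) l (𝓝 1) := by
    simpa using ENNReal.tendsto_ofReal
      ((tendsto_integral_exp_mul hf hexp ha).inv₀ one_ne_zero)
  have htilted (i : ι) : ∫⁻ x, u x ∂(ν.tilted fun x => a i * f x) =
      ENNReal.ofReal (∫ x, Real.exp (a i * f x) ∂ν)⁻¹ *
        ∫⁻ x, ENNReal.ofReal (Real.exp (a i * f x)) * u x ∂ν := by
    rw [lintegral_tilted, ← lintegral_const_mul _ (by fun_prop)]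
    refine lintegral_congr fun x => ?_
    rw [div_eq_inv_mul, ENNReal.ofReal_mul (inv_nonneg.2 (integral_nonneg fun x => by positivity)),
      mul_assoc]
  simp only [htilted]
  simpa using ENNReal.Tendsto.mul hnormalization (.inl one_ne_zero)
    (tendsto_lintegral_exp_mul hf hu hint ha) (.inr ENNReal.one_ne_top)

theorem integrable_of_klDiv_ne_top [IsProbabilityMeasure μ] (hf : Measurable f)
    (hexp : Integrable (fun x => Real.exp |f x|) ν) (hkl : klDiv μ ν ≠ ⊤) : Integrable f μ := by
  refine ⟨hf.aestronglyMeasurable, (hasFiniteIntegral_iff_norm f).2 ?_⟩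
  exact (lintegral_le_klDiv_add_lintegral_exp μ ν hf.norm).trans_lt
    (ENNReal.add_lt_top.2 ⟨hkl.lt_top, hexp.lintegral_lt_top⟩)

theorem tendsto_klDiv_tilted [IsProbabilityMeasure μ] (hf : Measurable f)
    (hexp : Integrable (fun x => Real.exp |f x|) ν) (ha : Tendsto a l (𝓝 0))
    (hkl : klDiv μ ν ≠ ⊤) :
    Tendsto (fun i => klDiv μ (ν.tilted fun x => a i * f x)) l (𝓝 (klDiv μ ν)) := by
  have hfμ : Integrable f μ := integrable_of_klDiv_ne_top hf hexp hkl
  have hlim : Tendsto (fun i => (klDiv μ ν).toReal - a i * ∫ x, f x ∂μ +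
      Real.log (∫ x, Real.exp (a i * f x) ∂ν)) l (𝓝 (klDiv μ ν).toReal) := by
    simpa using ((ha.mul_const (∫ x, f x ∂μ)).const_sub _).add
      ((tendsto_integral_exp_mul hf hexp ha).log one_ne_zero)
  have hlim' := ENNReal.tendsto_ofReal hlim
  rw [ENNReal.ofReal_toReal hkl] at hlim'
  refine hlim'.congr' ?_
  filter_upwards [eventually_abs_le_one ha] with i hi
  rw [klDiv_tilted_right hkl (hfμ.const_mul _) (integrable_exp_mul hf hexp hi),
    integral_const_mul]

end Tilting

section FiniteMeasures

open InformationTheory ProbabilityTheory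

theorem klDiv_cond_ne_top {α : Type*} [MeasurableSpace α] (ν : Measure α) [IsFiniteMeasure ν]
    {s : Set α} (hs : MeasurableSet s) (hνs : ν s ≠ 0) : klDiv ν[|s] ν ≠ ⊤ := by
  have hdensity : ν[|s] = ν.withDensity (s.indicator fun _ => (ν s)⁻¹) := by
    rw [withDensity_indicator hs, withDensity_const, ProbabilityTheory.cond]
  have hac : ν[|s] ≪ ν := cond_absolutelyContinuous
  have hrnDeriv : ν[|s].rnDeriv ν =ᵐ[ν] s.indicator fun _ => (ν s)⁻¹ :=
    hdensity ▸ Measure.rnDeriv_withDensity ν (measurable_const.indicator hs)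
  have := cond_isProbabilityMeasure hνs
  refine klDiv_ne_top_iff.2 ⟨hac, (integrable_const (Real.log ((ν s)⁻¹).toReal)).congr ?_⟩
  filter_upwards [hac.ae_le hrnDeriv, ae_cond_mem hs] with x hx hxs
  rw [llr, hx, Set.indicator_of_mem hxs]

variable {X : Type*} [TopologicalSpace X] [T2Space X] [WeaklyLocallyCompactSpace X]
  [SigmaCompactSpace X] [MeasurableSpace X] [OpensMeasurableSpace X]

theorem exists_compactExhaustion_measure_compl_lt (μ : Measure X) [IsFiniteMeasure μ]
    {ε : ℕ → ℝ≥0∞} (hε : ∀ j, 0 < ε j) :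
    ∃ K : ℕ → Set X, (∀ j, IsCompact (K j)) ∧ (∀ j, μ (K j)ᶜ < ε j) ∧ ∀ x, ∃ j, x ∈ K j := by
  let K : CompactExhaustion X := default
  have hlim : Tendsto (fun j => μ (K j)ᶜ) atTop (𝓝 0) := by
    have h := tendsto_measure_iInter_atTop (μ := μ) (s := fun j => (K j)ᶜ)
      (fun j => (K.isCompact j).isClosed.measurableSet.compl.nullMeasurableSet)
      (fun i j hij => Set.compl_subset_compl.2 (K.subset hij)) ⟨0, measure_ne_top _ _⟩
    rwa [← Set.compl_iUnion, K.iUnion_eq, Set.compl_univ, measure_empty] at h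
  have hex (j : ℕ) : ∃ m, j ≤ m ∧ μ (K m)ᶜ < ε j :=
    ((eventually_ge_atTop j).and (hlim.eventually_lt_const (hε j))).exists
  choose φ hjφ hφ using hex
  refine ⟨fun j => K (φ j), fun j => K.isCompact _, hφ, fun x => ?_⟩
  obtain ⟨j, hj⟩ := K.exists_mem x
  exact ⟨j, K.subset (hjφ j) hj⟩

theorem ofReal_exp_find_le {α : Type*} {K : ℕ → Set α} (hK : ∀ x, ∃ j, x ∈ K j)
    [∀ x, DecidablePred fun j => x ∈ K j] (x : α) :
    ENNReal.ofReal (Real.exp (Nat.find (hK x))) ≤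
      1 + ∑' j : ℕ, (K j)ᶜ.indicator (fun _ => ENNReal.ofReal (Real.exp (j + 1))) x := by
  rcases h : Nat.find (hK x) with _ | m
  · simp
  · have hx : x ∈ (K m)ᶜ := Nat.find_min (hK x) (by omega)
    refine le_add_left (le_trans ?_ (ENNReal.le_tsum m))
    rw [Set.indicator_of_mem hx, Nat.cast_succ]

theorem exists_isExhaustion_lintegral_exp_ne_top (μ : Measure X) [IsFiniteMeasure μ] :
    ∃ h : X → ℕ, IsExhaustion h ∧ ∫⁻ x, ENNReal.ofReal (Real.exp (h x)) ∂μ ≠ ⊤ := by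
  classical
  obtain ⟨K, hK, hμK, hcover⟩ := exists_compactExhaustion_measure_compl_lt μ
    (ε := fun j => (ENNReal.ofReal (Real.exp (j + 1)))⁻¹ * 2⁻¹ ^ j)
    fun j => ENNReal.mul_pos (by simp) (by simp)
  have hmeas (j : ℕ) : MeasurableSet (K j) := (hK j).isClosed.measurableSet
  refine ⟨fun x => Nat.find (hcover x), ⟨measurable_find _ hmeas, fun k => ?_⟩, ?_⟩
  · refine ⟨⋃ j ∈ Finset.range (k + 1), K j,
      (Finset.range (k + 1)).isCompact_biUnion fun j _ => hK j, fun x hx => ?_⟩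
    simp only [Set.mem_iUnion, Finset.mem_range]
    exact ⟨_, Nat.lt_succ_of_le hx, Nat.find_spec (hcover x)⟩
  · refine ne_top_of_le_ne_top (b := μ Set.univ + 2) (by finiteness)
      ((lintegral_mono fun x => ofReal_exp_find_le hcover x).trans ?_)
    rw [lintegral_add_left measurable_const, lintegral_one, lintegral_tsum fun j =>
      (measurable_const.indicator (hmeas j).compl).aemeasurable]
    gcongr
    calc ∑' j : ℕ, ∫⁻ x, (K j)ᶜ.indicator (fun _ => ENNReal.ofReal (Real.exp (j + 1))) x ∂μ
      _ = ∑' j : ℕ, ENNReal.ofReal (Real.exp (j + 1)) * μ (K j)ᶜ := by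
          simp only [lintegral_indicator_const (hmeas _).compl]
      _ ≤ ∑' j : ℕ, (2⁻¹ : ℝ≥0∞) ^ j := by
          refine ENNReal.tsum_le_tsum fun j => (mul_le_mul_right (hμK j).le _).trans ?_
          rw [← mul_assoc, ENNReal.mul_inv_cancel (ENNReal.ofReal_pos.2 (Real.exp_pos _)).ne'
            ENNReal.ofReal_ne_top, one_mul]
      _ = 2 := by rw [ENNReal.tsum_geometric, ENNReal.one_sub_inv_two, inv_inv]

end FiniteMeasures

section Speed

variable {β : ℕ → ℝ} {γ : ℝ}

theorem tendsto_mul_natCast_sq_atTop (hγ : 0 < γ)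
    (hβγ : Tendsto (fun N : ℕ => (N : ℝ) * β N) atTop (𝓝 γ)) :
    Tendsto (fun N : ℕ => β N * (N : ℝ) ^ 2) atTop atTop :=
  (tendsto_natCast_atTop_atTop.atTop_mul_pos hγ hβγ).congr fun N => by ring

theorem tendsto_inv_mul_natCast_sq_mul_natCast (hγ : γ ≠ 0)
    (hβγ : Tendsto (fun N : ℕ => (N : ℝ) * β N) atTop (𝓝 γ)) :
    Tendsto (fun N : ℕ => (β N * (N : ℝ) ^ 2)⁻¹ * N) atTop (𝓝 γ⁻¹) := by
  refine (hβγ.inv₀ hγ).congr' ?_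
  filter_upwards [eventually_ne_atTop 0] with N hN
  field_simp

end Speed

section ReferenceMeasure

variable {X : Type*}

theorem exp_neg_shiftedPotential {V : X → EReal} (hV : ∀ x, V x ≠ ⊥) (ϑ : X → ℝ) (κ : ℝ) (x : X) :
    EReal.exp (-shiftedPotential V ϑ κ x) =
      EReal.exp (-V x) * ENNReal.ofReal (Real.exp (κ * ϑ x)) := by
  rw [shiftedPotential, EReal.neg_sub (.inl (hV x)) (.inr (EReal.coe_ne_top _)), EReal.exp_add,
    EReal.exp_coe]

theorem shiftedPotential_zero (V : X → EReal) (ϑ : X → ℝ) : shiftedPotential V ϑ 0 = V := by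
  ext x
  simp [shiftedPotential]

variable [MeasurableSpace X]

/-- The measure `e^{-V} ω`, of which every `referenceMeasure ω V ϑ κ` is an exponential tilt. -/
noncomputable def confinedMeasure (ω : Measure X) (V : X → EReal) : Measure X :=
  ω.withDensity fun x => EReal.exp (-V x)

theorem confinedMeasure_withDensity_exp {ω : Measure X} {V : X → EReal} {ϑ : X → ℝ}
    (hVm : Measurable V) (hV : ∀ x, V x ≠ ⊥) (hϑ : Measurable ϑ) (κ : ℝ) :
    (confinedMeasure ω V).withDensity (fun x => ENNReal.ofReal (Real.exp (κ * ϑ x))) =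
      ω.withDensity fun x => EReal.exp (-shiftedPotential V ϑ κ x) := by
  rw [confinedMeasure, ← withDensity_mul _ (by fun_prop) (by fun_prop)]
  simp only [exp_neg_shiftedPotential hV]
  rfl

end ReferenceMeasure

/-- A mean-field gas on a topological space: the topological counterpart of `GasAssumptions`, with
the decomposition of `g` and its behaviour near the diagonal replaced by integrability of the
positive part of `g` on compact squares. -/
structure IsMeanFieldGas {X : Type*} [TopologicalSpace X] [MeasurableSpace X] (ω : Measure X)
    (g : X → X → EReal) (V : X → EReal) (ϑ : X → ℝ) : Prop where
  symm : ∀ u x, g u x = g x u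
  lowerSemicontinuous : LowerSemicontinuous fun q : X × X => g q.1 q.2
  lintegral_lt_top : ∀ K : Set X, IsCompact K →
    ∫⁻ x in K, ∫⁻ z in K, (g x z).toENNReal ∂ω ∂ω < ⊤
  continuous_theta : Continuous ϑ
  theta_nonneg : ∀ x, 0 ≤ ϑ x
  neg_kernel_le : ∀ u x, -g u x ≤ ((ϑ u + ϑ x : ℝ) : EReal)
  potential_ne_bot : ∀ x, V x ≠ ⊥
  potential : ∀ κ : ℝ, 0 ≤ κ → IsAdmissiblePotential ω (shiftedPotential V ϑ κ)

theorem IsAdmissiblePotential.measurable {X : Type*} [TopologicalSpace X] [MeasurableSpace X]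
    [OpensMeasurableSpace X] {ω : Measure X} {U : X → EReal} (hU : IsAdmissiblePotential ω U) :
    Measurable U := by
  classical
  have hpiecewise : {x | U x < ⊤}.piecewise U (fun _ => ⊤) = U := by
    ext x
    by_cases hx : U x < ⊤
    · exact Set.piecewise_eq_of_mem _ _ _ hx
    · rw [not_lt_top_iff.1 hx]
      exact Set.piecewise_eq_of_notMem _ _ _ hx
  exact hpiecewise ▸
    hU.continuousOn.measurable_piecewise continuousOn_const hU.isOpen.measurableSet

namespace IsMeanFieldGas

variable {X : Type*} [TopologicalSpace X] [MeasurableSpace X] {ω : Measure X}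
  {g : X → X → EReal} {V : X → EReal} {ϑ : X → ℝ}

section Kernel

theorem compensatedKernel_symm (hA : IsMeanFieldGas ω g V ϑ) (x z : X) :
    compensatedKernel g ϑ x z = compensatedKernel g ϑ z x := by
  rw [compensatedKernel, compensatedKernel, hA.symm x z, add_comm (ϑ x)]

theorem lowerSemicontinuous_compensatedKernel (hA : IsMeanFieldGas ω g V ϑ) :
    LowerSemicontinuous fun q : X × X => compensatedKernel g ϑ q.1 q.2 := by
  have hϑ := hA.continuous_theta
  have hsum : LowerSemicontinuous fun q : X × X =>
      g q.1 q.2 + ((ϑ q.1 + ϑ q.2 : ℝ) : EReal) :=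
    hA.lowerSemicontinuous.add'
      (continuous_coe_real_ereal.comp (by fun_prop)).lowerSemicontinuous
      fun q => EReal.continuousAt_add (.inr (EReal.coe_ne_bot _)) (.inr (EReal.coe_ne_top _))
  exact EReal.continuous_toENNReal.comp_lowerSemicontinuous hsum fun _ _ h =>
    EReal.toENNReal_le_toENNReal h

theorem lintegral_compensatedKernel_ne_top [T2Space X] [OpensMeasurableSpace X]
    (hA : IsMeanFieldGas ω g V ϑ) {K : Set X} (hK : IsCompact K) (hωK : ω K ≠ ⊤) :
    ∫⁻ x in K, ∫⁻ z in K, compensatedKernel g ϑ x z ∂ω ∂ω ≠ ⊤ := by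
  obtain ⟨M, hM⟩ := hK.bddAbove_image hA.continuous_theta.continuousOn
  have hle (x) (hx : x ∈ K) (z) (hz : z ∈ K) :
      compensatedKernel g ϑ x z ≤ (g x z).toENNReal + ENNReal.ofReal (M + M) :=
    EReal.toENNReal_add_le.trans <| add_le_add_right (ENNReal.ofReal_le_ofReal
      (add_le_add (hM ⟨x, hx, rfl⟩) (hM ⟨z, hz, rfl⟩))) _
  have hmeas := hK.isClosed.measurableSet
  have hωK' : (ω.restrict K) Set.univ ≠ ⊤ := by rwa [Measure.restrict_apply_univ]
  refine ne_top_of_le_ne_top ?_ (setLIntegral_mono' hmeas fun x hx =>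
    setLIntegral_mono' hmeas fun z hz => hle x hx z hz)
  simp only [lintegral_add_right _ measurable_const, lintegral_const]
  exact ENNReal.add_ne_top.2 ⟨(hA.lintegral_lt_top K hK).ne, by finiteness⟩

end Kernel

section ReferenceMeasure

variable [OpensMeasurableSpace X]

theorem measurable_theta (hA : IsMeanFieldGas ω g V ϑ) : Measurable ϑ :=
  hA.continuous_theta.measurable

theorem measurable_potential (hA : IsMeanFieldGas ω g V ϑ) : Measurable V :=
  shiftedPotential_zero V ϑ ▸ (hA.potential 0 le_rfl).measurable

theorem lintegral_exp_theta_confinedMeasure (hA : IsMeanFieldGas ω g V ϑ) (κ : ℝ) :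
    ∫⁻ x, ENNReal.ofReal (Real.exp (κ * ϑ x)) ∂(confinedMeasure ω V) =
      ∫⁻ x, EReal.exp (-shiftedPotential V ϑ κ x) ∂ω := by
  rw [← setLIntegral_univ, ← withDensity_apply _ .univ, confinedMeasure_withDensity_exp
    hA.measurable_potential hA.potential_ne_bot hA.measurable_theta, withDensity_apply _ .univ,
    setLIntegral_univ]

theorem integrable_exp_theta (hA : IsMeanFieldGas ω g V ϑ) {κ : ℝ} (hκ : 0 ≤ κ) :
    Integrable (fun x => Real.exp (κ * ϑ x)) (confinedMeasure ω V) := by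
  have hϑ := hA.measurable_theta
  refine ⟨by fun_prop, (hasFiniteIntegral_iff_ofReal (.of_forall fun x => by positivity)).2 ?_⟩
  rw [hA.lintegral_exp_theta_confinedMeasure]
  exact (hA.potential κ hκ).lintegral_lt_top

variable [ω.IsOpenPosMeasure]

theorem neZero_confinedMeasure (hA : IsMeanFieldGas ω g V ϑ) : NeZero (confinedMeasure ω V) := by
  refine ⟨fun h => ?_⟩
  have hV := hA.measurable_potential
  have hU := hA.potential 0 le_rfl
  rw [shiftedPotential_zero] at hU
  have hae : ∀ᵐ x ∂ω, V x = ⊤ := by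
    filter_upwards [(withDensity_eq_zero_iff (by fun_prop)).1 h] with x hx
    simpa using hx
  exact (hU.isOpen.measure_pos ω hU.nonempty).ne'
    (measure_mono_null (fun x hx => ne_of_lt hx) hae)

theorem referenceMeasure_eq_tilted (hA : IsMeanFieldGas ω g V ϑ) {κ : ℝ} (hκ : 0 ≤ κ) :
    referenceMeasure ω V ϑ κ = (confinedMeasure ω V).tilted fun x => κ * ϑ x := by
  have hϑ := hA.measurable_theta
  have := hA.neZero_confinedMeasure
  have hpos := integral_exp_pos (hA.integrable_exp_theta hκ)
  rw [referenceMeasure, ← confinedMeasure_withDensity_exp hA.measurable_potential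
    hA.potential_ne_bot hϑ, ← hA.lintegral_exp_theta_confinedMeasure,
    ← ofReal_integral_eq_lintegral_ofReal (hA.integrable_exp_theta hκ)
      (.of_forall fun x => by positivity), Measure.tilted, ← withDensity_smul _ (by fun_prop),
    ← ENNReal.ofReal_inv_of_pos hpos]
  congr 1 with x
  rw [Pi.smul_apply, smul_eq_mul, ← ENNReal.ofReal_mul (by positivity), div_eq_inv_mul]

theorem isProbabilityMeasure_referenceMeasure (hA : IsMeanFieldGas ω g V ϑ) {κ : ℝ} (hκ : 0 ≤ κ) :
    IsProbabilityMeasure (referenceMeasure ω V ϑ κ) := by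
  have := hA.neZero_confinedMeasure
  rw [hA.referenceMeasure_eq_tilted hκ]
  exact isProbabilityMeasure_tilted (hA.integrable_exp_theta hκ)

theorem referenceMeasure_eq_tilted_referenceMeasure (hA : IsMeanFieldGas ω g V ϑ) {κ κ' : ℝ}
    (hκ : 0 ≤ κ) (hκ' : 0 ≤ κ') :
    referenceMeasure ω V ϑ κ' = (referenceMeasure ω V ϑ κ).tilted fun x => (κ' - κ) * ϑ x := by
  rw [hA.referenceMeasure_eq_tilted hκ, hA.referenceMeasure_eq_tilted hκ',
    tilted_tilted (hA.integrable_exp_theta hκ)]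
  congr 1 with x
  rw [Pi.add_apply]
  ring

theorem integrable_exp_abs_theta (hA : IsMeanFieldGas ω g V ϑ) {κ : ℝ} (hκ : 0 ≤ κ) :
    Integrable (fun x => Real.exp |ϑ x|) (referenceMeasure ω V ϑ κ) := by
  rw [hA.referenceMeasure_eq_tilted hκ, integrable_tilted_iff (hA.integrable_exp_theta hκ)]
  refine (hA.integrable_exp_theta (κ := κ + 1) (by linarith)).congr (.of_forall fun x => ?_)
  simp only [abs_of_nonneg (hA.theta_nonneg x), smul_eq_mul, ← Real.exp_add, add_mul, one_mul]

theorem lintegral_exp_shiftedPotential_pos (hA : IsMeanFieldGas ω g V ϑ) {κ : ℝ} (hκ : 0 ≤ κ) :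
    0 < ∫⁻ x, EReal.exp (-shiftedPotential V ϑ κ x) ∂ω := by
  have := hA.neZero_confinedMeasure
  rw [← hA.lintegral_exp_theta_confinedMeasure, ← ofReal_integral_eq_lintegral_ofReal
    (hA.integrable_exp_theta hκ) (.of_forall fun x => by positivity), ENNReal.ofReal_pos]
  exact integral_exp_pos (hA.integrable_exp_theta hκ)

section FiniteEnergy

open ProbabilityTheory InformationTheory

theorem referenceMeasure_ne_zero_of_subset (hA : IsMeanFieldGas ω g V ϑ) {κ : ℝ} (hκ : 0 ≤ κ)
    {K : Set X} (hK : K ⊆ {x | shiftedPotential V ϑ κ x < ⊤}) (hint : (interior K).Nonempty) :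
    referenceMeasure ω V ϑ κ K ≠ 0 := by
  have hU := (hA.potential κ hκ).measurable
  have hdensity :
      ω.withDensity (fun x => EReal.exp (-shiftedPotential V ϑ κ x)) (interior K) ≠ 0 := by
    rw [Ne, withDensity_apply_eq_zero (by fun_prop)]
    refine fun h => (isOpen_interior.measure_pos ω hint).ne' (measure_mono_null (fun x hx => ?_) h)
    exact ⟨by simpa using (hK (interior_subset hx)).ne, hx⟩
  rw [referenceMeasure, Measure.smul_apply, smul_eq_mul]
  exact mul_ne_zero (ENNReal.inv_ne_zero.2 (hA.potential κ hκ).lintegral_lt_top.ne)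
    fun h => hdensity (measure_mono_null interior_subset h)

theorem exists_cond_referenceMeasure_le [T2Space X] (hA : IsMeanFieldGas ω g V ϑ) {κ : ℝ}
    (hκ : 0 ≤ κ) {K : Set X} (hK : IsCompact K) (hKV : K ⊆ {x | shiftedPotential V ϑ κ x < ⊤})
    (hint : (interior K).Nonempty) :
    ∃ C : ℝ≥0∞, C ≠ ⊤ ∧ (referenceMeasure ω V ϑ κ)[|K] ≤ C • ω.restrict K := by
  obtain ⟨y, -, hy⟩ := hK.exists_isMinOn (hint.mono interior_subset)
    ((hA.potential κ hκ).continuousOn.mono hKV)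
  have hB : EReal.exp (-shiftedPotential V ϑ κ y) ≠ ⊤ := by
    simpa using shiftedPotential_ne_bot (hA.potential_ne_bot y) κ
  have hmeas := hK.isClosed.measurableSet
  have hdensity : (ω.restrict K).withDensity (fun x => EReal.exp (-shiftedPotential V ϑ κ x)) ≤
      EReal.exp (-shiftedPotential V ϑ κ y) • ω.restrict K := by
    rw [← withDensity_const]
    exact withDensity_mono ((ae_restrict_mem hmeas).mono fun x hx =>
      EReal.exp_monotone (EReal.neg_le_neg_iff.2 (hy hx)))
  refine ⟨(referenceMeasure ω V ϑ κ K)⁻¹ * ((∫⁻ x, EReal.exp (-shiftedPotential V ϑ κ x) ∂ω)⁻¹ *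
    EReal.exp (-shiftedPotential V ϑ κ y)), ?_, ?_⟩
  · exact ENNReal.mul_ne_top
      (ENNReal.inv_ne_top.2 (hA.referenceMeasure_ne_zero_of_subset hκ hKV hint))
      (ENNReal.mul_ne_top (ENNReal.inv_ne_top.2 (hA.lintegral_exp_shiftedPotential_pos hκ).ne') hB)
  · rw [ProbabilityTheory.cond, mul_smul]
    rw [referenceMeasure, Measure.restrict_smul, restrict_withDensity hmeas, mul_smul]
    gcongr

theorem exists_lintegral_compensatedKernel_ne_top [T2Space X] [LocallyCompactSpace X]
    [IsLocallyFiniteMeasure ω] (hA : IsMeanFieldGas ω g V ϑ) {κ : ℝ} (hκ : 0 ≤ κ) :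
    ∃ μ : ProbabilityMeasure X, ∫⁻ x, ∫⁻ z, compensatedKernel g ϑ x z ∂μ ∂μ ≠ ⊤ ∧
      klDiv μ (referenceMeasure ω V ϑ κ) ≠ ⊤ := by
  obtain ⟨x₀, hx₀⟩ := (hA.potential κ hκ).nonempty
  obtain ⟨K, hK, hx₀K, hKV⟩ := exists_compact_subset (hA.potential κ hκ).isOpen hx₀
  have hint : (interior K).Nonempty := ⟨x₀, hx₀K⟩
  have := hA.isProbabilityMeasure_referenceMeasure hκ
  have hνK := hA.referenceMeasure_ne_zero_of_subset hκ hKV hint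
  obtain ⟨C, hC, hle⟩ := hA.exists_cond_referenceMeasure_le hκ hK hKV hint
  refine ⟨⟨_, cond_isProbabilityMeasure hνK⟩, ?_,
    klDiv_cond_ne_top _ hK.isClosed.measurableSet hνK⟩
  refine ne_top_of_le_ne_top ?_
    (lintegral_mono' hle fun x => lintegral_mono' hle le_rfl)
  simp only [lintegral_smul_measure, smul_eq_mul, lintegral_const_mul' _ _ hC]
  exact ENNReal.mul_ne_top hC (ENNReal.mul_ne_top hC
    (hA.lintegral_compensatedKernel_ne_top hK hK.measure_lt_top.ne))

end FiniteEnergy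

end ReferenceMeasure

section GibbsMeasure

variable [BorelSpace X] [SecondCountableTopology X] [SigmaFinite ω] [ω.IsOpenPosMeasure]

theorem pairGibbs_compensatedKernel (hA : IsMeanFieldGas ω g V ϑ) {β : ℝ} (hβ : 0 ≤ β) (N : ℕ) :
    pairGibbs (compensatedKernel g ϑ) β (referenceMeasure ω V ϑ (β * ((N - 1 : ℕ) : ℝ))) N =
      ((∫⁻ x, EReal.exp (-shiftedPotential V ϑ (β * ((N - 1 : ℕ) : ℝ)) x) ∂ω)⁻¹ ^ N) •
        (Measure.pi fun _ => ω).withDensity fun x => EReal.exp (-gibbsEnergy β g V x) := by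
  set κ := β * ((N - 1 : ℕ) : ℝ)
  have hκ0 : 0 ≤ κ := by positivity
  set Z := ∫⁻ x, EReal.exp (-shiftedPotential V ϑ κ x) ∂ω
  have hU := (hA.potential κ hκ0).measurable
  have hG := measurable_pairSum hA.lowerSemicontinuous_compensatedKernel.measurable N
  have href : referenceMeasure ω V ϑ κ =
      ω.withDensity fun x => Z⁻¹ * EReal.exp (-shiftedPotential V ϑ κ x) :=
    (withDensity_smul _ (by fun_prop)).symm
  have := hA.isProbabilityMeasure_referenceMeasure hκ0
  rw [href] at this
  have hZ : Z⁻¹ ^ N ≠ ⊤ :=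
    ENNReal.pow_ne_top (ENNReal.inv_ne_top.2 (hA.lintegral_exp_shiftedPotential_pos hκ0).ne')
  rw [pairGibbs, href, pi_withDensity ω (by fun_prop), ← withDensity_mul _ (by fun_prop)
    (by fun_prop), ← withDensity_smul' _ _ hZ]
  congr 1 with x
  rw [Pi.mul_apply, Pi.smul_apply, smul_eq_mul,
    exp_neg_gibbsEnergy hA.neg_kernel_le hA.potential_ne_bot hβ, Finset.prod_mul_distrib,
    Finset.prod_const, Finset.card_univ, Fintype.card_fin]
  ring

theorem partitionFunction_pos_and_lt_top [T2Space X] [LocallyCompactSpace X]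
    [IsLocallyFiniteMeasure ω] (hA : IsMeanFieldGas ω g V ϑ) {β : ℝ} (hβ : 0 ≤ β) (N : ℕ) :
    0 < partitionFunction ω β g V N ∧ partitionFunction ω β g V N < ⊤ := by
  have hκ : 0 ≤ β * ((N - 1 : ℕ) : ℝ) := by positivity
  have := hA.isProbabilityMeasure_referenceMeasure hκ
  obtain ⟨μ, hE, hkl⟩ := hA.exists_lintegral_compensatedKernel_ne_top hκ
  have hpos :=
    pairGibbs_univ_pos hA.lowerSemicontinuous_compensatedKernel.measurable hβ hE hkl N
  have hle := pairGibbs_univ_le_one (compensatedKernel g ϑ) β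
    (referenceMeasure ω V ϑ (β * ((N - 1 : ℕ) : ℝ))) N
  have hmass := congrArg (· Set.univ) (hA.pairGibbs_compensatedKernel hβ N)
  simp only [Measure.smul_apply, smul_eq_mul, withDensity_apply _ .univ,
    Measure.restrict_univ] at hmass
  rw [hmass] at hpos hle
  exact ⟨pos_of_ne_zero (right_ne_zero_of_mul hpos.ne'),
    ENNReal.lt_top_of_mul_ne_top_right (ne_top_of_le_ne_top ENNReal.one_ne_top hle)
      (left_ne_zero_of_mul hpos.ne')⟩

theorem empiricalLaw_eq_pairGibbs (hA : IsMeanFieldGas ω g V ϑ) {β : ℝ} (hβ : 0 ≤ β) (N : ℕ)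
    (A : Set (ProbabilityMeasure X)) :
    empiricalLaw ω β g V N A =
      (pairGibbs (compensatedKernel g ϑ) β (referenceMeasure ω V ϑ (β * ((N - 1 : ℕ) : ℝ))) N
        (empiricalEvent N Set.univ))⁻¹ *
      pairGibbs (compensatedKernel g ϑ) β (referenceMeasure ω V ϑ (β * ((N - 1 : ℕ) : ℝ))) N
        (empiricalEvent N A) := by
  have hκ : 0 ≤ β * ((N - 1 : ℕ) : ℝ) := by positivity
  rcases N.eq_zero_or_pos with rfl | hN
  · have hempty : {x : Fin 0 → X | ∃ μ ∈ A, (μ : Measure X) = empiricalMeasure x} = ∅ :=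
      empiricalEvent_zero A
    simp only [empiricalLaw, hempty, empiricalEvent_zero, measure_empty, mul_zero]
  have hZ := hA.lintegral_exp_shiftedPotential_pos hκ
  rw [empiricalEvent_univ hN, hA.pairGibbs_compensatedKernel hβ N, Measure.smul_apply,
    Measure.smul_apply, smul_eq_mul, smul_eq_mul, mul_comm _⁻¹, ← div_eq_mul_inv,
    ENNReal.mul_div_mul_left _ _
      (pow_ne_zero N (ENNReal.inv_ne_zero.2 (hA.potential _ hκ).lintegral_lt_top.ne))
      (ENNReal.pow_ne_top (ENNReal.inv_ne_top.2 hZ.ne')), div_eq_mul_inv, mul_comm,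
    withDensity_apply _ .univ, Measure.restrict_univ]
  rfl

end GibbsMeasure

section Convergence

open scoped BoundedContinuousFunction

variable [OpensMeasurableSpace X] [ω.IsOpenPosMeasure]

variable {ι : Type*} {l : Filter ι} [l.IsCountablyGenerated] {κ : ι → ℝ} {γ : ℝ}

theorem tendsto_lintegral_referenceMeasure (hA : IsMeanFieldGas ω g V ϑ) (hγ : 0 ≤ γ)
    (hκ : ∀ i, 0 ≤ κ i) (hκγ : Tendsto κ l (𝓝 γ)) {u : X → ℝ≥0∞} (hu : Measurable u)
    (hint : ∫⁻ x, ENNReal.ofReal (Real.exp |ϑ x|) * u x ∂(referenceMeasure ω V ϑ γ) ≠ ⊤) :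
    Tendsto (fun i => ∫⁻ x, u x ∂(referenceMeasure ω V ϑ (κ i))) l
      (𝓝 (∫⁻ x, u x ∂(referenceMeasure ω V ϑ γ))) := by
  have := hA.isProbabilityMeasure_referenceMeasure hγ
  simp only [fun i => hA.referenceMeasure_eq_tilted_referenceMeasure hγ (hκ i)]
  exact tendsto_lintegral_tilted hA.measurable_theta (hA.integrable_exp_abs_theta hγ) hu hint
    (tendsto_sub_nhds_zero_iff.2 hκγ)

theorem tendsto_klDiv_referenceMeasure (hA : IsMeanFieldGas ω g V ϑ) (hγ : 0 ≤ γ)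
    (hκ : ∀ i, 0 ≤ κ i) (hκγ : Tendsto κ l (𝓝 γ)) {μ : Measure X} [IsProbabilityMeasure μ]
    (hkl : InformationTheory.klDiv μ (referenceMeasure ω V ϑ γ) ≠ ⊤) :
    Tendsto (fun i => InformationTheory.klDiv μ (referenceMeasure ω V ϑ (κ i))) l
      (𝓝 (InformationTheory.klDiv μ (referenceMeasure ω V ϑ γ))) := by
  have := hA.isProbabilityMeasure_referenceMeasure hγ
  simp only [fun i => hA.referenceMeasure_eq_tilted_referenceMeasure hγ (hκ i)]
  exact tendsto_klDiv_tilted hA.measurable_theta (hA.integrable_exp_abs_theta hγ)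
    (tendsto_sub_nhds_zero_iff.2 hκγ) hkl

theorem tendsto_lintegral_exp_boundedContinuous_referenceMeasure
    (hA : IsMeanFieldGas ω g V ϑ) (hγ : 0 ≤ γ) (hκ : ∀ i, 0 ≤ κ i) (hκγ : Tendsto κ l (𝓝 γ))
    (f : X →ᵇ ℝ) :
    Tendsto (fun i => ∫⁻ x, ENNReal.ofReal (Real.exp (f x)) ∂(referenceMeasure ω V ϑ (κ i))) l
      (𝓝 (∫⁻ x, ENNReal.ofReal (Real.exp (f x)) ∂(referenceMeasure ω V ϑ γ))) := by
  have hf : Measurable f := f.continuous.measurable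
  have hexp := (hA.integrable_exp_abs_theta hγ).lintegral_lt_top
  refine hA.tendsto_lintegral_referenceMeasure hγ hκ hκγ (by fun_prop) (ne_top_of_le_ne_top
    (ENNReal.mul_ne_top hexp.ne (ENNReal.ofReal_ne_top (r := Real.exp ‖f‖))) ?_)
  rw [← lintegral_mul_const' _ _ ENNReal.ofReal_ne_top]
  gcongr with x
  exact f.apply_le_norm x

theorem exists_isExhaustion_eventually_lintegral_exp_le [T2Space X] [LocallyCompactSpace X]
    [SigmaCompactSpace X] (hA : IsMeanFieldGas ω g V ϑ) (hγ : 0 ≤ γ) (hκ : ∀ i, 0 ≤ κ i)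
    (hκγ : Tendsto κ l (𝓝 γ)) :
    ∃ h : X → ℕ, IsExhaustion h ∧
      ∫⁻ x, ENNReal.ofReal (Real.exp (h x)) ∂(referenceMeasure ω V ϑ γ) ≠ ⊤ ∧
      ∃ b : ℝ, ∀ᶠ i in l, ∫⁻ x, ENNReal.ofReal (Real.exp (h x)) ∂(referenceMeasure ω V ϑ (κ i)) ≤
        ENNReal.ofReal (Real.exp b) := by
  have hϑ := hA.measurable_theta
  have := isFiniteMeasure_withDensity_ofReal (hA.integrable_exp_abs_theta hγ).2
  obtain ⟨h, hh, hint⟩ := exists_isExhaustion_lintegral_exp_ne_top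
    ((referenceMeasure ω V ϑ γ).withDensity fun x => ENNReal.ofReal (Real.exp |ϑ x|))
  have hhm := hh.measurable
  rw [lintegral_withDensity_eq_lintegral_mul _ (by fun_prop) (by fun_prop)] at hint
  have hexp : ∫⁻ x, ENNReal.ofReal (Real.exp (h x)) ∂(referenceMeasure ω V ϑ γ) ≠ ⊤ :=
    ne_top_of_le_ne_top hint <| lintegral_mono fun x => le_mul_of_one_le_left' <|
      ENNReal.one_le_ofReal.2 (Real.one_le_exp (abs_nonneg _))
  obtain ⟨b, hb⟩ := ((ENNReal.tendsto_ofReal_atTop.comp Real.tendsto_exp_atTop).eventually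
    (eventually_gt_nhds hexp.lt_top)).exists
  refine ⟨h, hh, hexp, b, ?_⟩
  exact (hA.tendsto_lintegral_referenceMeasure hγ hκ hκγ (by fun_prop) hint).eventually_le_const hb

end Convergence

section LargeDeviations

variable [T2Space X] [LocallyCompactSpace X] [SecondCountableTopology X] [BorelSpace X]
  [SigmaFinite ω] [ω.IsOpenPosMeasure] {γ : ℝ} {β : ℕ → ℝ}

theorem satisfiesLDP_empiricalLaw (hA : IsMeanFieldGas ω g V ϑ) (hγ : 0 < γ)
    (hβ : ∀ N, 0 ≤ β N) (hβγ : Tendsto (fun N : ℕ => (N : ℝ) * β N) atTop (𝓝 γ))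
    (hF : ∃ μ : ProbabilityMeasure X, freeEnergy ω g V ϑ γ μ < ⊤) :
    SatisfiesLDP (fun N => empiricalLaw ω (β N) g V N) (fun N => β N * (N : ℝ) ^ 2)
      fun μ : ProbabilityMeasure X => ENNReal.ofReal γ⁻¹ * (freeEnergy ω g V ϑ γ μ -
        ⨅ μ' : ProbabilityMeasure X, freeEnergy ω g V ϑ γ μ') := by
  have := TopologicalSpace.metrizableSpace_of_t3_secondCountable X
  have hκ (N : ℕ) : 0 ≤ β N * ((N - 1 : ℕ) : ℝ) := mul_nonneg (hβ N) (Nat.cast_nonneg _)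
  have hκγ := tendsto_mul_natCast_sub_one hβγ
  have (N : ℕ) := hA.isProbabilityMeasure_referenceMeasure (hκ N)
  have := hA.isProbabilityMeasure_referenceMeasure hγ.le
  have hG := hA.lowerSemicontinuous_compensatedKernel
  obtain ⟨h, hh, hexp, b, hb⟩ :=
    hA.exists_isExhaustion_eventually_lintegral_exp_le hγ.le hκ hκγ
  exact satisfiesLDP_of_exponential_bounds
    (Q := fun N A => pairGibbs (compensatedKernel g ϑ) (β N)
      (referenceMeasure ω V ϑ (β N * ((N - 1 : ℕ) : ℝ))) N (empiricalEvent N A))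
    (lowerSemicontinuous_meanFieldEnergy hG _ hγ.le)
    (fun r hr => isCompact_meanFieldEnergy_le hG _ hγ.le hh hexp hr)
    (iInf_lt_iff.2 hF).ne (tendsto_mul_natCast_sq_atTop hγ hβγ) (inv_pos.2 hγ)
    (tendsto_inv_mul_natCast_sq_mul_natCast hγ.ne' hβγ)
    (fun N A => hA.empiricalLaw_eq_pairGibbs (hβ N) N A)
    (fun C hC c hc => decaysAtRate_pairGibbs_of_isClosed hG hA.compensatedKernel_symm hγ.le hβ hβγ
      (hA.tendsto_lintegral_exp_boundedContinuous_referenceMeasure hγ.le hκ hκγ) hh hb hC hc)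
    (fun O hO μ hμ hfin => decaysAtMostAtRate_pairGibbs_of_mem_nhds hG.measurable hγ hβ hβγ
      (hA.tendsto_klDiv_referenceMeasure hγ.le hκ hκγ (ENNReal.add_ne_top.1 hfin).2)
      (hO.mem_nhds hμ) hfin)

end LargeDeviations

end IsMeanFieldGas

theorem le_one_add_rpow {p : ℝ} (hp : 1 ≤ p) (t : ℝ≥0∞) : t ≤ 1 + t ^ p := by
  rcases le_total t 1 with ht | ht
  · exact le_add_right ht
  · exact le_add_left (ENNReal.le_rpow_self_of_one_le ht hp)

theorem IsAdmissibleKernel.lintegral_toENNReal_lt_top {n : ℕ} {X : Type*} [MetricSpace X]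
    [MeasurableSpace X] {ω : Measure X} [IsFiniteMeasureOnCompacts ω]
    {g : X → X → EReal} (hg : IsAdmissibleKernel n ω g) {K : Set X} (hK : IsCompact K) :
    ∫⁻ x in K, ∫⁻ z in K, (g x z).toENNReal ∂ω ∂ω < ⊤ := by
  obtain ⟨c, -, hdec⟩ := hg.decomposition
  obtain ⟨gc, gs, p, hp, -, hgc, hsum, hint⟩ := hdec 1 le_rfl
  have hle (x z) : (g x z).toENNReal ≤ 2 + gs x z ^ p := by
    have hgc1 : ((gc x z : ℝ) : EReal).toENNReal ≤ 1 := by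
      rw [EReal.toENNReal_of_ne_top (EReal.coe_ne_top _), EReal.toReal_coe]
      exact ENNReal.ofReal_le_one.2 (by exact_mod_cast hgc x z)
    calc (g x z).toENNReal ≤ ((gc x z : ℝ) : EReal).toENNReal + gs x z := by
          rw [hsum]
          exact EReal.toENNReal_add_le.trans_eq (by rw [EReal.toENNReal_coe])
      _ ≤ 1 + (1 + gs x z ^ p) := add_le_add hgc1 (le_one_add_rpow hp.le _)
      _ = 2 + gs x z ^ p := by rw [← add_assoc, one_add_one_eq_two]
  have hinner (x) : ∫⁻ z in K, (g x z).toENNReal ∂ω ≤ 2 * ω K + ENNReal.ofReal (c 1) :=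
    calc ∫⁻ z in K, (g x z).toENNReal ∂ω ≤ ∫⁻ z in K, (2 + gs x z ^ p) ∂ω := lintegral_mono (hle x)
      _ = 2 * ω K + ∫⁻ z in K, gs x z ^ p ∂ω := by
          rw [lintegral_add_left measurable_const, setLIntegral_const]
      _ ≤ 2 * ω K + ENNReal.ofReal (c 1) := by
          gcongr
          exact (setLIntegral_le_lintegral _ _).trans (hint x)
  have hωK := hK.measure_lt_top (μ := ω)
  refine (lintegral_mono hinner).trans_lt ?_
  rw [setLIntegral_const]
  finiteness

theorem GasAssumptions.isMeanFieldGas {n : ℕ} {X : Type*} [MetricSpace X] [MeasurableSpace X]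
    {ω : Measure X} [IsFiniteMeasureOnCompacts ω] {g : X → X → EReal}
    {V : X → EReal} {ϑ : X → ℝ} (hA : GasAssumptions n ω g V ϑ) : IsMeanFieldGas ω g V ϑ where
  symm := hA.kernel.symm
  lowerSemicontinuous := hA.kernel.lowerSemicontinuous
  lintegral_lt_top _ hK := hA.kernel.lintegral_toENNReal_lt_top hK
  continuous_theta := hA.continuous_theta
  theta_nonneg := hA.theta_nonneg
  neg_kernel_le := hA.neg_kernel_le
  potential_ne_bot x h := by
    obtain ⟨m, hm⟩ := hA.bddBelow 0 le_rfl
    have hx := hm x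
    rw [shiftedPotential_zero, h] at hx
    exact EReal.coe_ne_bot m (le_bot_iff.1 hx)
  potential := hA.potential

theorem mainTheorem10_general {X : Type*} [TopologicalSpace X] [T2Space X] [LocallyCompactSpace X]
    [SecondCountableTopology X] [MeasurableSpace X] [BorelSpace X] {ω : Measure X}
    [IsLocallyFiniteMeasure ω] [ω.IsOpenPosMeasure] {g : X → X → EReal} {V : X → EReal}
    {ϑ : X → ℝ} (hA : IsMeanFieldGas ω g V ϑ) {γ : ℝ} (hγ : 0 < γ) {β : ℕ → ℝ}
    (hβ : ∀ N, 0 ≤ β N) (hβγ : Tendsto (fun N : ℕ => (N : ℝ) * β N) atTop (𝓝 γ)) :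
    (∀ N, 0 < partitionFunction ω (β N) g V N ∧ partitionFunction ω (β N) g V N < ⊤) ∧
    (∃ μ : ProbabilityMeasure X, freeEnergy ω g V ϑ γ μ < ⊤) ∧
    SatisfiesLDP (fun N => empiricalLaw ω (β N) g V N) (fun N => β N * (N : ℝ) ^ 2)
      (fun μ : ProbabilityMeasure X => ENNReal.ofReal γ⁻¹ *
        (freeEnergy ω g V ϑ γ μ - ⨅ μ' : ProbabilityMeasure X, freeEnergy ω g V ϑ γ μ')) := by
  obtain ⟨μ, hE, hkl⟩ := hA.exists_lintegral_compensatedKernel_ne_top hγ.le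
  have hF : freeEnergy ω g V ϑ γ μ < ⊤ :=
    ENNReal.add_lt_top.2 ⟨ENNReal.mul_lt_top ENNReal.ofReal_lt_top hE.lt_top, hkl.lt_top⟩
  exact ⟨fun N => hA.partitionFunction_pos_and_lt_top (hβ N) N, ⟨μ, hF⟩,
    hA.satisfiesLDP_empiricalLaw hγ hβ hβγ ⟨μ, hF⟩⟩

theorem mainTheorem10 {n : ℕ} {X : Type*} [MetricSpace X]
    [ChartedSpace (EuclideanSpace ℝ (Fin n)) X] [IsManifold (𝓡 n) 1 X]
    [RiemannianBundle (fun x : X => TangentSpace (𝓡 n) x)]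
    [IsContinuousRiemannianBundle (EuclideanSpace ℝ (Fin n))
      (fun x : X => TangentSpace (𝓡 n) x)]
    [IsRiemannianManifold (𝓡 n) X] [ConnectedSpace X] [SecondCountableTopology X]
    [MeasurableSpace X] [BorelSpace X]
    (g : X → X → EReal) (V : X → EReal) (ϑ : X → ℝ)
    (hA : GasAssumptions n (riemannianVolume n X) g V ϑ)
    (γ : ℝ) (hγ : 0 < γ) (β : ℕ → ℝ) (hβ : ∀ N, 0 < β N)
    (hβγ : Tendsto (fun N : ℕ => (N : ℝ) * β N) atTop (𝓝 γ)) :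
    (∀ N, 0 < partitionFunction (riemannianVolume n X) (β N) g V N ∧
      partitionFunction (riemannianVolume n X) (β N) g V N < ⊤) ∧
    (∃ μ : ProbabilityMeasure X, freeEnergy (riemannianVolume n X) g V ϑ γ μ < ⊤) ∧
    SatisfiesLDP (fun N => empiricalLaw (riemannianVolume n X) (β N) g V N)
      (fun N => β N * (N : ℝ) ^ 2)
      (fun μ : ProbabilityMeasure X => ENNReal.ofReal γ⁻¹ *
        (freeEnergy (riemannianVolume n X) g V ϑ γ μ -
          ⨅ μ' : ProbabilityMeasure X, freeEnergy (riemannianVolume n X) g V ϑ γ μ')) := by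
  have := ChartedSpace.locallyCompactSpace (EuclideanSpace ℝ (Fin n)) X
  exact mainTheorem10_general hA.isMeanFieldGas hγ (fun N => (hβ N).le) hβγ
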